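/- **Setting.** A seller and a buyer interact for $T$ rounds. In round $t$ a fresh good is for sale; its value $v_t\ge 0$ for the buyer is drawn, independently of the past, from a distribution $F$ on $[0,\infty)$ with mean $\mu$ and finite highest value $B$ in its support. The buyer sees $v_t$ and bids $b_t\ge 0$. A state-based mechanism with current state $s_t$ allocates ($x_t=1$) with probability $x(s_t,b_t)$ and otherwise does not ($x_t=0$), charges $p(s_t,b_t,x_t)$, and draws the next state from a distribution depending on $(s_t,b_t,x_t,p_t)$. Let $u_t(b)=E[v_tx_t-p_t\mid s_t,v_t,b_t=b]$, $U_0(s,v,b)=E[vx-p\mid s,v,b]$ and $U_\ell(s,v,b)=E\big[vx-p+\sup_{b'}U_{\ell-1}(s',v',b')\mid s,v,b\big]$, where $s'$ is the next state and $v'\sim F$. A $k$-lookahead buyer bids in every round $t$ some maximizer $b_t$ of $U_{\min\{k,T-t\}}(s_t,v_t,\cdot)$ (ties may be broken in any way, possibly at random and depending on the past). He is myopic if $k=0$, and infinite-lookahead if $k=T-1$. Write $\mathrm{Rev}^{\mathrm{Mye}}=\sup_y y(1-F(y))$. **Mechanism $M_\infty(\epsilon,\rho,p)$** (for given $F$ and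 $T$). Let $$R=T\mu(1-\epsilon)-\sqrt{4B\mu\sqrt T\ln T}-\sqrt{2B\mu\ln T}\sum_{j=1}^T\tfrac1{\sqrt j}.$$ States are triples $(TP,EP,t)$; the start is $TP=\mu\sqrt T+\sqrt{4B\mu\sqrt T\ln T}$, $EP=0$, $t=1$. The good is allocated with probability $1$ if $TP\ge EP$, with probability $\rho$ if $TP<EP$ and $b_t\ge p$, and with probability $0$ otherwise. The payment is $\min(b_t,R-TP)$ if $x_t=1$ and $TP\le R$, and $0$ otherwise. The next state is $(TP,0,t+1)$ if $TP\ge R$; it is $\big(TP+p_t,\ EP+\mu(1-\epsilon)-\sqrt{2B\mu\ln T/t},\ t+1\big)$ if $R>TP\ge EP$; if $TP<R$ and $TP<EP$, it is $(TP,EP,t+1)$ when $x_t=0$ and $(TP,TP,t+1)$ when $x_t=1$. **Theorem.** For every $\epsilon\in(0,1)$, with $\rho=\epsilon/(2-\epsilon)$ and a suitable choice of the price $p=p(F,T)\ge0$, the mechanism $M_\infty(\epsilon,\rho,p)$ has the following properties for every such $F$. 1. For every $T\ge1$ it is non-payment forceful: $p(s,b,x)\ge0$ and $p(s,0,x)=0$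 for all $s,b,x$. 2. For every $T\ge1$ it is interim individually rational: for all $k\ge 0$, $1\le t\le T$, states $s$ and values $v\ge0$, some bid $b$ has $U_{\min\{k,T-t\}}(s,v,b)\ge0$, and so has every maximizer. 3. It is $(\tfrac\epsilon2,1-\epsilon)$-robust against lookahead attitudes: there is a function $\delta(T)\to0$, depending only on $\epsilon$ and $F$, such that for every $T\ge 1$ the expected average revenue $E[\frac1T\sum_{t\le T}p_t]$ is at least $\frac\epsilon2\mathrm{Rev}^{\mathrm{Mye}}-\delta(T)$ against every myopic buyer, and at least $(1-\epsilon)\mu-\delta(T)$ against every $k$-lookahead buyer with $k\ge1$. 4. For every $T\ge1$ it is per-round ex-post individually rational against a myopic buyer: some myopic buyer's policy satisfies, almost surely, $u_t(b_t)\ge0$ for all $t\le T$. 5. It is, with high probability, per-round ex-post individually rational against an infinite-lookahead buyer: there is $c>0$ such that for all large $T$ some policy of an infinite-lookahead buyer satisfies, with probability at least $1-T^{-c}$, $b_t=v_t$ and $u_t(b_t)\ge0$ for all $t\le T$. 6. Truthful bidding is optimal with high probability: there is $c>0$ such that for all large $T$, if the buyer bids $b_t=v_t$ in every round, then with probability at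 least $1-T^{-c}$, for every $t\le T$ the bid $v_t$ maximizes $U_{T-t}(s_t,v_t,\cdot)$. -/

import Mathlib

open MeasureTheory ProbabilityTheory Filter Topology Set
open scoped NNReal

noncomputable section

namespace RepeatedAuction

/-! ## Valuation distributions -/

/-- A per-round valuation distribution: a probability distribution of a non-negative value,
with a finite highest value. -/
def IsValuationDist (F : Measure ℝ) : Prop :=
  IsProbabilityMeasure F ∧ ∃ C : ℝ, ∀ᵐ v ∂F, v ∈ Icc 0 C

/-- The mean `μ` of the valuation distribution. -/
def mean (F : Measure ℝ) : ℝ := ∫ v, v ∂F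

/-- The highest value in the support of the valuation distribution. -/
def topValue (F : Measure ℝ) : ℝ := sSup F.support

/-- The one-round Myerson revenue `sup_y y (1 - F(y))`. -/
def revMyerson (F : Measure ℝ) : ℝ := ⨆ y : ℝ≥0, (y : ℝ) * (1 - cdf F y)

/-! ## State-based mechanisms -/

/-- A dynamic state-based mechanism with state space `S`. Bids are non-negative reals.
`alloc s b` is the probability that the good is allocated, `pay s b x` is the payment, and
`next s b x p` is the distribution of the next state. -/
structure Mechanism (S : Type) [MeasurableSpace S] where
  alloc : S → ℝ≥0 → unitInterval
  pay : S → ℝ≥0 → Bool → ℝ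
  next : S → ℝ≥0 → Bool → ℝ → ProbabilityMeasure S
  start : S

/-- The utility `v x - p` of one round, for a realized allocation `x`. -/
def linearUtility (v p : ℝ) (x : Bool) : ℝ := (if x then v else 0) - p

section Lookahead

variable {S : Type} [MeasurableSpace S]

/-- The expected utility `u(b) = E[v x - p | s, v, b]` of a single round. -/
def roundUtility (M : Mechanism S) (s : S) (v : ℝ) (b : ℝ≥0) : ℝ :=
  (M.alloc s b : ℝ) * linearUtility v (M.pay s b true) true
    + (1 - (M.alloc s b : ℝ)) * linearUtility v (M.pay s b false) false

/-- The expected `ℓ`-lookahead utility of bidding `b` in state `s` with value `v`: the utility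
of the current round plus the expectation (over the allocation, the next state and the next
value) of the best `(ℓ-1)`-lookahead utility from the next round on. -/
def lookaheadUtility (M : Mechanism S) (F : Measure ℝ) : ℕ → S → ℝ → ℝ≥0 → ℝ
  | 0, s, v, b => roundUtility M s v b
  | ℓ + 1, s, v, b =>
      roundUtility M s v b
        + ((M.alloc s b : ℝ) *
            ∫ s', (∫ v', (⨆ b' : ℝ≥0, lookaheadUtility M F ℓ s' v' b') ∂F)
              ∂(M.next s b true (M.pay s b true) : Measure S)
          + (1 - (M.alloc s b : ℝ)) *
            ∫ s', (∫ v', (⨆ b' : ℝ≥0, lookaheadUtility M F ℓ s' v' b') ∂F)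
              ∂(M.next s b false (M.pay s b false) : Measure S))

/-- `b` maximizes the `ℓ`-lookahead utility in state `s` with value `v`. -/
def IsOptimalBid (M : Mechanism S) (F : Measure ℝ) (ℓ : ℕ) (s : S) (v : ℝ) (b : ℝ≥0) : Prop :=
  ∀ b' : ℝ≥0, lookaheadUtility M F ℓ s v b' ≤ lookaheadUtility M F ℓ s v b

end Lookahead

/-! ## Plays of the repeated auction -/

section Plays

variable {S : Type} [MeasurableSpace S] {Ω : Type} [MeasurableSpace Ω]

/-- The information available at the beginning of round `t`, before the value is drawn: the
states up to round `t`, and the values, bids and allocations of the earlier rounds. -/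
abbrev history (s : ℕ → Ω → S) (v : ℕ → Ω → ℝ) (b : ℕ → Ω → ℝ≥0) (x : ℕ → Ω → Bool) (t : ℕ) :
    MeasurableSpace Ω :=
  (⨆ i ∈ Finset.Icc 1 t, MeasurableSpace.comap (s i) inferInstance) ⊔
    ⨆ i ∈ Finset.Ico 1 t, (MeasurableSpace.comap (v i) inferInstance ⊔
      MeasurableSpace.comap (b i) inferInstance ⊔ MeasurableSpace.comap (x i) inferInstance)

/-- The information at the time of the allocation in round `t`: the history, the current value
and the current bid. -/
abbrev bidHistory (s : ℕ → Ω → S) (v : ℕ → Ω → ℝ) (b : ℕ → Ω → ℝ≥0) (x : ℕ → Ω → Bool) (t : ℕ) :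
    MeasurableSpace Ω :=
  history s v b x t ⊔ (MeasurableSpace.comap (v t) inferInstance ⊔
    MeasurableSpace.comap (b t) inferInstance)

/-- A play of the mechanism `M` for rounds `1, …, T`, on a probability space `(Ω, P)`: states
`s t`, values `v t`, bids `b t` and allocations `x t`. The value of each round has law `F` and is
independent of the past, and the allocation and the next state are drawn as `M` prescribes. The
buyer's strategy is unrestricted: bids may depend on the whole past and on the current value,
and they may be randomized. -/
structure Play (M : Mechanism S) (F : Measure ℝ) (T : ℕ) (P : Measure Ω) where
  s : ℕ → Ω → S
  v : ℕ → Ω → ℝ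
  b : ℕ → Ω → ℝ≥0
  x : ℕ → Ω → Bool
  measurable_s : ∀ t, Measurable (s t)
  measurable_v : ∀ t, Measurable (v t)
  measurable_b : ∀ t, Measurable (b t)
  measurable_x : ∀ t, Measurable (x t)
  start_eq : ∀ ω, s 1 ω = M.start
  value_law : ∀ t ∈ Finset.Icc 1 T, P.map (v t) = F
  value_indep : ∀ t ∈ Finset.Icc 1 T,
    Indep (MeasurableSpace.comap (v t) inferInstance) (history s v b x t) P
  alloc_law : ∀ t ∈ Finset.Icc 1 T,
    P[(fun ω => if x t ω then (1 : ℝ) else 0) | bidHistory s v b x t]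
      =ᵐ[P] fun ω => (M.alloc (s t ω) (b t ω) : ℝ)
  next_law : ∀ t ∈ Finset.Ico 1 T, ∀ A : Set S, MeasurableSet A →
    P[(s (t + 1) ⁻¹' A).indicator (fun _ => (1 : ℝ)) |
        bidHistory s v b x t ⊔ MeasurableSpace.comap (x t) inferInstance]
      =ᵐ[P] fun ω =>
        (M.next (s t ω) (b t ω) (x t ω) (M.pay (s t ω) (b t ω) (x t ω)) : Measure S).real A

variable {M : Mechanism S} {F : Measure ℝ} {T : ℕ} {P : Measure Ω}

/-- The buyer of the play is a `k`-lookahead buyer: in every round `t` he bids so as to maximize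
his `min k (T - t)`-lookahead utility. -/
def Play.IsLookaheadBuyer (π : Play M F T P) (k : ℕ) : Prop :=
  ∀ t ∈ Finset.Icc 1 T, ∀ᵐ ω ∂P,
    IsOptimalBid M F (min k (T - t)) (π.s t ω) (π.v t ω) (π.b t ω)

/-- A myopic buyer is a `0`-lookahead buyer. -/
def Play.IsMyopicBuyer (π : Play M F T P) : Prop := π.IsLookaheadBuyer 0

/-- An infinite-lookahead buyer is a `(T-1)`-lookahead buyer. -/
def Play.IsInfiniteLookaheadBuyer (π : Play M F T P) : Prop := π.IsLookaheadBuyer (T - 1)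

/-- The buyer bids his true value in every round. -/
def Play.IsTruthful (π : Play M F T P) : Prop :=
  ∀ t ∈ Finset.Icc 1 T, ∀ᵐ ω ∂P, (π.b t ω : ℝ) = π.v t ω

/-- The average revenue over the `T` rounds. -/
def Play.avgRevenue (π : Play M F T P) (ω : Ω) : ℝ :=
  (∑ t ∈ Finset.Icc 1 T, M.pay (π.s t ω) (π.b t ω) (π.x t ω)) / T

end Plays

/-! ## Properties of mechanisms -/

section Properties

variable {S : Type} [MeasurableSpace S]

/-- Payments are non-negative, and `0` when the bid is `0`. -/
def NonPaymentForceful (M : Mechanism S) : Prop :=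
  (∀ s b x, 0 ≤ M.pay s b x) ∧ ∀ s x, M.pay s 0 x = 0

/-- Interim individual rationality over `T` rounds, for `k`-lookahead buyers for every `k`: in any
state and with any value some bid has non-negative perceived utility, and so does every optimal
bid. -/
def InterimIR (M : Mechanism S) (F : Measure ℝ) (T : ℕ) : Prop :=
  ∀ k : ℕ, ∀ t ∈ Finset.Icc 1 T, ∀ (s : S) (v : ℝ), 0 ≤ v →
    (∃ b : ℝ≥0, 0 ≤ lookaheadUtility M F (min k (T - t)) s v b) ∧
    ∀ b : ℝ≥0, IsOptimalBid M F (min k (T - t)) s v b →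
      0 ≤ lookaheadUtility M F (min k (T - t)) s v b

/-- `(α, β)`-robustness against lookahead attitudes. The mechanism is a family, indexed by the
valuation distribution and by the number of rounds. The error term depends on the distribution
and on the number of rounds only. -/
def RobustLookahead (M : Measure ℝ → ℕ → Mechanism S) (α β : ℝ) : Prop :=
  ∀ F : Measure ℝ, IsValuationDist F →
    ∃ δ : ℕ → ℝ, Tendsto δ atTop (𝓝 0) ∧
      ∀ T : ℕ, 1 ≤ T → ∀ (Ω : Type) [MeasurableSpace Ω] (P : Measure Ω) [IsProbabilityMeasure P]
        (π : Play (M F T) F T P),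
        (π.IsMyopicBuyer →
          Integrable π.avgRevenue P ∧ α * revMyerson F - δ T ≤ ∫ ω, π.avgRevenue ω ∂P) ∧
        ∀ k : ℕ, 1 ≤ k → π.IsLookaheadBuyer k →
          Integrable π.avgRevenue P ∧ β * mean F - δ T ≤ ∫ ω, π.avgRevenue ω ∂P

/-- Per-round ex-post individual rationality over `T` rounds against a myopic buyer: some myopic
buyer's policy has non-negative utility in every round, on every trajectory. -/
def MyopicPerRoundExPostIR (M : Mechanism S) (F : Measure ℝ) (T : ℕ) : Prop :=
  ∃ (Ω : Type) (_ : MeasurableSpace Ω) (P : Measure Ω) (_ : IsProbabilityMeasure P)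
    (π : Play M F T P), π.IsMyopicBuyer ∧
      ∀ᵐ ω ∂P, ∀ t ∈ Finset.Icc 1 T, 0 ≤ roundUtility M (π.s t ω) (π.v t ω) (π.b t ω)

/-- Per-round ex-post individual rationality against an infinite-lookahead buyer, with
probability `1 - 1 / poly(T)`: some policy that is optimal for an infinite-lookahead buyer has,
with that probability, non-negative utility in every round; and with the same probability this
optimal policy is to bid the true value throughout. -/
def InfinitePerRoundExPostIRWhp (M : ℕ → Mechanism S) (F : Measure ℝ) : Prop :=
  ∃ c : ℝ, 0 < c ∧ ∀ᶠ T : ℕ in atTop,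
    ∃ (Ω : Type) (_ : MeasurableSpace Ω) (P : Measure Ω) (_ : IsProbabilityMeasure P)
      (π : Play (M T) F T P), π.IsInfiniteLookaheadBuyer ∧
        ∃ E : Set Ω, MeasurableSet E ∧ 1 - (T : ℝ) ^ (-c) ≤ P.real E ∧
          ∀ ω ∈ E, ∀ t ∈ Finset.Icc 1 T,
            (π.b t ω : ℝ) = π.v t ω ∧
            0 ≤ roundUtility (M T) (π.s t ω) (π.v t ω) (π.b t ω)

/-- Truthful bidding is optimal for an infinite-lookahead buyer, with probability
`1 - 1 / poly(T)`: when the buyer bids his true value in every round, then with that probability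
each of these bids maximizes the utility of all the remaining rounds. -/
def TruthfulOptimalWhp (M : ℕ → Mechanism S) (F : Measure ℝ) : Prop :=
  ∃ c : ℝ, 0 < c ∧ ∀ᶠ T : ℕ in atTop,
    ∀ (Ω : Type) [MeasurableSpace Ω] (P : Measure Ω) [IsProbabilityMeasure P]
      (π : Play (M T) F T P), π.IsTruthful →
        ∃ E : Set Ω, MeasurableSet E ∧ 1 - (T : ℝ) ^ (-c) ≤ P.real E ∧
          ∀ ω ∈ E, ∀ t ∈ Finset.Icc 1 T,
            IsOptimalBid (M T) F (T - t) (π.s t ω) (π.v t ω) (π.b t ω)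

end Properties

/-! ## The mechanism with vanishing slack and a revenue target -/

/-- The initial credit `μ √T + √(4 B μ √T ln T)`. -/
def initialCredit (F : Measure ℝ) (T : ℕ) : ℝ :=
  mean F * √T + √(4 * topValue F * mean F * √T * Real.log T)

/-- The revenue target
`T μ (1 - ε) - √(4 B μ √T ln T) - √(2 B μ ln T) ∑_{j=1}^T 1 / √j`. -/
def revenueTarget (ε : ℝ) (F : Measure ℝ) (T : ℕ) : ℝ :=
  T * mean F * (1 - ε) - √(4 * topValue F * mean F * √T * Real.log T)
    - √(2 * topValue F * mean F * Real.log T) * ∑ j ∈ Finset.Icc 1 T, 1 / √(j : ℝ)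

/-- The slack `√(2 B μ ln T / t)` of round `t`. -/
def slack (F : Measure ℝ) (T t : ℕ) : ℝ :=
  √(2 * topValue F * mean F * Real.log T / t)

/-- A state `(TP, EP, t)`: the total payment `TP` in good states (including the credit), the
expected payment `EP`, and the number `t` of the current round. -/
abbrev TargetState : Type := ℝ × ℝ × ℕ

/-- The mechanism `M_∞(ε, ρ, p)` for the valuation distribution `F` and `T` rounds. -/
def mInfinity (ε : ℝ) (ρ : unitInterval) (p : ℝ≥0) (F : Measure ℝ) (T : ℕ) :
    Mechanism TargetState where
  alloc := fun (TP, EP, _) b => if EP ≤ TP then 1 else if p ≤ b then ρ else 0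
  pay := fun (TP, _, _) b x =>
    if x = true ∧ TP ≤ revenueTarget ε F T then min (b : ℝ) (revenueTarget ε F T - TP) else 0
  next := fun (TP, EP, t) _ x pt =>
    let s' : TargetState :=
      if revenueTarget ε F T ≤ TP then (TP, 0, t + 1)
      else if EP ≤ TP then (TP + pt, EP + (mean F * (1 - ε) - slack F T t), t + 1)
      else if x then (TP, TP, t + 1)
      else (TP, EP, t + 1)
    ⟨Measure.dirac s', inferInstance⟩
  start := (initialCredit F T, 0, 1)

end RepeatedAuction

end

/-!
Call a state good if `EP ≤ TP`, and bad otherwise. In good states below the target every bid wins,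
even `0`, and is added to `TP`, while `EP` grows by about `μ (1 - ε)` in every round.

**Lookahead.** The heart of the proof is an upper bound on the value of a state to a buyer who plays
optimally, `stateValue_le_sub_min`. In a good state the buyer gets at most the whole welfare of the
remaining rounds, less the cheaper of two ways to stay in good states: to pay what is missing to the
target, or to pay the increases of `EP` in all rounds but the last. In a bad state he loses
`μ (1 - ε)` in addition, and `ρ = ε / (2 - ε)` is the probability for which this surcharge
reproduces itself under the recursion. Falling into a bad state saves less than `μ (1 - ε)`,
because of the slack, so no buyer with lookahead `k ≥ 1` does so while `EP` is below the target
(`stays_good_of_isOptimalBid`), and on almost every play he pays up to the target, except for the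
initial credit and at most one round. The credit and the error terms in the target are `o(T)`.

The same bound identifies optimal bids. For a buyer who sees all the remaining rounds, and for large
`T`, what is missing to the target is the cheaper way. Hence a bid is optimal as soon as it keeps
the state good and leaves time to reach the target (`isOptimalBid_of_keepsOnTrack`). Truthful
bids do so as long as the partial sums of the values do not fall short of those of `EP` minus the
credit, which by Hoeffding's inequality holds throughout with probability at least `1 - 1 / T`
(`eventually_le_creditEvent`). The policy `trackBid` bids truthfully until that would be harmful
and pays the missing amount otherwise, so that it is optimal almost surely and truthful with high
probability.

**Myopic buyers.** A myopic buyer bids `0` in good states, so that `TP` stays at the initial credit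
and `EP` exceeds it after `o(T)` rounds. From then on every good state is the result of a sale in a
bad state, and in a bad state the buyer faces the price `p` with probability `ρ`, and buys
when his value exceeds it. Sales thus have frequency at least
`ρ q / (1 + ρ q) ≥ (ε / 2) q` with `q = 1 - F(p)`, and a nearly optimal `p` yields `(ε / 2)` of the
Myerson revenue (`Play.IsMyopicBuyer.le_integral_avgRevenue`).

The statements that some policy of a buyer has a property need plays to exist. They are built
from independent draws of values and coins (`simPlay`).
-/

namespace RepeatedAuction

/-! ### Valuation distributions -/

lemma IsValuationDist.ae_nonneg {F : Measure ℝ} (hF : IsValuationDist F) : ∀ᵐ v ∂F, 0 ≤ v := by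
  obtain ⟨C, hC⟩ := hF.2
  filter_upwards [hC] with v hv using hv.1

lemma IsValuationDist.integrable {F : Measure ℝ} (hF : IsValuationDist F) :
    Integrable (fun v : ℝ => v) F := by
  have := hF.1
  obtain ⟨C, hC⟩ := hF.2
  exact Integrable.of_mem_Icc 0 C aemeasurable_id hC

lemma mean_nonneg {F : Measure ℝ} (hF : IsValuationDist F) : 0 ≤ mean F :=
  integral_nonneg_of_ae hF.ae_nonneg

lemma bddAbove_support {F : Measure ℝ} (hF : IsValuationDist F) : BddAbove F.support := by
  obtain ⟨C, hC⟩ := hF.2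
  exact ⟨C, fun x hx => (Measure.support_subset_of_isClosed isClosed_Icc hC hx).2⟩

lemma ae_le_topValue {F : Measure ℝ} (hF : IsValuationDist F) : ∀ᵐ v ∂F, v ≤ topValue F := by
  filter_upwards [Measure.support_mem_ae (μ := F)] with v hv
  exact le_csSup (bddAbove_support hF) hv

lemma mean_le_topValue {F : Measure ℝ} (hF : IsValuationDist F) : mean F ≤ topValue F := by
  have := hF.1
  calc mean F ≤ ∫ _, topValue F ∂F :=
        integral_mono_ae hF.integrable (integrable_const _) (ae_le_topValue hF)
    _ = topValue F := by simp

/-! ### Lookahead utilities -/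

section Lookahead

variable {S : Type} [MeasurableSpace S]

/-- The expected utility of the `ℓ + 1` rounds that start in state `s`, for a buyer who bids
optimally in each of them and who has not yet seen the first value. -/
noncomputable def stateValue (M : Mechanism S) (F : Measure ℝ) (ℓ : ℕ) (s : S) : ℝ :=
  ∫ v, (⨆ b : ℝ≥0, lookaheadUtility M F ℓ s v b) ∂F

lemma lookaheadUtility_succ (M : Mechanism S) (F : Measure ℝ) (ℓ : ℕ) (s : S) (v : ℝ) (b : ℝ≥0) :
    lookaheadUtility M F (ℓ + 1) s v b = roundUtility M s v b
      + ((M.alloc s b : ℝ) *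
            ∫ s', stateValue M F ℓ s' ∂(M.next s b true (M.pay s b true) : Measure S)
        + (1 - (M.alloc s b : ℝ)) *
            ∫ s', stateValue M F ℓ s' ∂(M.next s b false (M.pay s b false) : Measure S)) := rfl

lemma roundUtility_eq (M : Mechanism S) (s : S) (v : ℝ) (b : ℝ≥0) :
    roundUtility M s v b = (M.alloc s b : ℝ) * (v - M.pay s b true)
      - (1 - (M.alloc s b : ℝ)) * M.pay s b false := by
  simp only [roundUtility, linearUtility, if_true, Bool.false_eq_true, if_false]
  ring

lemma lookaheadUtility_mono (M : Mechanism S) (F : Measure ℝ) (ℓ : ℕ) (s : S) (b : ℝ≥0) :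
    Monotone fun v => lookaheadUtility M F ℓ s v b := by
  have hround : Monotone fun v => roundUtility M s v b := fun v w h => by
    have := (M.alloc s b).2.1
    simp only [roundUtility_eq]
    gcongr
  cases ℓ with
  | zero => exact hround
  | succ ℓ =>
    intro v w h
    have := hround h
    simp only [lookaheadUtility_succ]
    simpa using this

variable {M : Mechanism S} {F : Measure ℝ}

lemma NonPaymentForceful.roundUtility_le (hM : NonPaymentForceful M) (s : S) (v : ℝ) (b : ℝ≥0) :
    roundUtility M s v b ≤ max v 0 := by
  have h0 := (M.alloc s b).2.1
  have h1 := (M.alloc s b).2.2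
  rw [roundUtility_eq]
  have e1 : (M.alloc s b : ℝ) * (v - M.pay s b true) ≤ (M.alloc s b : ℝ) * max v 0 :=
    mul_le_mul_of_nonneg_left (by linarith [hM.1 s b true, le_max_left v 0]) h0
  have e2 := mul_le_mul_of_nonneg_right h1 (le_max_right v 0)
  have e3 := mul_nonneg (sub_nonneg.2 h1) (hM.1 s b false)
  linarith

lemma NonPaymentForceful.min_le_roundUtility_zero (hM : NonPaymentForceful M) (s : S) (v : ℝ) :
    min v 0 ≤ roundUtility M s v 0 := by
  have h0 := (M.alloc s 0).2.1
  have h1 := (M.alloc s 0).2.2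
  rw [roundUtility_eq, hM.2, hM.2]
  rcases le_total v 0 with hv | hv
  · rw [min_eq_left hv]; nlinarith
  · rw [min_eq_right hv]; nlinarith

lemma integrable_iSup_lookaheadUtility (hF : IsValuationDist F) {ℓ : ℕ} {s : S} {K : ℝ}
    (hub : ∀ v b, lookaheadUtility M F ℓ s v b ≤ max v 0 + K)
    (hlb : ∀ v, min v 0 ≤ lookaheadUtility M F ℓ s v 0) :
    Integrable (fun v => ⨆ b : ℝ≥0, lookaheadUtility M F ℓ s v b) F := by
  have := hF.1
  have hbdd : ∀ v, BddAbove (range fun b : ℝ≥0 => lookaheadUtility M F ℓ s v b) := fun v =>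
    ⟨max v 0 + K, by rintro _ ⟨b, rfl⟩; exact hub v b⟩
  have hmono : Monotone fun v => ⨆ b : ℝ≥0, lookaheadUtility M F ℓ s v b := fun v w h =>
    ciSup_mono (hbdd w) fun b => lookaheadUtility_mono M F ℓ s b h
  obtain ⟨C, hC⟩ := hF.2
  refine Integrable.of_mem_Icc 0 (C + K) hmono.measurable.aemeasurable ?_
  filter_upwards [hC] with v hv
  constructor
  · exact ((min_eq_right hv.1).symm.le.trans (hlb v)).trans (le_ciSup (hbdd v) 0)
  · refine ciSup_le fun b => (hub v b).trans ?_
    rw [max_eq_left hv.1]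
    linarith [hv.2]

lemma stateValue_mem_Icc_of_bounds (hF : IsValuationDist F) {ℓ : ℕ} {s : S} {K : ℝ}
    (hub : ∀ v b, lookaheadUtility M F ℓ s v b ≤ max v 0 + K)
    (hlb : ∀ v, min v 0 ≤ lookaheadUtility M F ℓ s v 0) :
    stateValue M F ℓ s ∈ Icc 0 (mean F + K) := by
  have := hF.1
  constructor
  · refine integral_nonneg_of_ae ?_
    filter_upwards [hF.ae_nonneg] with v hv
    refine ((min_eq_right hv).symm.le.trans (hlb v)).trans
      (le_ciSup (f := fun b : ℝ≥0 => lookaheadUtility M F ℓ s v b) ⟨max v 0 + K, ?_⟩ 0)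
    rintro _ ⟨b, rfl⟩
    exact hub v b
  · calc stateValue M F ℓ s ≤ ∫ v, (v + K) ∂F := by
          refine integral_mono_ae (integrable_iSup_lookaheadUtility hF hub hlb)
            (hF.integrable.add (integrable_const _)) ?_
          filter_upwards [hF.ae_nonneg] with v hv
          refine ciSup_le fun b => (hub v b).trans ?_
          rw [max_eq_left hv]
      _ = mean F + K := by
          rw [integral_add hF.integrable (integrable_const _)]
          simp [mean]

lemma lookaheadUtility_bounds (hM : NonPaymentForceful M) (hF : IsValuationDist F) (ℓ : ℕ) :
    ∀ s, (∀ v b, lookaheadUtility M F ℓ s v b ≤ max v 0 + ℓ * mean F) ∧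
      ∀ v, min v 0 ≤ lookaheadUtility M F ℓ s v 0 := by
  induction ℓ with
  | zero =>
    refine fun s => ⟨fun v b => ?_, fun v => hM.min_le_roundUtility_zero s v⟩
    simpa [lookaheadUtility] using hM.roundUtility_le s v b
  | succ ℓ ih =>
    have hV : ∀ s, stateValue M F ℓ s ∈ Icc 0 (mean F + ℓ * mean F) := fun s =>
      stateValue_mem_Icc_of_bounds hF (ih s).1 (ih s).2
    have hI : ∀ ν : ProbabilityMeasure S,
        ∫ s', stateValue M F ℓ s' ∂(ν : Measure S) ∈ Icc 0 (mean F + ℓ * mean F) := fun ν => by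
      refine ⟨integral_nonneg fun s => (hV s).1, ?_⟩
      have := norm_integral_le_of_norm_le_const (μ := (ν : Measure S))
        (ae_of_all _ fun s => by
          rw [Real.norm_eq_abs, abs_of_nonneg (hV s).1]; exact (hV s).2)
      simp only [probReal_univ, mul_one] at this
      exact (le_abs_self _).trans this
    intro s
    refine ⟨fun v b => ?_, fun v => ?_⟩
    · have h0 := (M.alloc s b).2.1
      have h1 := (M.alloc s b).2.2
      rw [lookaheadUtility_succ]
      have e1 := mul_le_mul_of_nonneg_left (hI (M.next s b true (M.pay s b true))).2 h0
      have e2 := mul_le_mul_of_nonneg_left (hI (M.next s b false (M.pay s b false))).2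
        (sub_nonneg.2 h1)
      have e3 := hM.roundUtility_le s v b
      push_cast
      linarith
    · have h0 := (M.alloc s 0).2.1
      have h1 := (M.alloc s 0).2.2
      rw [lookaheadUtility_succ]
      have e1 := mul_nonneg h0 (hI (M.next s 0 true (M.pay s 0 true))).1
      have e2 := mul_nonneg (sub_nonneg.2 h1) (hI (M.next s 0 false (M.pay s 0 false))).1
      have e3 := hM.min_le_roundUtility_zero s v
      linarith

lemma bddAbove_lookaheadUtility (hM : NonPaymentForceful M) (hF : IsValuationDist F) (ℓ : ℕ)
    (s : S) (v : ℝ) : BddAbove (range fun b : ℝ≥0 => lookaheadUtility M F ℓ s v b) :=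
  ⟨max v 0 + ℓ * mean F, by
    rintro _ ⟨b, rfl⟩; exact (lookaheadUtility_bounds hM hF ℓ s).1 v b⟩

/-- Upper bounds on the utility of every bid pass to the value of a state. -/
lemma stateValue_le_of_forall (hM : NonPaymentForceful M) (hF : IsValuationDist F) {ℓ : ℕ} {s : S}
    {κ K : ℝ} (h : ∀ v, 0 ≤ v → ∀ b, lookaheadUtility M F ℓ s v b ≤ κ * v + K) :
    stateValue M F ℓ s ≤ κ * mean F + K := by
  have := hF.1
  have hb := lookaheadUtility_bounds hM hF ℓ s
  calc stateValue M F ℓ s ≤ ∫ v, (κ * v + K) ∂F := by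
        refine integral_mono_ae (integrable_iSup_lookaheadUtility hF hb.1 hb.2)
          ((hF.integrable.const_mul κ).add (integrable_const _)) ?_
        filter_upwards [hF.ae_nonneg] with v hv
        exact ciSup_le fun b => h v hv b
    _ = κ * mean F + K := by
        rw [integral_add (hF.integrable.const_mul κ) (integrable_const _), integral_const_mul]
        simp [mean]

/-- The utility of any single bid is a lower bound on the value of a state. -/
lemma le_stateValue (hM : NonPaymentForceful M) (hF : IsValuationDist F) {ℓ : ℕ} {s : S}
    {K : ℝ} (b : ℝ≥0) (h : ∀ v, v + K ≤ lookaheadUtility M F ℓ s v b) :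
    mean F + K ≤ stateValue M F ℓ s := by
  have := hF.1
  have hb := lookaheadUtility_bounds hM hF ℓ s
  calc mean F + K = ∫ v, (v + K) ∂F := by
        rw [integral_add hF.integrable (integrable_const _)]
        simp [mean]
    _ ≤ stateValue M F ℓ s := by
        refine integral_mono_ae (hF.integrable.add (integrable_const _))
          (integrable_iSup_lookaheadUtility hF hb.1 hb.2) ?_
        filter_upwards with v
        exact (h v).trans (le_ciSup (bddAbove_lookaheadUtility hM hF ℓ s v) b)

lemma stateValue_le_mul_mean (hM : NonPaymentForceful M) (hF : IsValuationDist F) (ℓ : ℕ)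
    (s : S) : stateValue M F ℓ s ≤ (ℓ + 1) * mean F := by
  have hb := lookaheadUtility_bounds hM hF ℓ s
  have := (stateValue_mem_Icc_of_bounds hF hb.1 hb.2).2
  linarith

/-- A buyer who is never forced to pay may bid `0`, so that his optimal utility is
non-negative. -/
lemma NonPaymentForceful.interimIR (hM : NonPaymentForceful M) (hF : IsValuationDist F) (T : ℕ) :
    InterimIR M F T := by
  intro k t _ s v hv
  have h0 : 0 ≤ lookaheadUtility M F (min k (T - t)) s v 0 :=
    (min_eq_right hv).symm.le.trans ((lookaheadUtility_bounds hM hF _ s).2 v)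
  exact ⟨⟨0, h0⟩, fun b hb => h0.trans (hb 0)⟩

end Lookahead

/-! ### One round of the mechanism -/

/-- The increase `μ (1 - ε) - √(2 B μ ln T / t)` of the expected payment in a round `t` that starts
in a good state, that is, in a state with `EP ≤ TP`. -/
noncomputable def expStep (ε : ℝ) (F : Measure ℝ) (T t : ℕ) : ℝ := mean F * (1 - ε) - slack F T t

/-- The total increase of the expected payment over `m` consecutive rounds in good states, the
first of which is round `t`. -/
noncomputable def cumStep (ε : ℝ) (F : Measure ℝ) (T t m : ℕ) : ℝ :=
  ∑ j ∈ Finset.range m, expStep ε F T (t + j)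

/-- The state after a round of `mInfinity` with allocation `x` and payment `pt`. -/
noncomputable def nextState (ε : ℝ) (F : Measure ℝ) (T : ℕ) (s : TargetState) (x : Bool)
    (pt : ℝ) : TargetState :=
  if revenueTarget ε F T ≤ s.1 then (s.1, 0, s.2.2 + 1)
  else if s.2.1 ≤ s.1 then (s.1 + pt, s.2.1 + expStep ε F T s.2.2, s.2.2 + 1)
  else if x then (s.1, s.1, s.2.2 + 1)
  else (s.1, s.2.1, s.2.2 + 1)

lemma slack_nonneg (F : Measure ℝ) (T t : ℕ) : 0 ≤ slack F T t := Real.sqrt_nonneg _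

lemma expStep_le (ε : ℝ) (F : Measure ℝ) (T t : ℕ) : expStep ε F T t ≤ mean F * (1 - ε) := by
  have := slack_nonneg F T t
  unfold expStep
  linarith

@[simp] lemma cumStep_zero (ε : ℝ) (F : Measure ℝ) (T t : ℕ) : cumStep ε F T t 0 = 0 := by
  simp [cumStep]

lemma cumStep_succ (ε : ℝ) (F : Measure ℝ) (T t m : ℕ) :
    cumStep ε F T t (m + 1) = expStep ε F T t + cumStep ε F T (t + 1) m := by
  simp only [cumStep, Finset.sum_range_succ', Nat.add_zero]
  rw [add_comm]
  congr 1
  refine Finset.sum_congr rfl fun j _ => ?_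
  congr 1
  ring

section MInfinity

variable {ε : ℝ} {ρ : unitInterval} {p : ℝ≥0} {F : Measure ℝ} {T : ℕ}

lemma mInfinity_next (s : TargetState) (b : ℝ≥0) (x : Bool) (pt : ℝ) :
    ((mInfinity ε ρ p F T).next s b x pt : Measure TargetState)
      = Measure.dirac (nextState ε F T s x pt) := rfl

lemma mInfinity_alloc (s : TargetState) (b : ℝ≥0) :
    (mInfinity ε ρ p F T).alloc s b = if s.2.1 ≤ s.1 then 1 else if p ≤ b then ρ else 0 := rfl

lemma mInfinity_pay (s : TargetState) (b : ℝ≥0) (x : Bool) :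
    (mInfinity ε ρ p F T).pay s b x = if x = true ∧ s.1 ≤ revenueTarget ε F T then
      min (b : ℝ) (revenueTarget ε F T - s.1) else 0 := rfl

lemma mInfinity_nonPaymentForceful : NonPaymentForceful (mInfinity ε ρ p F T) := by
  refine ⟨fun s b x => ?_, fun s x => ?_⟩
  · rw [mInfinity_pay]
    split_ifs with h
    · exact le_min b.coe_nonneg (by linarith [h.2])
    · exact le_rfl
  · rw [mInfinity_pay]
    split_ifs with h
    · exact min_eq_left (by simpa using h.2)
    · rfl

lemma mInfinity_pay_false (s : TargetState) (b : ℝ≥0) :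
    (mInfinity ε ρ p F T).pay s b false = 0 := by
  simp [mInfinity_pay]

lemma mInfinity_roundUtility (s : TargetState) (v : ℝ) (b : ℝ≥0) :
    roundUtility (mInfinity ε ρ p F T) s v b
      = ((mInfinity ε ρ p F T).alloc s b : ℝ) * (v - (mInfinity ε ρ p F T).pay s b true) := by
  rw [roundUtility_eq, mInfinity_pay_false]
  ring

lemma mInfinity_lookaheadUtility_succ (ℓ : ℕ) (s : TargetState) (v : ℝ) (b : ℝ≥0) :
    lookaheadUtility (mInfinity ε ρ p F T) F (ℓ + 1) s v b
      = ((mInfinity ε ρ p F T).alloc s b : ℝ) * (v - (mInfinity ε ρ p F T).pay s b true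
          + stateValue (mInfinity ε ρ p F T) F ℓ
              (nextState ε F T s true ((mInfinity ε ρ p F T).pay s b true)))
        + (1 - ((mInfinity ε ρ p F T).alloc s b : ℝ)) *
            stateValue (mInfinity ε ρ p F T) F ℓ (nextState ε F T s false 0) := by
  rw [lookaheadUtility_succ, mInfinity_roundUtility, mInfinity_next, mInfinity_next,
    integral_dirac, integral_dirac, mInfinity_pay_false]
  ring

section RoundFormulas

variable {TP EP v : ℝ} {t ℓ : ℕ} {b : ℝ≥0}

lemma pay_true_of_le (h : TP ≤ revenueTarget ε F T) :
    (mInfinity ε ρ p F T).pay (TP, EP, t) b true = min (b : ℝ) (revenueTarget ε F T - TP) := by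
  simp [mInfinity_pay, h]

lemma pay_of_target_le (h : revenueTarget ε F T ≤ TP) (x : Bool) :
    (mInfinity ε ρ p F T).pay (TP, EP, t) b x = 0 := by
  rw [mInfinity_pay]
  split_ifs with h1
  · have : TP = revenueTarget ε F T := le_antisymm h1.2 h
    simp [this]
  · rfl

lemma roundUtility_good (hR : TP < revenueTarget ε F T) (hE : EP ≤ TP) :
    roundUtility (mInfinity ε ρ p F T) (TP, EP, t) v b
      = v - min (b : ℝ) (revenueTarget ε F T - TP) := by
  rw [mInfinity_roundUtility, pay_true_of_le hR.le, mInfinity_alloc]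
  simp [hE]

lemma lookaheadUtility_succ_good (hR : TP < revenueTarget ε F T) (hE : EP ≤ TP) :
    lookaheadUtility (mInfinity ε ρ p F T) F (ℓ + 1) (TP, EP, t) v b
      = v - min (b : ℝ) (revenueTarget ε F T - TP) + stateValue (mInfinity ε ρ p F T) F ℓ
          (TP + min (b : ℝ) (revenueTarget ε F T - TP), EP + expStep ε F T t, t + 1) := by
  rw [mInfinity_lookaheadUtility_succ, pay_true_of_le hR.le, mInfinity_alloc]
  simp [hE, nextState, not_le.2 hR]

lemma roundUtility_bad (hR : TP < revenueTarget ε F T) (hE : TP < EP) :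
    roundUtility (mInfinity ε ρ p F T) (TP, EP, t) v b
      = if p ≤ b then ρ * (v - min (b : ℝ) (revenueTarget ε F T - TP)) else 0 := by
  rw [mInfinity_roundUtility, pay_true_of_le hR.le, mInfinity_alloc]
  simp only [not_le.2 hE, if_false]
  split_ifs <;> simp

lemma lookaheadUtility_succ_bad (hR : TP < revenueTarget ε F T) (hE : TP < EP) :
    lookaheadUtility (mInfinity ε ρ p F T) F (ℓ + 1) (TP, EP, t) v b
      = if p ≤ b then ρ * (v - min (b : ℝ) (revenueTarget ε F T - TP)
            + stateValue (mInfinity ε ρ p F T) F ℓ (TP, TP, t + 1))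
          + (1 - ρ) * stateValue (mInfinity ε ρ p F T) F ℓ (TP, EP, t + 1)
        else stateValue (mInfinity ε ρ p F T) F ℓ (TP, EP, t + 1) := by
  rw [mInfinity_lookaheadUtility_succ, pay_true_of_le hR.le, mInfinity_alloc]
  have h1 : ¬ EP ≤ TP := not_le.2 hE
  simp only [h1, if_false, nextState, not_le.2 hR, if_true, Bool.false_eq_true]
  split_ifs with h2 <;> simp

lemma roundUtility_done (hR : revenueTarget ε F T ≤ TP) (hE : EP ≤ TP) :
    roundUtility (mInfinity ε ρ p F T) (TP, EP, t) v b = v := by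
  rw [mInfinity_roundUtility, pay_of_target_le hR, mInfinity_alloc]
  simp [hE]

lemma lookaheadUtility_succ_done (hR : revenueTarget ε F T ≤ TP) (hE : EP ≤ TP) :
    lookaheadUtility (mInfinity ε ρ p F T) F (ℓ + 1) (TP, EP, t) v b
      = v + stateValue (mInfinity ε ρ p F T) F ℓ (TP, 0, t + 1) := by
  rw [mInfinity_lookaheadUtility_succ, pay_of_target_le hR, mInfinity_alloc]
  simp [hE, nextState, hR]

/-- Once the target is reached, the bids no longer matter. -/
lemma isOptimalBid_of_target_le (hR : revenueTarget ε F T ≤ TP) (hE : EP ≤ TP) (ℓ : ℕ) :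
    IsOptimalBid (mInfinity ε ρ p F T) F ℓ (TP, EP, t) v b := by
  intro b'
  cases ℓ with
  | zero => simp only [lookaheadUtility]; rw [roundUtility_done hR hE, roundUtility_done hR hE]
  | succ ℓ => rw [lookaheadUtility_succ_done hR hE, lookaheadUtility_succ_done hR hE]

end RoundFormulas

/-! ### Bounds on the value of a state -/

section ValueBounds

variable {TP EP v : ℝ} {t ℓ : ℕ} {b : ℝ≥0}

/-- The utility of a bid in a good state, given bounds on the values of the states of the next
round. -/
lemma lookaheadUtility_good_le_of (hF : IsValuationDist F) (hε1 : ε < 1)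
    (hgood : ∀ TP EP : ℝ, TP < revenueTarget ε F T → EP ≤ TP →
      stateValue (mInfinity ε ρ p F T) F ℓ (TP, EP, t + 1) ≤ (ℓ + 1) * mean F
        - min (revenueTarget ε F T - TP) (cumStep ε F T (t + 1) ℓ - (TP - EP)))
    (hbad : ∀ TP EP : ℝ, TP < revenueTarget ε F T → TP < EP →
      stateValue (mInfinity ε ρ p F T) F ℓ (TP, EP, t + 1) ≤ (ℓ + 1) * mean F
        - mean F * (1 - ε) - min (revenueTarget ε F T - TP) (cumStep ε F T (t + 1) ℓ))
    (hR : TP < revenueTarget ε F T) (hE : EP ≤ TP) :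
    lookaheadUtility (mInfinity ε ρ p F T) F (ℓ + 1) (TP, EP, t) v b
      ≤ v + (ℓ + 1) * mean F
        - min (revenueTarget ε F T - TP) (cumStep ε F T t (ℓ + 1) - (TP - EP)) := by
  have hc : 0 ≤ mean F * (1 - ε) := mul_nonneg (mean_nonneg hF) (by linarith)
  have hst := expStep_le ε F T t
  rw [lookaheadUtility_succ_good hR hE, cumStep_succ]
  set z := min (b : ℝ) (revenueTarget ε F T - TP) with hz
  have hz0 : 0 ≤ z := le_min b.coe_nonneg (by linarith)
  have hz1 : z ≤ revenueTarget ε F T - TP := min_le_right _ _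
  set A := expStep ε F T t
  set D := cumStep ε F T (t + 1) ℓ
  rcases le_or_gt (revenueTarget ε F T) (TP + z) with h1 | h1
  · have := stateValue_le_mul_mean (M := mInfinity ε ρ p F T) mInfinity_nonPaymentForceful hF ℓ
      (TP + z, EP + A, t + 1)
    have := min_le_left (revenueTarget ε F T - TP) (A + D - (TP - EP))
    linarith
  · rcases le_or_gt (EP + A) (TP + z) with h2 | h2
    · have h3 := hgood (TP + z) (EP + A) h1 h2
      rcases min_choice (revenueTarget ε F T - (TP + z)) (D - (TP + z - (EP + A))) with h4 | h4 <;>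
        rw [h4] at h3
      · have := min_le_left (revenueTarget ε F T - TP) (A + D - (TP - EP))
        linarith
      · have := min_le_right (revenueTarget ε F T - TP) (A + D - (TP - EP))
        linarith
    · have h3 := hbad (TP + z) (EP + A) h1 h2
      rcases min_choice (revenueTarget ε F T - (TP + z)) D with h4 | h4 <;> rw [h4] at h3
      · have := min_le_left (revenueTarget ε F T - TP) (A + D - (TP - EP))
        linarith
      · have := min_le_right (revenueTarget ε F T - TP) (A + D - (TP - EP))
        linarith

/-- The value of a good state falls short of the welfare of the remaining rounds by at least the
cheaper of two ways to stay in good states: to pay up to the target, or to pay the expected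
payment of every round but the last. In a bad state it falls short by a further `μ (1 - ε)`.
The choice of `ρ` makes this surcharge self-reproducing: with probability `1 - ρ` a bad round
loses the good, and leaves the buyer in a bad state, and `(1 - ρ) (μ + μ (1 - ε))` is
`2 μ (1 - ε)`. -/
lemma stateValue_le_sub_min (hF : IsValuationDist F) (hε0 : 0 < ε) (hε1 : ε < 1)
    (hρ : (ρ : ℝ) = ε / (2 - ε)) (ℓ : ℕ) : ∀ t : ℕ, ∀ TP EP : ℝ, TP < revenueTarget ε F T →
      (EP ≤ TP → stateValue (mInfinity ε ρ p F T) F ℓ (TP, EP, t) ≤ (ℓ + 1) * mean F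
        - min (revenueTarget ε F T - TP) (cumStep ε F T t ℓ - (TP - EP))) ∧
      (TP < EP → stateValue (mInfinity ε ρ p F T) F ℓ (TP, EP, t) ≤ (ℓ + 1) * mean F
        - mean F * (1 - ε) - min (revenueTarget ε F T - TP) (cumStep ε F T t ℓ)) := by
  have hM : NonPaymentForceful (mInfinity ε ρ p F T) := mInfinity_nonPaymentForceful
  have hμ := mean_nonneg hF
  have hc : 0 ≤ mean F * (1 - ε) := mul_nonneg hμ (by linarith)
  have hρ0 := ρ.2.1
  have hρ1 := ρ.2.2
  have hρ2 : (1 - (ρ : ℝ)) * (2 - ε) = 2 * (1 - ε) := by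
    rw [hρ]
    field_simp [show (2 - ε) ≠ 0 by linarith]
    ring
  induction ℓ with
  | zero =>
    refine fun t TP EP hR => ⟨fun hE => ?_, fun hE => ?_⟩
    · have h1 := stateValue_le_mul_mean hM hF 0 (TP, EP, t)
      have h2 := min_le_right (revenueTarget ε F T - TP) (cumStep ε F T t 0 - (TP - EP))
      rw [cumStep_zero] at *
      linarith
    · have h1 : stateValue (mInfinity ε ρ p F T) F 0 (TP, EP, t) ≤ ρ * mean F + 0 := by
        refine stateValue_le_of_forall hM hF fun v hv b => ?_
        simp only [lookaheadUtility]
        rw [roundUtility_bad hR hE]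
        have := le_min b.coe_nonneg (by linarith : 0 ≤ revenueTarget ε F T - TP)
        split_ifs with hb
        · nlinarith
        · positivity
      have h2 := min_le_right (revenueTarget ε F T - TP) (cumStep ε F T t 0)
      rw [cumStep_zero] at *
      have h3 : (1 - ε) ≤ 1 - (ρ : ℝ) := by nlinarith
      have := mul_le_mul_of_nonneg_left h3 hμ
      push_cast
      linarith
  | succ ℓ ih =>
    refine fun t TP EP hR => ⟨fun hE => ?_, fun hE => ?_⟩
    · have h1 := stateValue_le_of_forall (ℓ := ℓ + 1) (s := (TP, EP, t)) (κ := 1)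
        (K := (ℓ + 1) * mean F
          - min (revenueTarget ε F T - TP) (cumStep ε F T t (ℓ + 1) - (TP - EP))) hM hF
        fun v hv b => by
          have := lookaheadUtility_good_le_of (v := v) (b := b) (p := p) (ρ := ρ) hF hε1
            (fun TP EP h h' => (ih (t + 1) TP EP h).1 h')
            (fun TP EP h h' => (ih (t + 1) TP EP h).2 h') hR hE
          linarith
      push_cast
      linarith
    · set D := cumStep ε F T (t + 1) ℓ with hD
      set L := min (revenueTarget ε F T - TP) D with hL
      have hg := (ih (t + 1) TP TP hR).1 le_rfl
      have hb := (ih (t + 1) TP EP hR).2 hE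
      rw [sub_self, sub_zero] at hg
      have h1 := stateValue_le_of_forall (ℓ := ℓ + 1) (s := (TP, EP, t)) (κ := ρ)
        (K := (ℓ + 1) * mean F - L - (1 - ρ) * (mean F * (1 - ε))) hM hF fun v hv b => by
          rw [lookaheadUtility_succ_bad hR hE]
          have hz := le_min b.coe_nonneg (by linarith : 0 ≤ revenueTarget ε F T - TP)
          split_ifs with hpb
          · have e1 := mul_le_mul_of_nonneg_left hg hρ0
            have e2 := mul_le_mul_of_nonneg_left hb (sub_nonneg.2 hρ1)
            have e3 := mul_nonneg hρ0 hz
            linarith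
          · have e1 := mul_nonneg hρ0 hv
            have e2 := mul_nonneg hρ0 hc
            linarith
      have h2 : min (revenueTarget ε F T - TP) (cumStep ε F T t (ℓ + 1))
          ≤ L + mean F * (1 - ε) := by
        have := expStep_le ε F T t
        rw [cumStep_succ, hL, ← hD]
        rcases min_choice (revenueTarget ε F T - TP) D with h4 | h4 <;> rw [h4]
        · exact (min_le_left _ _).trans (by linarith)
        · exact (min_le_right _ _).trans (by linarith)
      have h3 : (1 - (ρ : ℝ)) * (mean F + mean F * (1 - ε)) = 2 * (mean F * (1 - ε)) := by
        linear_combination mean F * hρ2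
      push_cast
      linarith

lemma stateValue_done (hF : IsValuationDist F) (ℓ : ℕ) :
    ∀ t : ℕ, ∀ TP EP : ℝ, revenueTarget ε F T ≤ TP → 0 ≤ TP → EP ≤ TP →
      (ℓ + 1) * mean F ≤ stateValue (mInfinity ε ρ p F T) F ℓ (TP, EP, t) := by
  have hM : NonPaymentForceful (mInfinity ε ρ p F T) := mInfinity_nonPaymentForceful
  induction ℓ with
  | zero =>
    intro t TP EP hR h0 hE
    have := le_stateValue (ℓ := 0) (s := (TP, EP, t)) (K := 0) hM hF 0 fun v => by
      simp only [lookaheadUtility]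
      rw [roundUtility_done hR hE, add_zero]
    push_cast
    linarith
  | succ ℓ ih =>
    intro t TP EP hR h0 hE
    have := le_stateValue (ℓ := ℓ + 1) (s := (TP, EP, t)) (K := (ℓ + 1) * mean F) hM hF 0
      fun v => by
        rw [lookaheadUtility_succ_done hR hE]
        linarith [ih (t + 1) TP 0 hR h0 h0]
    push_cast
    linarith

/-- Paying up to the target at once wins all the remaining goods. -/
lemma le_lookaheadUtility_of_eq_target (hF : IsValuationDist F) (ht : 0 ≤ TP)
    (hR : TP < revenueTarget ε F T) (hE : EP ≤ TP)
    (hE' : EP + expStep ε F T t ≤ revenueTarget ε F T) (ℓ : ℕ)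
    (hb : revenueTarget ε F T - TP ≤ b) :
    v + ℓ * mean F - (revenueTarget ε F T - TP)
      ≤ lookaheadUtility (mInfinity ε ρ p F T) F ℓ (TP, EP, t) v b := by
  cases ℓ with
  | zero =>
    simp only [lookaheadUtility]
    rw [roundUtility_good hR hE, min_eq_right hb]
    simp
  | succ ℓ =>
    rw [lookaheadUtility_succ_good hR hE, min_eq_right hb]
    have := stateValue_done (ρ := ρ) (p := p) hF ℓ (t + 1)
      (TP + (revenueTarget ε F T - TP)) (EP + expStep ε F T t) (by linarith) (by linarith)
      (by linarith)
    push_cast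
    linarith

lemma le_stateValue_of_target (hF : IsValuationDist F) (ht : 0 ≤ TP)
    (hR : TP < revenueTarget ε F T) (hE : EP ≤ TP)
    (hE' : EP + expStep ε F T t ≤ revenueTarget ε F T) (ℓ : ℕ) :
    (ℓ + 1) * mean F - (revenueTarget ε F T - TP)
      ≤ stateValue (mInfinity ε ρ p F T) F ℓ (TP, EP, t) := by
  have := le_stateValue (M := mInfinity ε ρ p F T) (ℓ := ℓ) (s := (TP, EP, t))
    (K := ℓ * mean F - (revenueTarget ε F T - TP)) mInfinity_nonPaymentForceful hF
    (Real.toNNReal (revenueTarget ε F T - TP)) fun v => by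
      have := le_lookaheadUtility_of_eq_target (v := v) (ρ := ρ) (p := p)
        (b := Real.toNNReal (revenueTarget ε F T - TP)) hF ht hR hE hE' ℓ
        (Real.le_coe_toNNReal _)
      linarith
  linarith

/-- The lower bound that comes from paying exactly the expected payment in every round but the
last. -/
lemma le_stateValue_of_cumStep (hF : IsValuationDist F) (ℓ : ℕ) : ∀ t : ℕ, ∀ TP EP : ℝ,
    (∀ j, t ≤ j → 0 ≤ expStep ε F T j) → 0 ≤ TP → EP ≤ TP →
      TP + cumStep ε F T t ℓ ≤ revenueTarget ε F T →
      (ℓ + 1) * mean F - cumStep ε F T t ℓ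
        ≤ stateValue (mInfinity ε ρ p F T) F ℓ (TP, EP, t) := by
  have hM : NonPaymentForceful (mInfinity ε ρ p F T) := mInfinity_nonPaymentForceful
  induction ℓ with
  | zero =>
    intro t TP EP hst h0 hE hR
    rw [cumStep_zero, add_zero] at hR
    have := le_stateValue (ℓ := 0) (s := (TP, EP, t)) (K := 0) hM hF 0 fun v => by
      simp only [lookaheadUtility]
      rw [mInfinity_roundUtility, hM.2, mInfinity_alloc]
      simp [hE]
    rw [cumStep_zero]
    push_cast
    linarith
  | succ ℓ ih =>
    intro t TP EP hst h0 hE hR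
    have hA := hst t le_rfl
    have hD : 0 ≤ cumStep ε F T (t + 1) ℓ :=
      Finset.sum_nonneg fun j _ => hst _ (by omega)
    rw [cumStep_succ] at hR ⊢
    rcases le_or_gt (revenueTarget ε F T) TP with h1 | h1
    · have := stateValue_done (ρ := ρ) (p := p) hF (ℓ + 1) t TP EP h1 h0 hE
      linarith
    · have := le_stateValue (ℓ := ℓ + 1) (s := (TP, EP, t))
        (K := (ℓ + 1) * mean F - (expStep ε F T t + cumStep ε F T (t + 1) ℓ)) hM hF
        (Real.toNNReal (expStep ε F T t)) fun v => by
          rw [lookaheadUtility_succ_good h1 hE, Real.coe_toNNReal _ hA,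
            min_eq_left (by linarith)]
          have := ih (t + 1) (TP + expStep ε F T t) (EP + expStep ε F T t)
            (fun j hj => hst j (by omega)) (by linarith) (by linarith) (by linarith)
          linarith
      push_cast
      linarith

end ValueBounds

/-! ### Optimal bids -/

section OptimalBids

variable {TP EP v : ℝ} {t ℓ : ℕ} {b : ℝ≥0}

lemma lookaheadUtility_good_le (hF : IsValuationDist F) (hε0 : 0 < ε) (hε1 : ε < 1)
    (hρ : (ρ : ℝ) = ε / (2 - ε)) (hR : TP < revenueTarget ε F T) (hE : EP ≤ TP) (ℓ : ℕ)
    (b : ℝ≥0) :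
    lookaheadUtility (mInfinity ε ρ p F T) F ℓ (TP, EP, t) v b
      ≤ v + ℓ * mean F
        - min (revenueTarget ε F T - TP) (cumStep ε F T t ℓ - (TP - EP)) := by
  cases ℓ with
  | zero =>
    simp only [lookaheadUtility]
    rw [roundUtility_good hR hE, cumStep_zero]
    have := le_min b.coe_nonneg (by linarith : 0 ≤ revenueTarget ε F T - TP)
    have := min_le_right (revenueTarget ε F T - TP) (0 - (TP - EP))
    push_cast
    linarith
  | succ ℓ =>
    push_cast
    exact lookaheadUtility_good_le_of hF hε1
      (fun TP EP h h' => (stateValue_le_sub_min hF hε0 hε1 hρ ℓ (t + 1) TP EP h).1 h')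
      (fun TP EP h h' => (stateValue_le_sub_min hF hε0 hε1 hρ ℓ (t + 1) TP EP h).2 h') hR hE

/-- A buyer who looks at least one round ahead never lets the total payment fall behind the
expected payment, as long as the expected payment is below the target: to fall behind saves less
than `μ (1 - ε)`, and costs at least as much. -/
lemma stays_good_of_isOptimalBid (hF : IsValuationDist F) (hε0 : 0 < ε) (hε1 : ε < 1)
    (hρ : (ρ : ℝ) = ε / (2 - ε)) (h0 : 0 ≤ TP) (hR : TP < revenueTarget ε F T) (hE : EP ≤ TP)
    (hE' : EP + expStep ε F T t ≤ revenueTarget ε F T) (hslack : 0 < slack F T t)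
    (hst : 0 ≤ expStep ε F T t → ∀ j, t ≤ j → 0 ≤ expStep ε F T j)
    (hb : IsOptimalBid (mInfinity ε ρ p F T) F (ℓ + 1) (TP, EP, t) v b) :
    EP + expStep ε F T t ≤ TP + min (b : ℝ) (revenueTarget ε F T - TP) := by
  by_contra! hlt
  have hz0 : 0 ≤ min (b : ℝ) (revenueTarget ε F T - TP) := le_min b.coe_nonneg (by linarith)
  have hA : 0 ≤ expStep ε F T t := by linarith
  have hAc : expStep ε F T t < mean F * (1 - ε) := by
    unfold expStep; linarith
  have hopt := hb
  have h1 := (stateValue_le_sub_min (p := p) hF hε0 hε1 hρ ℓ (t + 1)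
    (TP + min (b : ℝ) (revenueTarget ε F T - TP)) (EP + expStep ε F T t) (by linarith)).2 hlt
  unfold IsOptimalBid at hopt
  rw [lookaheadUtility_succ_good hR hE] at hopt
  set z := min (b : ℝ) (revenueTarget ε F T - TP)
  set D := cumStep ε F T (t + 1) ℓ with hD
  rcases le_or_gt (EP + expStep ε F T t + D) (revenueTarget ε F T) with h2 | h2
  · -- the target is out of reach: compare with paying the expected payment throughout
    have h3 := hopt (Real.toNNReal (EP + expStep ε F T t - TP))
    rw [lookaheadUtility_succ_good hR hE, Real.coe_toNNReal _ (by linarith),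
      min_eq_left (by linarith)] at h3
    have h4 := le_stateValue_of_cumStep (ρ := ρ) (p := p) hF ℓ (t + 1)
      (TP + (EP + expStep ε F T t - TP)) (EP + expStep ε F T t)
      (fun j hj => hst hA j (by omega)) (by linarith) (by linarith) (by linarith)
    rw [min_eq_right (by linarith)] at h1
    linarith
  · -- compare with paying up to the target at once
    have h3 := hopt (Real.toNNReal (revenueTarget ε F T - TP))
    have h4 := le_lookaheadUtility_of_eq_target (v := v) (ρ := ρ) (p := p)
      (b := Real.toNNReal (revenueTarget ε F T - TP)) hF h0 hR hE hE' (ℓ + 1)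
      (Real.le_coe_toNNReal _)
    push_cast at h4
    rcases min_choice (revenueTarget ε F T - (TP + z)) D with h5 | h5 <;> rw [h5] at h1
    · linarith
    · linarith

/-- The bid brings the total payment up to the target, or it keeps the next state good and leaves
a further round to pay up to the target, before the expected payment exceeds the target. -/
def KeepsOnTrack (ε : ℝ) (F : Measure ℝ) (T : ℕ) (s : TargetState) (b : ℝ) : Prop :=
  revenueTarget ε F T ≤ s.1 + b ∨
    (s.2.1 + expStep ε F T s.2.2 ≤ s.1 + b ∧
      s.2.1 + expStep ε F T s.2.2 + expStep ε F T (s.2.2 + 1) ≤ revenueTarget ε F T)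

/-- When the remaining expected payments exceed what is missing to the target, the bids that keep
on track are optimal: all that the buyer pays from now on is what is missing to the target, and he
wins every good. -/
lemma isOptimalBid_of_keepsOnTrack (hF : IsValuationDist F) (hε0 : 0 < ε) (hε1 : ε < 1)
    (hρ : (ρ : ℝ) = ε / (2 - ε)) (h0 : 0 ≤ TP) (hR : TP < revenueTarget ε F T) (hE : EP ≤ TP)
    (hE' : EP + expStep ε F T t ≤ revenueTarget ε F T)
    (hD : revenueTarget ε F T ≤ EP + cumStep ε F T t ℓ)
    (hb : KeepsOnTrack ε F T (TP, EP, t) b) :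
    IsOptimalBid (mInfinity ε ρ p F T) F ℓ (TP, EP, t) v b := by
  intro b'
  refine (lookaheadUtility_good_le hF hε0 hε1 hρ hR hE ℓ b').trans ?_
  rw [min_eq_left (by linarith)]
  cases ℓ with
  | zero => rw [cumStep_zero] at hD; linarith
  | succ ℓ =>
    rcases le_or_gt (revenueTarget ε F T - TP) b with h1 | h1
    · exact le_lookaheadUtility_of_eq_target hF h0 hR hE hE' (ℓ + 1) h1
    · rcases hb with h2 | ⟨h2, h3⟩
      · exact absurd h2 (by simp only [not_le]; linarith)
      · rw [lookaheadUtility_succ_good hR hE, min_eq_left h1.le]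
        have := le_stateValue_of_target (ρ := ρ) (p := p) (TP := TP + b)
          (EP := EP + expStep ε F T t) (t := t + 1) hF (by have := b.coe_nonneg; linarith)
          (by linarith) h2 h3 ℓ
        push_cast
        linarith

end OptimalBids

end MInfinity

/-! ### The expected payment of a trajectory without bad states -/

/-- The expected payment `EP` at the beginning of round `t`, on a trajectory that has been in good
states below the target so far. -/
noncomputable def expPayment (ε : ℝ) (F : Measure ℝ) (T t : ℕ) : ℝ :=
  ∑ j ∈ Finset.Ico 1 t, expStep ε F T j

section ExpPayment

variable {ε : ℝ} {F : Measure ℝ} {T : ℕ}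

@[simp] lemma expPayment_one : expPayment ε F T 1 = 0 := by simp [expPayment]

lemma expPayment_succ {t : ℕ} (ht : 1 ≤ t) :
    expPayment ε F T (t + 1) = expPayment ε F T t + expStep ε F T t :=
  Finset.sum_Ico_succ_top ht _

lemma expPayment_add_cumStep {t : ℕ} (ht : 1 ≤ t) (m : ℕ) :
    expPayment ε F T t + cumStep ε F T t m = expPayment ε F T (t + m) := by
  unfold expPayment cumStep
  rw [← Finset.sum_Ico_consecutive _ ht (Nat.le_add_right t m),
    Finset.sum_Ico_eq_sum_range _ t (t + m), Nat.add_sub_cancel_left]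

lemma slack_eq (F : Measure ℝ) (T t : ℕ) :
    slack F T t = √(2 * topValue F * mean F * Real.log T) * (1 / √(t : ℝ)) := by
  unfold slack
  rw [Real.sqrt_div' _ (Nat.cast_nonneg t)]
  ring

lemma revenueTarget_eq :
    revenueTarget ε F T = expPayment ε F T (T + 1)
      - √(4 * topValue F * mean F * √T * Real.log T) := by
  unfold revenueTarget expPayment expStep
  rw [Finset.sum_sub_distrib, Finset.sum_const, Nat.card_Ico, Finset.mul_sum]
  simp only [slack_eq]
  have : Finset.Ico 1 (T + 1) = Finset.Icc 1 T := by ext; simp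
  rw [this]
  simp only [Nat.add_sub_cancel, nsmul_eq_mul]
  ring

lemma slack_antitone (F : Measure ℝ) (T : ℕ) {t j : ℕ} (ht : 1 ≤ t) (h : t ≤ j) :
    slack F T j ≤ slack F T t := by
  rw [slack_eq, slack_eq]
  have : (0 : ℝ) < t := by exact_mod_cast ht
  have : (t : ℝ) ≤ j := by exact_mod_cast h
  gcongr

lemma expStep_mono {t j : ℕ} (ht : 1 ≤ t) (h : t ≤ j) : expStep ε F T t ≤ expStep ε F T j := by
  have := slack_antitone F T ht h
  unfold expStep
  linarith

lemma expPayment_nonpos_of_expStep_nonpos {t : ℕ} (h : expStep ε F T t ≤ 0) :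
    expPayment ε F T t ≤ 0 := by
  refine Finset.sum_nonpos fun j hj => ?_
  rw [Finset.mem_Ico] at hj
  exact (expStep_mono hj.1 hj.2.le).trans h

lemma expPayment_le (t : ℕ) :
    expPayment ε F T t ≤ mean F * (1 - ε) * (t - 1 : ℕ) := by
  calc expPayment ε F T t ≤ ∑ _j ∈ Finset.Ico 1 t, mean F * (1 - ε) :=
        Finset.sum_le_sum fun j _ => expStep_le ε F T j
    _ = mean F * (1 - ε) * (t - 1 : ℕ) := by simp [mul_comm]

end ExpPayment

/-! ### Plays of the mechanism -/

section Measurability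

variable {S Ω : Type} [MeasurableSpace S]

lemma history_le_of {s : ℕ → Ω → S} {v : ℕ → Ω → ℝ} {b : ℕ → Ω → ℝ≥0} {x : ℕ → Ω → Bool}
    {t : ℕ} {m : MeasurableSpace Ω} (hs : ∀ i ∈ Finset.Icc 1 t, Measurable[m] (s i))
    (hv : ∀ i ∈ Finset.Ico 1 t, Measurable[m] (v i))
    (hb : ∀ i ∈ Finset.Ico 1 t, Measurable[m] (b i))
    (hx : ∀ i ∈ Finset.Ico 1 t, Measurable[m] (x i)) : history s v b x t ≤ m :=
  sup_le (iSup₂_le fun i hi => (hs i hi).comap_le)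
    (iSup₂_le fun i hi => sup_le (sup_le (hv i hi).comap_le (hb i hi).comap_le) (hx i hi).comap_le)

lemma measurable_history_state {s : ℕ → Ω → S} {v : ℕ → Ω → ℝ} {b : ℕ → Ω → ℝ≥0}
    {x : ℕ → Ω → Bool} {i t : ℕ} (hi : 1 ≤ i) (hit : i ≤ t) :
    Measurable[history s v b x t] (s i) := by
  refine measurable_iff_comap_le.2 (le_trans ?_ le_sup_left)
  exact le_iSup₂_of_le i (Finset.mem_Icc.2 ⟨hi, hit⟩) le_rfl

/-- The information at the end of round `t`: the bid history and the allocation. -/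
abbrev outcomeHistory (s : ℕ → Ω → S) (v : ℕ → Ω → ℝ) (b : ℕ → Ω → ℝ≥0) (x : ℕ → Ω → Bool)
    (t : ℕ) : MeasurableSpace Ω :=
  bidHistory s v b x t ⊔ MeasurableSpace.comap (x t) inferInstance

/-- A random variable whose conditional law is the Dirac measure at a known point is that
point. -/
lemma ae_eq_of_condExp_indicator_eq_dirac {m mΩ : MeasurableSpace Ω}
    {P : Measure Ω} [MeasurableSpace.CountablySeparated S] [IsProbabilityMeasure P] (hm : m ≤ mΩ)
    {X Y : Ω → S} (hX : Measurable X) (hY : Measurable[m] Y)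
    (h : ∀ A : Set S, MeasurableSet A → P[(X ⁻¹' A).indicator (fun _ => (1 : ℝ)) | m]
      =ᵐ[P] fun ω => (Measure.dirac (Y ω)).real A) : X =ᵐ[P] Y := by
  have key : ∀ A : Set S, MeasurableSet A → ∀ᵐ ω ∂P, Y ω ∈ A → X ω ∈ A := by
    intro A hA
    have hXA := hX hA
    have hYA : MeasurableSet[m] (Y ⁻¹' A) := hY hA
    have hYA' : MeasurableSet (Y ⁻¹' A) := hm _ hYA
    have e1 : ∫ ω in Y ⁻¹' A, (X ⁻¹' A).indicator (fun _ => (1 : ℝ)) ω ∂P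
        = ∫ ω in Y ⁻¹' A, (1 : ℝ) ∂P := by
      rw [← setIntegral_condExp hm ((integrable_const (1 : ℝ)).indicator hXA) hYA]
      refine setIntegral_congr_ae hYA' ?_
      filter_upwards [h A hA] with ω hω hmem
      rw [hω, Measure.real, Measure.dirac_apply' _ hA]
      simp [show Y ω ∈ A from hmem]
    rw [setIntegral_indicator hXA, setIntegral_const, setIntegral_const] at e1
    simp only [smul_eq_mul, mul_one] at e1
    have e2 : P.real (Y ⁻¹' A \ (X ⁻¹' A)) = 0 := by
      have := measureReal_inter_add_sdiff (μ := P) (s := Y ⁻¹' A) hXA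
      linarith
    rw [measureReal_eq_zero_iff] at e2
    refine (ae_iff.2 ?_)
    convert! e2 using 2
    ext ω
    simp
  refine Filter.EventuallyEq.of_forall_separating_preimage MeasurableSet fun A hA => ?_
  filter_upwards [key A hA, key Aᶜ hA.compl] with ω h1 h2
  exact propext ⟨fun hx => by_contra fun hy => h2 hy hx, h1⟩

variable [mΩ : MeasurableSpace Ω] {M : Mechanism S} {F : Measure ℝ} {T : ℕ} {P : Measure Ω}
  (π : Play M F T P)

namespace Play

lemma history_le (t : ℕ) : history π.s π.v π.b π.x t ≤ mΩ :=
  history_le_of (fun i _ => π.measurable_s i) (fun i _ => π.measurable_v i)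
    (fun i _ => π.measurable_b i) (fun i _ => π.measurable_x i)

lemma bidHistory_le (t : ℕ) : bidHistory π.s π.v π.b π.x t ≤ mΩ :=
  sup_le (π.history_le t) (sup_le (π.measurable_v t).comap_le (π.measurable_b t).comap_le)

lemma measurable_history_v {i t : ℕ} (hi : 1 ≤ i) (hit : i < t) :
    Measurable[history π.s π.v π.b π.x t] (π.v i) := by
  refine measurable_iff_comap_le.2 (le_trans ?_ le_sup_right)
  exact le_iSup₂_of_le i (Finset.mem_Ico.2 ⟨hi, hit⟩) (le_sup_left.trans le_sup_left)

lemma measurable_bidHistory_s {t : ℕ} (ht : 1 ≤ t) :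
    Measurable[bidHistory π.s π.v π.b π.x t] (π.s t) :=
  (measurable_history_state ht le_rfl).mono le_sup_left le_rfl

lemma measurable_bidHistory_b (t : ℕ) : Measurable[bidHistory π.s π.v π.b π.x t] (π.b t) :=
  measurable_iff_comap_le.2 (le_sup_right.trans le_sup_right)

/-- Properties that hold for almost every value hold along almost every play. -/
lemma ae_value {q : ℝ → Prop} (hq : ∀ᵐ v ∂F, q v) : ∀ᵐ ω ∂P, ∀ t ∈ Finset.Icc 1 T, q (π.v t ω) := by
  refine (ae_ball_iff (Finset.Icc 1 T).countable_toSet).2 fun t ht => ?_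
  have h := π.value_law t ht
  rw [← h] at hq
  exact ae_of_ae_map (π.measurable_v t).aemeasurable hq

end Play

end Measurability

section MInfinityPlays

variable {Ω : Type} [mΩ : MeasurableSpace Ω] {ε : ℝ} {ρ : unitInterval} {p : ℝ≥0} {F : Measure ℝ}
  {T : ℕ} {P : Measure Ω}

lemma measurable_expStep (ε : ℝ) (F : Measure ℝ) (T : ℕ) : Measurable (expStep ε F T) :=
  measurable_from_nat

lemma measurableSet_good : MeasurableSet {s : TargetState | s.2.1 ≤ s.1} :=
  measurableSet_le (by fun_prop) (by fun_prop)

lemma measurable_nextState :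
    Measurable fun q : TargetState × Bool × ℝ => nextState ε F T q.1 q.2.1 q.2.2 := by
  have h1 := measurable_expStep ε F T
  unfold nextState
  refine Measurable.ite (measurableSet_le (by fun_prop) (by fun_prop)) (by fun_prop) ?_
  refine Measurable.ite (measurableSet_le (by fun_prop) (by fun_prop)) (by fun_prop) ?_
  refine Measurable.ite ?_ (by fun_prop) (by fun_prop)
  exact (measurableSet_singleton true).preimage (by fun_prop : Measurable
    fun q : TargetState × Bool × ℝ => q.2.1)

lemma measurable_pay :
    Measurable fun q : TargetState × ℝ≥0 × Bool =>
      (mInfinity ε ρ p F T).pay q.1 q.2.1 q.2.2 := by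
  simp only [mInfinity_pay]
  have h1 : MeasurableSet {q : TargetState × ℝ≥0 × Bool | q.2.2 = true} :=
    (measurableSet_singleton true).preimage (by fun_prop)
  have h2 : MeasurableSet {q : TargetState × ℝ≥0 × Bool | q.1.1 ≤ revenueTarget ε F T} :=
    measurableSet_le (by fun_prop) (by fun_prop)
  exact Measurable.ite (h1.inter h2) (by fun_prop) measurable_const

lemma measurable_alloc :
    Measurable fun q : TargetState × ℝ≥0 => (mInfinity ε ρ p F T).alloc q.1 q.2 := by
  simp only [mInfinity_alloc]
  have h1 : MeasurableSet {q : TargetState × ℝ≥0 | q.1.2.1 ≤ q.1.1} :=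
    measurableSet_le (by fun_prop) (by fun_prop)
  have h2 : MeasurableSet {q : TargetState × ℝ≥0 | p ≤ q.2} :=
    measurableSet_le (by fun_prop) (by fun_prop)
  exact Measurable.ite h1 measurable_const (Measurable.ite h2 measurable_const measurable_const)

namespace Play

variable (π : Play (mInfinity ε ρ p F T) F T P)

/-- The payment of round `t`. -/
noncomputable def payment (t : ℕ) (ω : Ω) : ℝ :=
  (mInfinity ε ρ p F T).pay (π.s t ω) (π.b t ω) (π.x t ω)

lemma measurable_payment (t : ℕ) : Measurable (π.payment t) :=
  measurable_pay.comp ((π.measurable_s t).prodMk ((π.measurable_b t).prodMk (π.measurable_x t)))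

lemma measurable_bidHistory_alloc {t : ℕ} (ht : 1 ≤ t) :
    Measurable[bidHistory π.s π.v π.b π.x t]
      fun ω => (mInfinity ε ρ p F T).alloc (π.s t ω) (π.b t ω) :=
  measurable_alloc.comp ((π.measurable_bidHistory_s ht).prodMk (π.measurable_bidHistory_b t))

lemma measurableSet_x (t : ℕ) : MeasurableSet {ω | π.x t ω = true} :=
  π.measurable_x t (measurableSet_singleton true)

lemma setIntegral_x (t : ℕ) (A : Set Ω) :
    ∫ ω in A, (if π.x t ω then (1 : ℝ) else 0) ∂P = P.real (A ∩ {ω | π.x t ω = true}) := by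
  have : (fun ω => if π.x t ω then (1 : ℝ) else 0)
      = {ω | π.x t ω = true}.indicator fun _ => (1 : ℝ) := by
    ext ω; simp [indicator]
  rw [this, setIntegral_indicator (π.measurableSet_x t), setIntegral_const]
  simp

variable [IsProbabilityMeasure P]

/-- Since `mInfinity` draws the next state from a Dirac measure, almost every play follows
`nextState`. -/
lemma ae_next : ∀ᵐ ω ∂P, ∀ t ∈ Finset.Ico 1 T,
    π.s (t + 1) ω = nextState ε F T (π.s t ω) (π.x t ω) (π.payment t ω) := by
  refine (ae_ball_iff (Finset.Ico 1 T).countable_toSet).2 fun t ht => ?_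
  have ht1 := (Finset.mem_Ico.1 ht).1
  have hle : outcomeHistory π.s π.v π.b π.x t ≤ mΩ :=
    sup_le (π.bidHistory_le t) (π.measurable_x t).comap_le
  have hs : Measurable[outcomeHistory π.s π.v π.b π.x t] (π.s t) :=
    (π.measurable_bidHistory_s ht1).mono le_sup_left le_rfl
  have hb : Measurable[outcomeHistory π.s π.v π.b π.x t] (π.b t) :=
    (π.measurable_bidHistory_b t).mono le_sup_left le_rfl
  have hx : Measurable[outcomeHistory π.s π.v π.b π.x t] (π.x t) :=
    measurable_iff_comap_le.2 le_sup_right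
  refine ae_eq_of_condExp_indicator_eq_dirac hle (π.measurable_s (t + 1)) ?_ fun A hA => ?_
  · have hpay : Measurable[outcomeHistory π.s π.v π.b π.x t] (π.payment t) :=
      measurable_pay.comp (hs.prodMk (hb.prodMk hx))
    exact measurable_nextState.comp (hs.prodMk (hx.prodMk hpay))
  · exact π.next_law t ht A hA

lemma setIntegral_alloc {t : ℕ} (ht : t ∈ Finset.Icc 1 T) {A : Set Ω}
    (hA : MeasurableSet[bidHistory π.s π.v π.b π.x t] A) :
    ∫ ω in A, (if π.x t ω then (1 : ℝ) else 0) ∂P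
      = ∫ ω in A, ((mInfinity ε ρ p F T).alloc (π.s t ω) (π.b t ω) : ℝ) ∂P := by
  have hint : Integrable (fun ω => if π.x t ω then (1 : ℝ) else 0) P := by
    refine Integrable.of_mem_Icc 0 1 ?_ (ae_of_all _ fun ω => ?_)
    · exact ((measurable_of_countable fun y : Bool => if y then (1 : ℝ) else 0).comp
        (π.measurable_x t)).aemeasurable
    · split_ifs <;> simp
  rw [← setIntegral_condExp (π.bidHistory_le t) hint hA]
  refine setIntegral_congr_ae (π.bidHistory_le t _ hA) ?_
  filter_upwards [π.alloc_law t ht] with ω hω _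
  rw [hω]

lemma ae_alloc_one : ∀ᵐ ω ∂P, ∀ t ∈ Finset.Icc 1 T,
    (mInfinity ε ρ p F T).alloc (π.s t ω) (π.b t ω) = 1 → π.x t ω = true := by
  refine (ae_ball_iff (Finset.Icc 1 T).countable_toSet).2 fun t ht => ?_
  have ht1 := (Finset.mem_Icc.1 ht).1
  set A : Set Ω := {ω | (mInfinity ε ρ p F T).alloc (π.s t ω) (π.b t ω) = 1} with hA
  have hAm : MeasurableSet[bidHistory π.s π.v π.b π.x t] A :=
    π.measurable_bidHistory_alloc ht1 (measurableSet_singleton 1)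
  have h1 := π.setIntegral_alloc ht hAm
  rw [setIntegral_x, setIntegral_congr_fun (g := fun _ => (1 : ℝ)) (π.bidHistory_le t _ hAm)
    (fun ω hω => by simp [show _ = (1 : unitInterval) from hω]), setIntegral_const] at h1
  have h2 := measureReal_inter_add_sdiff (μ := P) (s := A) (π.measurableSet_x t)
  have h3 : P.real (A \ {ω | π.x t ω = true}) = 0 := by
    simp only [smul_eq_mul, mul_one] at h1
    linarith
  rw [measureReal_eq_zero_iff] at h3
  refine ae_iff.2 ?_
  convert! h3 using 2
  ext ω
  simp [hA]

lemma ae_alloc_zero : ∀ᵐ ω ∂P, ∀ t ∈ Finset.Icc 1 T,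
    (mInfinity ε ρ p F T).alloc (π.s t ω) (π.b t ω) = 0 → π.x t ω = false := by
  refine (ae_ball_iff (Finset.Icc 1 T).countable_toSet).2 fun t ht => ?_
  have ht1 := (Finset.mem_Icc.1 ht).1
  set A : Set Ω := {ω | (mInfinity ε ρ p F T).alloc (π.s t ω) (π.b t ω) = 0} with hA
  have hAm : MeasurableSet[bidHistory π.s π.v π.b π.x t] A :=
    π.measurable_bidHistory_alloc ht1 (measurableSet_singleton 0)
  have h1 := π.setIntegral_alloc ht hAm
  rw [setIntegral_x, setIntegral_congr_fun (g := fun _ => (0 : ℝ)) (π.bidHistory_le t _ hAm)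
    (fun ω hω => by simp [show _ = (0 : unitInterval) from hω]), setIntegral_const] at h1
  rw [smul_zero, measureReal_eq_zero_iff] at h1
  refine ae_iff.2 ?_
  convert! h1 using 2
  ext ω
  simp [hA]

/-- In a good state the good is allocated. -/
lemma ae_good : ∀ᵐ ω ∂P, ∀ t ∈ Finset.Icc 1 T, (π.s t ω).2.1 ≤ (π.s t ω).1 → π.x t ω = true := by
  filter_upwards [π.ae_alloc_one] with ω h t ht hE
  exact h t ht (by rw [mInfinity_alloc, if_pos hE])

/-- In a bad state the good is allocated only to bids of at least the price. -/
lemma ae_bad : ∀ᵐ ω ∂P, ∀ t ∈ Finset.Icc 1 T, (π.s t ω).1 < (π.s t ω).2.1 →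
    π.x t ω = true → p ≤ π.b t ω := by
  filter_upwards [π.ae_alloc_zero] with ω h t ht hE hx
  by_contra hp
  have := h t ht (by rw [mInfinity_alloc, if_neg (not_le.2 hE), if_neg hp])
  simp [this] at hx

end Play

end MInfinityPlays

/-! ### Trajectories -/

/-- The deterministic part of a play: states, bids and allocations of a trajectory that follows
the transitions of `mInfinity`, and in which the good is allocated in good states, and in bad
states only to bids of at least the price. -/
structure IsTrajectory (ε : ℝ) (ρ : unitInterval) (p : ℝ≥0) (F : Measure ℝ) (T : ℕ)
    (s : ℕ → TargetState) (b : ℕ → ℝ≥0) (x : ℕ → Bool) : Prop where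
  start : s 1 = (initialCredit F T, 0, 1)
  next : ∀ t ∈ Finset.Ico 1 T, s (t + 1) =
    nextState ε F T (s t) (x t) ((mInfinity ε ρ p F T).pay (s t) (b t) (x t))
  good : ∀ t ∈ Finset.Icc 1 T, (s t).2.1 ≤ (s t).1 → x t = true
  bad : ∀ t ∈ Finset.Icc 1 T, (s t).1 < (s t).2.1 → x t = true → p ≤ b t

lemma Play.ae_isTrajectory {Ω : Type} [MeasurableSpace Ω] {ε : ℝ} {ρ : unitInterval} {p : ℝ≥0}
    {F : Measure ℝ} {T : ℕ} {P : Measure Ω} [IsProbabilityMeasure P]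
    (π : Play (mInfinity ε ρ p F T) F T P) :
    ∀ᵐ ω ∂P, IsTrajectory ε ρ p F T (π.s · ω) (π.b · ω) (π.x · ω) := by
  filter_upwards [π.ae_next, π.ae_good, π.ae_bad] with ω h1 h2 h3
  exact ⟨π.start_eq ω, h1, h2, h3⟩

lemma initialCredit_nonneg {F : Measure ℝ} (hF : IsValuationDist F) (T : ℕ) :
    0 ≤ initialCredit F T := by
  have := mean_nonneg hF
  unfold initialCredit
  positivity

section NextState

variable {ε : ℝ} {F : Measure ℝ} {T t : ℕ} {TP EP pt : ℝ} {x : Bool}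

lemma nextState_done (h : revenueTarget ε F T ≤ TP) :
    nextState ε F T (TP, EP, t) x pt = (TP, 0, t + 1) := by
  simp [nextState, h]

lemma nextState_good (h : TP < revenueTarget ε F T) (hE : EP ≤ TP) :
    nextState ε F T (TP, EP, t) x pt = (TP + pt, EP + expStep ε F T t, t + 1) := by
  simp [nextState, not_le.2 h, hE]

lemma nextState_bad_true (h : TP < revenueTarget ε F T) (hE : TP < EP) :
    nextState ε F T (TP, EP, t) true pt = (TP, TP, t + 1) := by
  simp [nextState, not_le.2 h, not_le.2 hE]

lemma nextState_bad_false (h : TP < revenueTarget ε F T) (hE : TP < EP) :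
    nextState ε F T (TP, EP, t) false pt = (TP, EP, t + 1) := by
  simp [nextState, not_le.2 h, not_le.2 hE]

lemma nextState_fst_mem (s : TargetState) (hpt : 0 ≤ pt) :
    (nextState ε F T s x pt).1 ∈ Icc s.1 (s.1 + pt) := by
  unfold nextState
  split_ifs <;> simp [hpt]

lemma nextState_round (s : TargetState) : (nextState ε F T s x pt).2.2 = s.2.2 + 1 := by
  unfold nextState
  split_ifs <;> rfl

end NextState

namespace IsTrajectory

variable {ε : ℝ} {ρ : unitInterval} {p : ℝ≥0} {F : Measure ℝ} {T : ℕ} {s : ℕ → TargetState}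
  {b : ℕ → ℝ≥0} {x : ℕ → Bool} (h : IsTrajectory ε ρ p F T s b x)
include h

lemma round_eq {t : ℕ} (h1 : 1 ≤ t) (hT : t ≤ T) : (s t).2.2 = t := by
  induction t, h1 using Nat.le_induction with
  | base => rw [h.start]
  | succ t h1 ih => rw [h.next t (Finset.mem_Ico.2 ⟨h1, hT⟩), nextState_round, ih (by omega)]

lemma eq_mk {t : ℕ} (h1 : 1 ≤ t) (hT : t ≤ T) : s t = ((s t).1, (s t).2.1, t) :=
  Prod.ext rfl (Prod.ext rfl (h.round_eq h1 hT))

lemma le_succ {t : ℕ} (h1 : 1 ≤ t) (hT : t < T) : (s t).1 ≤ (s (t + 1)).1 := by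
  rw [h.next t (Finset.mem_Ico.2 ⟨h1, hT⟩)]
  exact (nextState_fst_mem _ (mInfinity_nonPaymentForceful.1 _ _ _)).1

lemma initialCredit_le {t : ℕ} (h1 : 1 ≤ t) (hT : t ≤ T) : initialCredit F T ≤ (s t).1 := by
  induction t, h1 using Nat.le_induction with
  | base => rw [h.start]
  | succ t h1 ih => exact (ih (by omega)).trans (h.le_succ h1 hT)

/-- The total payment, in the sense of the mechanism, is backed by actual payments. -/
lemma le_sum_pay {t : ℕ} (h1 : 1 ≤ t) (hT : t ≤ T) :
    (s t).1 - initialCredit F T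
      ≤ ∑ j ∈ Finset.Ico 1 t, (mInfinity ε ρ p F T).pay (s j) (b j) (x j) := by
  induction t, h1 using Nat.le_induction with
  | base => simp [h.start]
  | succ t h1 ih =>
    rw [Finset.sum_Ico_succ_top h1]
    have := ih (by omega)
    have := (nextState_fst_mem (ε := ε) (F := F) (T := T) (x := x t)
      (pt := (mInfinity ε ρ p F T).pay (s t) (b t) (x t)) (s t)
      (mInfinity_nonPaymentForceful.1 _ _ _)).2
    rw [← h.next t (Finset.mem_Ico.2 ⟨h1, hT⟩)] at this
    linarith

lemma pay_le (hF : IsValuationDist F) {t : ℕ} (h1 : 1 ≤ t) (hT : t ≤ T) :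
    (mInfinity ε ρ p F T).pay (s t) (b t) (x t) ≤ max (revenueTarget ε F T) 0 := by
  rw [mInfinity_pay]
  split_ifs
  · have := h.initialCredit_le h1 hT
    have := initialCredit_nonneg hF T
    exact (min_le_right _ _).trans ((by linarith : _ ≤ revenueTarget ε F T).trans (le_max_left _ _))
  · exact le_max_right _ _

lemma next_good {t : ℕ} (h1 : 1 ≤ t) (hT : t < T) (hR : (s t).1 < revenueTarget ε F T)
    (hE : (s t).2.1 ≤ (s t).1) :
    s (t + 1) = ((s t).1 + min (b t : ℝ) (revenueTarget ε F T - (s t).1),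
      (s t).2.1 + expStep ε F T t, t + 1) := by
  have hx := h.good t (Finset.mem_Icc.2 ⟨h1, hT.le⟩) hE
  rw [h.next t (Finset.mem_Ico.2 ⟨h1, hT⟩), hx]
  generalize hs : s t = st at *
  have hr : st.2.2 = t := by rw [← hs]; exact h.round_eq h1 hT.le
  obtain ⟨TP, EP, r⟩ := st
  simp only at hR hE hr
  rw [nextState_good hR hE, pay_true_of_le hR.le, hr]

end IsTrajectory

/-! ### Revenue against buyers who look ahead -/

section LookaheadRevenue

variable {ε : ℝ} {ρ : unitInterval} {p : ℝ≥0} {F : Measure ℝ} {T : ℕ}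

lemma slack_pos {t : ℕ} (ht : 1 ≤ t) (hT : 2 ≤ T) (hF : IsValuationDist F) (hμ : 0 < mean F) :
    0 < slack F T t := by
  have h1 : 0 < Real.log T := Real.log_pos (by exact_mod_cast hT)
  have h2 : 0 < topValue F := hμ.trans_le (mean_le_topValue hF)
  have h3 : (0 : ℝ) < t := by exact_mod_cast ht
  unfold slack
  positivity

/-- A buyer who looks ahead stays in good states until the total payment is within one round of
the target. This happens in the last round at the latest, because there the expected payment is
within one round of the target, and in a good state the total payment is at least as large. -/
lemma IsTrajectory.target_le_of_isOptimalBid {s : ℕ → TargetState} {b : ℕ → ℝ≥0} {x : ℕ → Bool}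
    {v : ℕ → ℝ} (h : IsTrajectory ε ρ p F T s b x) (hF : IsValuationDist F) (hμ : 0 < mean F)
    (hε0 : 0 < ε) (hε1 : ε < 1) (hρ : (ρ : ℝ) = ε / (2 - ε)) (hT : 1 ≤ T) {k : ℕ} (hk : 1 ≤ k)
    (hopt : ∀ t ∈ Finset.Icc 1 T,
      IsOptimalBid (mInfinity ε ρ p F T) F (min k (T - t)) (s t) (v t) (b t)) :
    revenueTarget ε F T - mean F * (1 - ε) ≤ (s T).1 := by
  have hc : 0 ≤ mean F * (1 - ε) := mul_nonneg hμ.le (by linarith)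
  have key : ∀ t, 1 ≤ t → t ≤ T → revenueTarget ε F T - mean F * (1 - ε) ≤ (s t).1 ∨
      ((s t).2.1 = expPayment ε F T t ∧ (s t).2.1 ≤ (s t).1) := by
    intro t h1
    induction t, h1 using Nat.le_induction with
    | base =>
      intro _
      right
      rw [h.start]
      simpa using initialCredit_nonneg hF T
    | succ t h1 ih =>
      intro hT'
      rcases le_or_gt (revenueTarget ε F T - mean F * (1 - ε)) (s t).1 with h2 | h2
      · exact Or.inl (h2.trans (h.le_succ h1 hT'))
      · right
        rcases ih (by omega) with h3 | ⟨h3, h4⟩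
        · exact absurd h3 (not_le.2 h2)
        have hR : (s t).1 < revenueTarget ε F T := by linarith
        have h5 := hopt t (Finset.mem_Icc.2 ⟨h1, by omega⟩)
        obtain ⟨ℓ, hℓ⟩ : ∃ ℓ, min k (T - t) = ℓ + 1 := ⟨min k (T - t) - 1, by omega⟩
        have h6 := h.initialCredit_le h1 (by omega)
        have h7 := initialCredit_nonneg hF T
        have h8 := expStep_le ε F T t
        rw [h.next_good h1 hT' hR h4]
        rw [hℓ, h.eq_mk h1 (by omega)] at h5
        refine ⟨?_, stays_good_of_isOptimalBid hF hε0 hε1 hρ (by linarith) hR h4 (by linarith)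
          (slack_pos h1 (by omega) hF hμ)
          (fun h9 j hj => h9.trans (expStep_mono h1 hj)) h5⟩
        rw [expPayment_succ h1, ← h3]
  rcases key T hT le_rfl with h1 | ⟨h1, h2⟩
  · exact h1
  · rw [revenueTarget_eq, expPayment_succ hT]
    have h3 := expStep_le ε F T T
    have h4 := Real.sqrt_nonneg (4 * topValue F * mean F * √T * Real.log T)
    linarith

variable {Ω : Type} [MeasurableSpace Ω] {P : Measure Ω} (π : Play (mInfinity ε ρ p F T) F T P)

lemma Play.avgRevenue_eq (ω : Ω) :
    π.avgRevenue ω = (∑ t ∈ Finset.Icc 1 T, π.payment t ω) / T := rfl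

lemma Play.payment_nonneg (t : ℕ) (ω : Ω) : 0 ≤ π.payment t ω :=
  mInfinity_nonPaymentForceful.1 _ _ _

lemma Play.integral_avgRevenue_nonneg : 0 ≤ ∫ ω, π.avgRevenue ω ∂P :=
  integral_nonneg fun ω => div_nonneg
    (Finset.sum_nonneg fun t _ => π.payment_nonneg t ω) (Nat.cast_nonneg T)

variable [IsProbabilityMeasure P]

lemma Play.integrable_payment (hF : IsValuationDist F) {t : ℕ} (ht : t ∈ Finset.Icc 1 T) :
    Integrable (π.payment t) P := by
  refine Integrable.of_mem_Icc 0 (max (revenueTarget ε F T) 0)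
    (π.measurable_payment t).aemeasurable ?_
  filter_upwards [π.ae_isTrajectory] with ω h
  rw [Finset.mem_Icc] at ht
  exact ⟨π.payment_nonneg t ω, h.pay_le hF ht.1 ht.2⟩

lemma Play.integrable_avgRevenue (hF : IsValuationDist F) : Integrable π.avgRevenue P :=
  (integrable_finsetSum _ fun _ ht => π.integrable_payment hF ht).div_const _

/-- The revenue from a buyer who looks ahead reaches the target almost surely, up to the initial
credit and one round. -/
lemma Play.IsLookaheadBuyer.le_integral_avgRevenue {k : ℕ} (hπ : π.IsLookaheadBuyer k)
    (hF : IsValuationDist F) (hμ : 0 < mean F) (hε0 : 0 < ε) (hε1 : ε < 1)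
    (hρ : (ρ : ℝ) = ε / (2 - ε)) (hT : 1 ≤ T) (hk : 1 ≤ k) :
    (revenueTarget ε F T - mean F * (1 - ε) - initialCredit F T) / T
      ≤ ∫ ω, π.avgRevenue ω ∂P := by
  have h1 : ∀ᵐ ω ∂P, (revenueTarget ε F T - mean F * (1 - ε) - initialCredit F T) / T
      ≤ π.avgRevenue ω := by
    have hopt := (ae_ball_iff (Finset.Icc 1 T).countable_toSet).2 hπ
    filter_upwards [π.ae_isTrajectory, hopt] with ω h hω
    have h2 := h.target_le_of_isOptimalBid hF hμ hε0 hε1 hρ hT hk hω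
    have h3 := h.le_sum_pay hT le_rfl
    rw [π.avgRevenue_eq]
    gcongr
    have h4 : ∑ j ∈ Finset.Ico 1 T, π.payment j ω ≤ ∑ j ∈ Finset.Icc 1 T, π.payment j ω :=
      Finset.sum_le_sum_of_subset_of_nonneg Finset.Ico_subset_Icc_self
        fun j _ _ => π.payment_nonneg j ω
    have h5 : (π.s T ω).1 - initialCredit F T ≤ ∑ j ∈ Finset.Ico 1 T, π.payment j ω := h3
    linarith
  calc _ = ∫ _, (revenueTarget ε F T - mean F * (1 - ε) - initialCredit F T) / T ∂P := by simp
    _ ≤ _ := integral_mono_ae (integrable_const _) (π.integrable_avgRevenue hF) h1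

end LookaheadRevenue

/-! ### Revenue against myopic buyers -/

section MyopicRevenue

variable {ε : ℝ} {ρ : unitInterval} {p : ℝ≥0} {F : Measure ℝ} {T : ℕ}

lemma eq_zero_of_isOptimalBid_good {TP EP v : ℝ} {t : ℕ} {b : ℝ≥0}
    (hR : TP < revenueTarget ε F T) (hE : EP ≤ TP)
    (hb : IsOptimalBid (mInfinity ε ρ p F T) F 0 (TP, EP, t) v b) : b = 0 := by
  have h1 := hb 0
  simp only [lookaheadUtility] at h1
  rw [roundUtility_good hR hE, roundUtility_good hR hE] at h1
  have h2 : min (b : ℝ) (revenueTarget ε F T - TP) ≤ 0 := by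
    have : min ((0 : ℝ≥0) : ℝ) (revenueTarget ε F T - TP) ≤ 0 := min_le_left _ _
    linarith
  rcases min_le_iff.1 h2 with h3 | h3
  · exact le_antisymm (by exact_mod_cast h3) b.2
  · linarith

lemma price_le_of_isOptimalBid_bad {TP EP v : ℝ} {t : ℕ} {b : ℝ≥0} (hρ : 0 < (ρ : ℝ))
    (hR : TP < revenueTarget ε F T) (hE : TP < EP) (hv : p < v)
    (hb : IsOptimalBid (mInfinity ε ρ p F T) F 0 (TP, EP, t) v b) : p ≤ b := by
  by_contra hpb
  have h1 := hb p
  simp only [lookaheadUtility] at h1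
  rw [roundUtility_bad hR hE, roundUtility_bad hR hE, if_pos le_rfl, if_neg hpb] at h1
  have h2 : min (p : ℝ) (revenueTarget ε F T - TP) ≤ p := min_le_left _ _
  have := mul_pos hρ (by linarith : 0 < v - min (p : ℝ) (revenueTarget ε F T - TP))
  linarith

/-- On a trajectory of a myopic buyer the total payment stays at the initial credit. The expected
payment follows `expPayment` until it exceeds that credit, and never falls below it again. -/
lemma IsTrajectory.myopic_invariant {s : ℕ → TargetState} {b : ℕ → ℝ≥0} {x : ℕ → Bool}
    {v : ℕ → ℝ} (h : IsTrajectory ε ρ p F T s b x) (hF : IsValuationDist F)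
    (hR : initialCredit F T < revenueTarget ε F T)
    (hopt : ∀ t ∈ Finset.Icc 1 T, IsOptimalBid (mInfinity ε ρ p F T) F 0 (s t) (v t) (b t))
    {t : ℕ} (h1 : 1 ≤ t) (hT : t ≤ T) :
    (s t).1 = initialCredit F T ∧ ((s t).2.1 = expPayment ε F T t ∨
      (initialCredit F T ≤ (s t).2.1 ∧ 0 ≤ expStep ε F T t)) := by
  induction t, h1 using Nat.le_induction with
  | base => rw [h.start]; simp
  | succ t h1 ih =>
    obtain ⟨h2, h3⟩ := ih (by omega)
    have hs : s t = (initialCredit F T, (s t).2.1, t) := by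
      rw [← h2]
      exact h.eq_mk h1 (by omega)
    have ho := hopt t (Finset.mem_Icc.2 ⟨h1, by omega⟩)
    have hmono := expStep_mono (ε := ε) (F := F) (T := T) h1 (Nat.le_succ t)
    have h0 := initialCredit_nonneg hF T
    rcases le_or_gt (s t).2.1 (initialCredit F T) with hE | hE
    · rw [h.next_good h1 hT (by rwa [h2]) (by rwa [h2])]
      rw [hs] at ho
      rw [eq_zero_of_isOptimalBid_good hR hE ho]
      have h4 : min ((0 : ℝ≥0) : ℝ) (revenueTarget ε F T - (s t).1) = 0 :=
        min_eq_left (by rw [h2]; simpa using hR.le)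
      rw [h4]
      refine ⟨by simpa using h2, ?_⟩
      rcases h3 with h3 | ⟨h3, h5⟩
      · left
        rw [expPayment_succ h1, ← h3]
      · right
        exact ⟨by simpa using by linarith, h5.trans hmono⟩
    · have h5 : 0 ≤ expStep ε F T t := by
        rcases h3 with h3 | h3
        · by_contra hneg
          have := expPayment_nonpos_of_expStep_nonpos (not_le.1 hneg).le
          linarith
        · exact h3.2
      rw [h.next t (Finset.mem_Ico.2 ⟨h1, hT⟩), hs]
      cases x t with
      | true =>
        rw [nextState_bad_true hR hE]
        exact ⟨rfl, Or.inr ⟨le_rfl, h5.trans hmono⟩⟩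
      | false =>
        rw [nextState_bad_false hR hE]
        exact ⟨rfl, Or.inr ⟨hE.le, h5.trans hmono⟩⟩

/-- Once the credit is used up, a good state is entered only by a purchase in a bad state. -/
lemma IsTrajectory.bad_of_next_good {s : ℕ → TargetState} {b : ℕ → ℝ≥0} {x : ℕ → Bool}
    {v : ℕ → ℝ} (h : IsTrajectory ε ρ p F T s b x) (hF : IsValuationDist F)
    (hR : initialCredit F T < revenueTarget ε F T)
    (hopt : ∀ t ∈ Finset.Icc 1 T, IsOptimalBid (mInfinity ε ρ p F T) F 0 (s t) (v t) (b t))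
    {t : ℕ} (h1 : 1 ≤ t) (hT : t < T) (hS : initialCredit F T ≤ expPayment ε F T t)
    (hst : 0 < expStep ε F T t) (hg : (s (t + 1)).2.1 ≤ (s (t + 1)).1) :
    (s t).1 < (s t).2.1 ∧ x t = true := by
  obtain ⟨h2, h3⟩ := h.myopic_invariant hF hR hopt h1 hT.le
  obtain ⟨h4, -⟩ := h.myopic_invariant hF hR hopt (Nat.le_succ_of_le h1) hT
  have hE : initialCredit F T ≤ (s t).2.1 := by
    rcases h3 with h3 | h3
    · rwa [h3]
    · exact h3.1
  have hs : s t = (initialCredit F T, (s t).2.1, t) := by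
    rw [← h2]
    exact h.eq_mk h1 hT.le
  rcases hE.eq_or_lt with hE' | hE'
  · exfalso
    rw [h4, h.next_good h1 hT (by rwa [h2]) (by rw [h2, hE']), ← hE'] at hg
    simp only at hg
    linarith
  · refine ⟨by rwa [h2], ?_⟩
    by_contra hx
    rw [h4, h.next t (Finset.mem_Ico.2 ⟨h1, hT⟩), hs, Bool.eq_false_of_not_eq_true hx,
      nextState_bad_false hR hE'] at hg
    exact absurd hg (not_le.2 hE')

variable {Ω : Type} [MeasurableSpace Ω] {P : Measure Ω} (π : Play (mInfinity ε ρ p F T) F T P)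

/-- The event that round `t` starts in a bad state. -/
def Play.badEvent (t : ℕ) : Set Ω := {ω | (π.s t ω).1 < (π.s t ω).2.1}

/-- The event that round `t` starts in a bad state and the good is sold in it. -/
def Play.badSaleEvent (t : ℕ) : Set Ω := π.badEvent t ∩ {ω | π.x t ω = true}

lemma Play.measurableSet_history_badEvent {t : ℕ} (ht : 1 ≤ t) :
    MeasurableSet[history π.s π.v π.b π.x t] (π.badEvent t) := by
  have h1 : MeasurableSet {s : TargetState | s.1 < s.2.1} :=
    measurableSet_lt (by fun_prop) (by fun_prop)
  exact measurable_history_state ht le_rfl h1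

lemma Play.measurableSet_badSaleEvent {t : ℕ} (ht : 1 ≤ t) : MeasurableSet (π.badSaleEvent t) :=
  (π.history_le t _ (π.measurableSet_history_badEvent ht)).inter (π.measurableSet_x t)

lemma measureReal_Ioi_eq [IsProbabilityMeasure F] (y : ℝ) : F.real (Ioi y) = 1 - cdf F y := by
  rw [cdf_eq_real, ← compl_Iic, probReal_compl_eq_one_sub measurableSet_Iic]

variable [IsProbabilityMeasure P]

/-- A myopic buyer in a bad state buys with probability at least `ρ (1 - F(p))`. -/
lemma Play.IsMyopicBuyer.le_badSaleEvent (hπ : π.IsMyopicBuyer) (hF : IsValuationDist F)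
    (hR : initialCredit F T < revenueTarget ε F T) (hρ : 0 < (ρ : ℝ)) {t : ℕ}
    (ht : t ∈ Finset.Icc 1 T) :
    ρ * (1 - cdf F p) * P.real (π.badEvent t) ≤ P.real (π.badSaleEvent t) := by
  have := hF.1
  have ht1 := (Finset.mem_Icc.1 ht).1
  have hbad := π.measurableSet_history_badEvent ht1
  have hbad' : MeasurableSet[bidHistory π.s π.v π.b π.x t] (π.badEvent t) :=
    (le_sup_left : history π.s π.v π.b π.x t ≤ _) _ hbad
  have hbadΩ := π.history_le t _ hbad
  have hv : MeasurableSet[MeasurableSpace.comap (π.v t) inferInstance] (π.v t ⁻¹' Ioi (p : ℝ)) :=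
    ⟨_, measurableSet_Ioi, rfl⟩
  have hvΩ : MeasurableSet (π.v t ⁻¹' Ioi (p : ℝ)) := π.measurable_v t measurableSet_Ioi
  have hind := (Indep_iff _ _ P).1 (π.value_indep t ht) _ _ hv hbad
  have hlaw : P (π.v t ⁻¹' Ioi (p : ℝ)) = F (Ioi (p : ℝ)) := by
    rw [← Measure.map_apply (π.measurable_v t) measurableSet_Ioi, π.value_law t ht]
  have hind' : P.real (π.v t ⁻¹' Ioi (p : ℝ) ∩ π.badEvent t)
      = (1 - cdf F p) * P.real (π.badEvent t) := by
    rw [← measureReal_Ioi_eq, measureReal_def, hind, ENNReal.toReal_mul, hlaw]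
    rfl
  have halloc : Integrable
      (fun ω => ((mInfinity ε ρ p F T).alloc (π.s t ω) (π.b t ω) : ℝ)) P :=
    Integrable.of_mem_Icc 0 1 (measurable_subtype_coe.comp
      (measurable_alloc.comp ((π.measurable_s t).prodMk (π.measurable_b t)))).aemeasurable
      (ae_of_all _ fun ω => ((mInfinity ε ρ p F T).alloc (π.s t ω) (π.b t ω)).2)
  have hopt := (ae_ball_iff (Finset.Icc 1 T).countable_toSet).2 hπ
  rw [Play.badSaleEvent, ← π.setIntegral_x, π.setIntegral_alloc ht hbad']
  calc ρ * (1 - cdf F p) * P.real (π.badEvent t)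
      = ∫ _ in π.badEvent t ∩ π.v t ⁻¹' Ioi (p : ℝ), (ρ : ℝ) ∂P := by
        rw [setIntegral_const, smul_eq_mul, inter_comm, hind']
        ring
    _ ≤ ∫ ω in π.badEvent t ∩ π.v t ⁻¹' Ioi (p : ℝ),
          ((mInfinity ε ρ p F T).alloc (π.s t ω) (π.b t ω) : ℝ) ∂P := by
        refine setIntegral_mono_on_ae (integrable_const _).integrableOn halloc.integrableOn
          (hbadΩ.inter hvΩ) ?_
        filter_upwards [π.ae_isTrajectory, hopt] with ω h ho hω
        simp only [Nat.zero_min] at ho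
        have h2 := (h.myopic_invariant hF hR ho ht1 (Finset.mem_Icc.1 ht).2).1
        have h3 := ho t ht
        have hE : (π.s t ω).1 < (π.s t ω).2.1 := hω.1
        rw [mInfinity_alloc, if_neg (not_le.2 hE), if_pos]
        exact price_le_of_isOptimalBid_bad (TP := (π.s t ω).1) (EP := (π.s t ω).2.1)
          (t := (π.s t ω).2.2) hρ (by rw [h2]; exact hR) hE hω.2 h3
    _ ≤ ∫ ω in π.badEvent t, ((mInfinity ε ρ p F T).alloc (π.s t ω) (π.b t ω) : ℝ) ∂P :=
        setIntegral_mono_set halloc.integrableOn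
          (ae_of_all _ fun ω => ((mInfinity ε ρ p F T).alloc (π.s t ω) (π.b t ω)).2.1)
          (ae_of_all _ inter_subset_left)

lemma Play.IsMyopicBuyer.one_sub_badEvent_le (hπ : π.IsMyopicBuyer) (hF : IsValuationDist F)
    (hR : initialCredit F T < revenueTarget ε F T) {t : ℕ} (h1 : 1 ≤ t) (hT : t < T)
    (hS : initialCredit F T ≤ expPayment ε F T t) (hst : 0 < expStep ε F T t) :
    1 - P.real (π.badEvent (t + 1)) ≤ P.real (π.badSaleEvent t) := by
  have hm := π.history_le _ _ (π.measurableSet_history_badEvent (Nat.le_succ_of_le h1))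
  rw [← probReal_compl_eq_one_sub hm]
  have hopt := (ae_ball_iff (Finset.Icc 1 T).countable_toSet).2 hπ
  refine ENNReal.toReal_mono (measure_ne_top _ _) (measure_mono_ae ?_)
  filter_upwards [π.ae_isTrajectory, hopt] with ω h ho hω
  simp only [Nat.zero_min] at ho
  exact h.bad_of_next_good hF hR ho h1 hT hS hst (not_lt.1 hω)

lemma Play.IsMyopicBuyer.le_integral_payment (hπ : π.IsMyopicBuyer) (hF : IsValuationDist F)
    (hR : initialCredit F T < revenueTarget ε F T)
    (hp : initialCredit F T + p ≤ revenueTarget ε F T) {t : ℕ} (ht : t ∈ Finset.Icc 1 T) :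
    p * P.real (π.badSaleEvent t) ≤ ∫ ω, π.payment t ω ∂P := by
  have hopt := (ae_ball_iff (Finset.Icc 1 T).countable_toSet).2 hπ
  have ht1 := (Finset.mem_Icc.1 ht).1
  calc p * P.real (π.badSaleEvent t)
      = ∫ ω, (π.badSaleEvent t).indicator (fun _ => (p : ℝ)) ω ∂P := by
        rw [integral_indicator_const _ (π.measurableSet_badSaleEvent ht1), smul_eq_mul, mul_comm]
    _ ≤ ∫ ω, π.payment t ω ∂P := by
        refine integral_mono_ae ((integrable_const _).indicator (π.measurableSet_badSaleEvent ht1))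
          (π.integrable_payment hF ht) ?_
        filter_upwards [π.ae_isTrajectory, hopt] with ω h ho
        simp only [Nat.zero_min] at ho
        have h2 := (h.myopic_invariant hF hR ho ht1 (Finset.mem_Icc.1 ht).2).1
        by_cases hω : ω ∈ π.badSaleEvent t
        · have hx : π.x t ω = true := hω.2
          have h3 := h.bad t ht hω.1 hx
          rw [indicator_of_mem hω, Play.payment, mInfinity_pay,
            if_pos ⟨hx, by rw [h2]; exact hR.le⟩]
          exact le_min (by exact_mod_cast h3) (by rw [h2]; linarith)
        · rw [indicator_of_notMem hω]
          exact π.payment_nonneg t ω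

/-- The renewal argument: after the credit is used up, every round starts in a bad state or
follows a sale in a bad state, and bad states lead to a sale with probability at least
`ρ (1 - F(p))`. Hence sales have frequency at least
`ρ (1 - F(p)) / (1 + ρ (1 - F(p))) ≥ (ε / 2) (1 - F(p))`. -/
lemma Play.IsMyopicBuyer.le_integral_avgRevenue (hπ : π.IsMyopicBuyer) (hF : IsValuationDist F)
    (hε0 : 0 < ε) (hε1 : ε < 1) (hρ : (ρ : ℝ) = ε / (2 - ε))
    (hR : initialCredit F T < revenueTarget ε F T)
    (hp : initialCredit F T + p ≤ revenueTarget ε F T) {r : ℕ} (hr : 1 ≤ r) (hrT : r ≤ T)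
    (hS : ∀ t, r ≤ t → initialCredit F T ≤ expPayment ε F T t)
    (hst : ∀ t, r ≤ t → 0 < expStep ε F T t) :
    ε / 2 * (p * (1 - cdf F p)) * (T - r - 1) / T ≤ ∫ ω, π.avgRevenue ω ∂P := by
  have hρ0 : 0 < (ρ : ℝ) := by rw [hρ]; exact div_pos hε0 (by linarith)
  set q := 1 - cdf F p with hq
  have hq0 : 0 ≤ q := by have := cdf_le_one F p; linarith
  have hq1 : q ≤ 1 := by have := cdf_nonneg F p; linarith
  set A := ∑ t ∈ Finset.Ico r T, P.real (π.badSaleEvent t) with hA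
  set E := ∑ t ∈ Finset.Ico r T, P.real (π.badEvent t) with hE
  have hA0 : 0 ≤ A := Finset.sum_nonneg fun _ _ => measureReal_nonneg
  have h1 : ρ * q * E ≤ A := by
    rw [hE, Finset.mul_sum]
    refine Finset.sum_le_sum fun t ht => ?_
    rw [Finset.mem_Ico] at ht
    exact hπ.le_badSaleEvent π hF hR hρ0 (Finset.mem_Icc.2 ⟨by omega, by omega⟩)
  have h2 : (T : ℝ) - r - 1 ≤ A + E := by
    have h3 : ∑ t ∈ Finset.Ico r T, (1 - P.real (π.badEvent (t + 1))) ≤ A :=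
      Finset.sum_le_sum fun t ht => by
        rw [Finset.mem_Ico] at ht
        exact hπ.one_sub_badEvent_le π hF hR (by omega) ht.2 (hS t ht.1) (hst t ht.1)
    have h4 : ∑ t ∈ Finset.Ico r T, P.real (π.badEvent (t + 1)) ≤ E + 1 := by
      have := Finset.sum_Ico_consecutive (fun t => P.real (π.badEvent t)) hrT (Nat.le_succ T)
      rw [Nat.Ico_succ_singleton, Finset.sum_singleton] at this
      have h5 : ∑ t ∈ Finset.Ico r T, P.real (π.badEvent (t + 1))
          ≤ ∑ t ∈ Finset.Ico r (T + 1), P.real (π.badEvent t) := by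
        rw [Finset.sum_Ico_add' (fun t => P.real (π.badEvent t))]
        refine Finset.sum_le_sum_of_subset_of_nonneg ?_ fun _ _ _ => measureReal_nonneg
        exact Finset.Ico_subset_Ico (Nat.le_succ r) le_rfl
      have h6 : P.real (π.badEvent T) ≤ 1 := measureReal_le_one
      linarith
    rw [Finset.sum_sub_distrib, Finset.sum_const, Nat.card_Ico, nsmul_eq_mul, mul_one,
      Nat.cast_sub hrT] at h3
    linarith
  have hρ2 : (ρ : ℝ) * (2 - ε) = ε := by
    rw [hρ]
    exact div_mul_cancel₀ _ (by linarith)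
  -- `(1 + ρ q) A ≥ ρ q (A + E)`, and `ρ / (1 + ρ q) ≥ ρ / (1 + ρ) = ε / 2`
  have h3 : ε / 2 * q * (T - r - 1) ≤ A := by
    rcases le_or_gt ((T : ℝ) - r - 1) 0 with h4 | h4
    · exact (mul_nonpos_of_nonneg_of_nonpos (by positivity) h4).trans hA0
    · have h5 : ρ * q * (T - r - 1) ≤ (1 + ρ) * A := by
        have e1 := mul_le_mul_of_nonneg_left h2 (mul_nonneg hρ0.le hq0)
        have e2 : ρ * q * A ≤ ρ * A := by
          have := mul_le_mul_of_nonneg_right hq1 (mul_nonneg hρ0.le hA0)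
          linarith
        linarith
      have h6 : (ρ : ℝ) = ε / 2 * (1 + ρ) := by linarith
      have h7 : (1 + (ρ : ℝ)) * (ε / 2 * q * (T - r - 1)) ≤ (1 + ρ) * A := by
        calc _ = ε / 2 * (1 + ρ) * q * (T - r - 1) := by ring
          _ = ρ * q * (T - r - 1) := by rw [← h6]
          _ ≤ _ := h5
      exact le_of_mul_le_mul_left h7 (by linarith)
  have h4 : ∫ ω, π.avgRevenue ω ∂P = (∑ t ∈ Finset.Icc 1 T, ∫ ω, π.payment t ω ∂P) / T := by
    simp only [π.avgRevenue_eq]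
    rw [integral_div, integral_finsetSum _ fun t ht => π.integrable_payment hF ht]
  rw [h4]
  gcongr
  calc ε / 2 * (p * q) * (T - r - 1) = p * (ε / 2 * q * (T - r - 1)) := by ring
    _ ≤ p * A := mul_le_mul_of_nonneg_left h3 p.2
    _ = ∑ t ∈ Finset.Ico r T, p * P.real (π.badSaleEvent t) := by rw [hA, Finset.mul_sum]
    _ ≤ ∑ t ∈ Finset.Ico r T, ∫ ω, π.payment t ω ∂P := Finset.sum_le_sum fun t ht => by
        rw [Finset.mem_Ico] at ht
        exact hπ.le_integral_payment π hF hR hp (Finset.mem_Icc.2 ⟨by omega, by omega⟩)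
    _ ≤ ∑ t ∈ Finset.Icc 1 T, ∫ ω, π.payment t ω ∂P :=
        Finset.sum_le_sum_of_subset_of_nonneg
          (fun t ht => by rw [Finset.mem_Ico] at ht; exact Finset.mem_Icc.2 ⟨by omega, by omega⟩)
          fun t _ _ => integral_nonneg fun ω => π.payment_nonneg t ω

end MyopicRevenue

/-! ### Growth of the target, the credit and the expected payment -/

section Growth

lemma eventually_sq_le_cube (a b : ℝ) {d : ℝ} (hd : 0 < d) :
    ∀ᶠ x : ℝ in atTop, a * x ^ 2 + b ≤ d * x ^ 3 := by
  filter_upwards [eventually_ge_atTop 1, eventually_ge_atTop ((|a| + |b|) / d)] with x h1 h2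
  rw [div_le_iff₀ hd] at h2
  have h3 : 1 ≤ x ^ 2 := one_le_pow₀ h1
  have h4 : a * x ^ 2 ≤ |a| * x ^ 2 := mul_le_mul_of_nonneg_right (le_abs_self a) (by positivity)
  have h5 : b ≤ |b| * x ^ 2 := (le_abs_self b).trans (le_mul_of_one_le_right (abs_nonneg b) h3)
  have h6 := mul_le_mul_of_nonneg_right h2 (by positivity : 0 ≤ x ^ 2)
  calc a * x ^ 2 + b ≤ (|a| + |b|) * x ^ 2 := by linarith
    _ ≤ x * d * x ^ 2 := h6
    _ = d * x ^ 3 := by ring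

/-- The fourth root of the number of rounds, the natural unit for the error terms of the
mechanism. -/
noncomputable def fourthRoot (T : ℕ) : ℝ := √√(T : ℝ)

lemma fourthRoot_nonneg (T : ℕ) : 0 ≤ fourthRoot T := Real.sqrt_nonneg _

lemma fourthRoot_sq (T : ℕ) : fourthRoot T ^ 2 = √T := Real.sq_sqrt (Real.sqrt_nonneg _)

lemma fourthRoot_pow_four (T : ℕ) : fourthRoot T ^ 4 = T := by
  rw [show fourthRoot T ^ 4 = (fourthRoot T ^ 2) ^ 2 by ring, fourthRoot_sq,
    Real.sq_sqrt (Nat.cast_nonneg T)]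

lemma tendsto_fourthRoot : Tendsto fourthRoot atTop atTop :=
  Real.tendsto_sqrt_atTop.comp (Real.tendsto_sqrt_atTop.comp tendsto_natCast_atTop_atTop)

lemma log_le_two_mul_sq (T : ℕ) : Real.log T ≤ 2 * fourthRoot T ^ 2 := by
  rcases Nat.eq_zero_or_pos T with rfl | hT
  · simp [fourthRoot]
  · have h1 : (0 : ℝ) < T := by exact_mod_cast hT
    have h2 := Real.log_le_sub_one_of_pos (Real.sqrt_pos.2 h1)
    rw [Real.log_sqrt h1.le] at h2
    rw [fourthRoot_sq]
    linarith

lemma sum_one_div_sqrt_le (n : ℕ) : ∑ j ∈ Finset.Icc 1 n, 1 / √(j : ℝ) ≤ 2 * √n := by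
  induction n with
  | zero => simp
  | succ n ih =>
    rw [Finset.sum_Icc_succ_top (by omega)]
    have h0 : (0 : ℝ) < √((n + 1 : ℕ) : ℝ) := Real.sqrt_pos.2 (by positivity)
    have h1 : √(n : ℝ) ^ 2 = n := Real.sq_sqrt (Nat.cast_nonneg n)
    have h2 : √((n + 1 : ℕ) : ℝ) ^ 2 = n + 1 := by
      rw [Real.sq_sqrt (by positivity)]; push_cast; ring
    have h3 : 1 / √((n + 1 : ℕ) : ℝ) ≤ 2 * √((n + 1 : ℕ) : ℝ) - 2 * √(n : ℝ) := by
      rw [div_le_iff₀ h0]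
      nlinarith [sq_nonneg (√((n + 1 : ℕ) : ℝ) - √(n : ℝ))]
    linarith

variable {ε : ℝ} {F : Measure ℝ} {T : ℕ}

lemma topValue_mul_mean_nonneg (hF : IsValuationDist F) : 0 ≤ topValue F * mean F :=
  mul_nonneg ((mean_nonneg hF).trans (mean_le_topValue hF)) (mean_nonneg hF)

lemma sqrt_credit_le (hF : IsValuationDist F) (T : ℕ) :
    √(4 * topValue F * mean F * √T * Real.log T)
      ≤ √(8 * (topValue F * mean F)) * fourthRoot T ^ 2 := by
  have h0 := topValue_mul_mean_nonneg hF
  have h1 := log_le_two_mul_sq T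
  have h2 := fourthRoot_nonneg T
  rw [← fourthRoot_sq, ← Real.sqrt_sq (by positivity : 0 ≤ fourthRoot T ^ 2),
    ← Real.sqrt_mul (by positivity), Real.sqrt_sq (by positivity)]
  refine Real.sqrt_le_sqrt ?_
  calc 4 * topValue F * mean F * fourthRoot T ^ 2 * Real.log T
      = 4 * (topValue F * mean F) * fourthRoot T ^ 2 * Real.log T := by ring
    _ ≤ 4 * (topValue F * mean F) * fourthRoot T ^ 2 * (2 * fourthRoot T ^ 2) := by gcongr
    _ = _ := by ring

lemma sqrt_slack_le (hF : IsValuationDist F) (T : ℕ) :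
    √(2 * topValue F * mean F * Real.log T)
      ≤ √(4 * (topValue F * mean F)) * fourthRoot T := by
  have h0 := topValue_mul_mean_nonneg hF
  have h1 := log_le_two_mul_sq T
  have h2 := fourthRoot_nonneg T
  nth_rewrite 1 [← Real.sqrt_sq h2]
  rw [← Real.sqrt_mul (by positivity)]
  refine Real.sqrt_le_sqrt ?_
  calc 2 * topValue F * mean F * Real.log T
      = 2 * (topValue F * mean F) * Real.log T := by ring
    _ ≤ 2 * (topValue F * mean F) * (2 * fourthRoot T ^ 2) := by gcongr
    _ = _ := by ring

lemma initialCredit_le_mul_sq (hF : IsValuationDist F) (T : ℕ) :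
    initialCredit F T ≤ (mean F + √(8 * (topValue F * mean F))) * fourthRoot T ^ 2 := by
  have h1 := sqrt_credit_le hF T
  unfold initialCredit
  rw [add_mul, fourthRoot_sq] at *
  linarith

lemma le_revenueTarget (hF : IsValuationDist F) (ε : ℝ) (T : ℕ) :
    mean F * (1 - ε) * fourthRoot T ^ 4 - √(8 * (topValue F * mean F)) * fourthRoot T ^ 2
      - 2 * √(4 * (topValue F * mean F)) * fourthRoot T ^ 3 ≤ revenueTarget ε F T := by
  have h1 := sqrt_credit_le hF T
  have h2 := sqrt_slack_le hF T
  have h3 := sum_one_div_sqrt_le T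
  have h4 : √(2 * topValue F * mean F * Real.log T) * ∑ j ∈ Finset.Icc 1 T, 1 / √(j : ℝ)
      ≤ √(4 * (topValue F * mean F)) * fourthRoot T * (2 * √T) :=
    mul_le_mul h2 h3 (Finset.sum_nonneg fun j _ => by positivity)
      (mul_nonneg (Real.sqrt_nonneg _) (fourthRoot_nonneg T))
  rw [← fourthRoot_sq] at h4
  unfold revenueTarget
  rw [fourthRoot_pow_four]
  linarith

/-- The target eventually exceeds the initial credit by any given amount. -/
lemma eventually_initialCredit_add_le (hF : IsValuationDist F) (hμ : 0 < mean F) (hε1 : ε < 1)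
    (C : ℝ) : ∀ᶠ T : ℕ in atTop, initialCredit F T + C ≤ revenueTarget ε F T := by
  have hc : 0 < mean F * (1 - ε) := mul_pos hμ (by linarith)
  set κ := √(8 * (topValue F * mean F)) with hκ
  set κ' := √(4 * (topValue F * mean F)) with hκ'
  filter_upwards [tendsto_fourthRoot.eventually (eventually_sq_le_cube (mean F + 2 * κ) C one_pos),
    tendsto_fourthRoot.eventually_ge_atTop ((1 + 2 * κ') / (mean F * (1 - ε)))] with T h1 h2
  have h3 := initialCredit_le_mul_sq hF T
  have h4 := le_revenueTarget hF ε T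
  rw [div_le_iff₀ hc] at h2
  have h5 := mul_le_mul_of_nonneg_right h2 (pow_nonneg (fourthRoot_nonneg T) 3)
  rw [← hκ] at h3 h4
  rw [← hκ'] at h4
  have h6 : fourthRoot T * (mean F * (1 - ε)) * fourthRoot T ^ 3
      = mean F * (1 - ε) * fourthRoot T ^ 4 := by ring
  linarith

lemma le_expPayment (hF : IsValuationDist F) (hc : 0 < mean F * (1 - ε)) (T : ℕ) {t : ℕ}
    (ht : 1 ≤ t) :
    mean F * (1 - ε) / 2 * t - mean F * (1 - ε)
        - 8 * (topValue F * mean F) / (mean F * (1 - ε)) * fourthRoot T ^ 2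
      ≤ expPayment ε F T t := by
  set c := mean F * (1 - ε) with hcdef
  set l := √(2 * topValue F * mean F * Real.log T) with hl
  have h0 := topValue_mul_mean_nonneg hF
  have h1 : expPayment ε F T t = c * (t - 1) - l * ∑ j ∈ Finset.Ico 1 t, 1 / √(j : ℝ) := by
    unfold expPayment expStep
    rw [Finset.sum_sub_distrib, Finset.sum_const, Nat.card_Ico, Finset.mul_sum]
    simp only [slack_eq, nsmul_eq_mul, Nat.cast_sub ht, Nat.cast_one]
    rw [← hl, ← hcdef]
    ring
  have h2 : ∑ j ∈ Finset.Ico 1 t, 1 / √(j : ℝ) ≤ 2 * √t :=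
    (Finset.sum_le_sum_of_subset_of_nonneg Finset.Ico_subset_Icc_self
      fun j _ _ => by positivity).trans (sum_one_div_sqrt_le t)
  have h3 : l ^ 2 ≤ 4 * (topValue F * mean F) * fourthRoot T ^ 2 := by
    calc l ^ 2 ≤ (√(4 * (topValue F * mean F)) * fourthRoot T) ^ 2 :=
          pow_le_pow_left₀ (Real.sqrt_nonneg _) (sqrt_slack_le hF T) 2
      _ = _ := by rw [mul_pow, Real.sq_sqrt (by positivity)]
  set w := √(t : ℝ) with hw
  have h4 : w ^ 2 = t := Real.sq_sqrt (Nat.cast_nonneg t)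
  -- `2 l √t ≤ (c / 2) t + (2 / c) l²`
  have h5 : l * (2 * w) ≤ c / 2 * t + 2 / c * l ^ 2 := by
    have h6 : 0 ≤ (c * w - 2 * l) ^ 2 / (2 * c) := by positivity
    have h7 : (c * w - 2 * l) ^ 2 / (2 * c) = c / 2 * t + 2 / c * l ^ 2 - l * (2 * w) := by
      rw [← h4]
      field_simp
      ring
    linarith
  have h6 := mul_le_mul_of_nonneg_left h2 (Real.sqrt_nonneg _ : 0 ≤ l)
  have h7 : 2 / c * l ^ 2 ≤ 8 * (topValue F * mean F) / c * fourthRoot T ^ 2 := by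
    calc 2 / c * l ^ 2 ≤ 2 / c * (4 * (topValue F * mean F) * fourthRoot T ^ 2) := by gcongr
      _ = _ := by ring
  rw [h1]
  linarith

lemma expStep_pos_of_lt {t : ℕ} (hF : IsValuationDist F) (hc : 0 < mean F * (1 - ε)) (ht : 1 ≤ t)
    (h : 4 * (topValue F * mean F) * fourthRoot T ^ 2 < (mean F * (1 - ε)) ^ 2 * t) :
    0 < expStep ε F T t := by
  have h0 := topValue_mul_mean_nonneg hF
  have ht' : (0 : ℝ) < t := by exact_mod_cast ht
  have h1 : slack F T t < mean F * (1 - ε) := by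
    unfold slack
    rw [Real.sqrt_lt' hc, div_lt_iff₀ ht']
    refine lt_of_le_of_lt ?_ h
    have h1 := log_le_two_mul_sq T
    calc 2 * topValue F * mean F * Real.log T
      = 2 * (topValue F * mean F) * Real.log T := by ring
    _ ≤ 2 * (topValue F * mean F) * (2 * fourthRoot T ^ 2) := by gcongr
    _ = _ := by ring
  unfold expStep
  linarith

/-- The initial credit is used up after `T ^ (3 / 4)` rounds, if nothing is paid. -/
lemma eventually_initialCredit_le_expPayment (hF : IsValuationDist F) (hμ : 0 < mean F)
    (hε1 : ε < 1) : ∀ᶠ T : ℕ in atTop, ∀ t : ℕ, ⌈fourthRoot T ^ 3⌉₊ ≤ t → 1 ≤ t →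
      initialCredit F T ≤ expPayment ε F T t ∧ 0 < expStep ε F T t := by
  have hc : 0 < mean F * (1 - ε) := mul_pos hμ (by linarith)
  set c := mean F * (1 - ε) with hcdef
  filter_upwards [tendsto_fourthRoot.eventually (eventually_sq_le_cube
      (mean F + √(8 * (topValue F * mean F)) + 8 * (topValue F * mean F) / c) c (half_pos hc)),
    tendsto_fourthRoot.eventually (eventually_sq_le_cube (4 * (topValue F * mean F)) 1
      (pow_pos hc 2))] with T h1 h2 t ht ht1
  have ht' : fourthRoot T ^ 3 ≤ t := Nat.ceil_le.1 ht
  constructor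
  · have h3 := initialCredit_le_mul_sq hF T
    have h4 := le_expPayment hF hc T ht1
    have h5 := mul_le_mul_of_nonneg_left ht' (half_pos hc).le
    rw [← hcdef] at h4
    linarith
  · refine expStep_pos_of_lt hF hc ht1 ?_
    have h5 := mul_le_mul_of_nonneg_left ht' (pow_pos hc 2).le
    rw [← hcdef]
    linarith

lemma tendsto_pow_fourthRoot_div {k : ℕ} (hk : k < 4) :
    Tendsto (fun T : ℕ => fourthRoot T ^ k / T) atTop (𝓝 0) := by
  have h1 : Tendsto (fun x : ℝ => x ^ k / x ^ 4) atTop (𝓝 0) :=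
    tendsto_pow_div_pow_atTop_zero hk
  refine (h1.comp tendsto_fourthRoot).congr fun T => ?_
  simp only [Function.comp, fourthRoot_pow_four]

end Growth

/-! ### The price -/

section Price

variable {F : Measure ℝ}

lemma cdf_eq_one_of_topValue_le (hF : IsValuationDist F) {y : ℝ} (hy : topValue F ≤ y) :
    cdf F y = 1 := by
  have := hF.1
  rw [cdf_eq_real, measureReal_def, (prob_compl_eq_zero_iff measurableSet_Iic).1]
  · simp
  · have h : ∀ᵐ v ∂F, v ∈ Iic y := by
      filter_upwards [ae_le_topValue hF] with v hv using hv.trans hy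
    exact h

/-- Markov's inequality: posting a price earns at most the mean. -/
lemma mul_one_sub_cdf_le_mean (hF : IsValuationDist F) (y : ℝ≥0) :
    y * (1 - cdf F y) ≤ mean F := by
  have := hF.1
  rw [← measureReal_Ioi_eq]
  have h1 := mul_meas_ge_le_integral_of_nonneg hF.ae_nonneg hF.integrable (y : ℝ)
  refine le_trans ?_ h1
  refine mul_le_mul_of_nonneg_left ?_ y.2
  exact measureReal_mono fun v (hv : (y : ℝ) < v) => hv.le

lemma bddAbove_range_mul_one_sub_cdf (hF : IsValuationDist F) :
    BddAbove (range fun y : ℝ≥0 => (y : ℝ) * (1 - cdf F y)) :=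
  ⟨mean F, by rintro _ ⟨y, rfl⟩; exact mul_one_sub_cdf_le_mean hF y⟩

lemma revMyerson_le_mean (hF : IsValuationDist F) : revMyerson F ≤ mean F :=
  ciSup_le fun y => mul_one_sub_cdf_le_mean hF y

lemma revMyerson_nonneg (hF : IsValuationDist F) : 0 ≤ revMyerson F := by
  calc 0 = ((0 : ℝ≥0) : ℝ) * (1 - cdf F (0 : ℝ≥0)) := by simp
    _ ≤ revMyerson F := le_ciSup (bddAbove_range_mul_one_sub_cdf hF) 0

lemma exists_nearly_optimal_price (hF : IsValuationDist F) {η : ℝ} (hη : 0 < η) :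
    ∃ y : ℝ≥0, revMyerson F - η ≤ y * (1 - cdf F y) ∧ (y : ℝ) ≤ topValue F := by
  obtain ⟨y, hy⟩ := exists_lt_of_lt_ciSup (show revMyerson F - η < revMyerson F by linarith)
  rcases le_or_gt (y : ℝ) (topValue F) with h | h
  · exact ⟨y, hy.le, h⟩
  · refine ⟨0, ?_, by simpa using (mean_nonneg hF).trans (mean_le_topValue hF)⟩
    rw [cdf_eq_one_of_topValue_le hF h.le] at hy
    simp only [sub_self, mul_zero] at hy
    simpa using hy.le

open Classical in
/-- A price whose one-round revenue is within `1 / (T + 1)` of the Myerson revenue. Such a price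
serves the purpose of an optimal price, which need not exist because the supremum in `revMyerson`
need not be attained. -/
noncomputable def reservePrice (F : Measure ℝ) (T : ℕ) : ℝ≥0 :=
  if h : ∃ y : ℝ≥0, revMyerson F - 1 / ((T : ℝ) + 1) ≤ y * (1 - cdf F y) ∧ (y : ℝ) ≤ topValue F
  then h.choose else 0

lemma reservePrice_spec (hF : IsValuationDist F) (T : ℕ) :
    revMyerson F - 1 / ((T : ℝ) + 1) ≤ reservePrice F T * (1 - cdf F (reservePrice F T)) ∧
      (reservePrice F T : ℝ) ≤ topValue F := by
  have h := exists_nearly_optimal_price hF (η := 1 / ((T : ℝ) + 1)) (by positivity)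
  rw [reservePrice, dif_pos h]
  exact h.choose_spec

end Price

/-! ### Robustness against lookahead attitudes -/

section Robust

variable {ε : ℝ} {ρ : unitInterval}

lemma robustLookahead_mInfinity (hε0 : 0 < ε) (hε1 : ε < 1) (hρ : (ρ : ℝ) = ε / (2 - ε)) :
    RobustLookahead (fun F T => mInfinity ε ρ (reservePrice F T) F T) (ε / 2) (1 - ε) := by
  intro F hF
  have hμ0 := mean_nonneg hF
  have hrev := revMyerson_le_mean hF
  have hrev0 := revMyerson_nonneg hF
  -- an error term of at least `μ` makes both bounds trivial
  have htriv : ε / 2 * revMyerson F - mean F ≤ 0 ∧ (1 - ε) * mean F - mean F ≤ 0 := by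
    constructor
    · have := mul_le_mul_of_nonneg_right (by linarith : ε / 2 ≤ 1) hrev0
      linarith
    · have := mul_nonneg hε0.le hμ0
      linarith
  rcases hμ0.eq_or_lt with hμ | hμ
  · refine ⟨fun _ => mean F, by simp [← hμ], fun T _ Ω _ P _ π =>
      ⟨fun _ => ⟨π.integrable_avgRevenue hF, htriv.1.trans π.integral_avgRevenue_nonneg⟩,
        fun k _ _ => ⟨π.integrable_avgRevenue hF, htriv.2.trans π.integral_avgRevenue_nonneg⟩⟩⟩
  set κ := √(8 * (topValue F * mean F)) with hκ
  set κ' := √(4 * (topValue F * mean F)) with hκ'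
  set r : ℕ → ℕ := fun T => max 1 ⌈fourthRoot T ^ 3⌉₊ with hr
  set δ₁ : ℕ → ℝ := fun T => (mean F + 2 * κ) * (fourthRoot T ^ 2 / T)
    + 2 * κ' * (fourthRoot T ^ 3 / T) + mean F * (1 - ε) * (1 / T) with hδ₁
  have hδ₁0 : Tendsto δ₁ atTop (𝓝 0) := by
    have h := (((tendsto_pow_fourthRoot_div (k := 2) (by norm_num)).const_mul
      (mean F + 2 * κ)).add ((tendsto_pow_fourthRoot_div (k := 3) (by norm_num)).const_mul
      (2 * κ'))).add ((tendsto_one_div_atTop_nhds_zero_nat (𝕜 := ℝ)).const_mul (mean F * (1 - ε)))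
    simpa [hδ₁] using h
  have hr0 : Tendsto (fun T : ℕ => ((r T : ℝ) + 1) / T) atTop (𝓝 0) := by
    have h : Tendsto (fun T : ℕ => fourthRoot T ^ 3 / T + 3 * (1 / (T : ℝ))) atTop (𝓝 0) := by
      simpa using (tendsto_pow_fourthRoot_div (k := 3) (by norm_num)).add
        ((tendsto_one_div_atTop_nhds_zero_nat (𝕜 := ℝ)).const_mul 3)
    refine squeeze_zero (fun T => by positivity) (fun T => ?_) h
    have h1 : (r T : ℝ) ≤ fourthRoot T ^ 3 + 2 := by
      have h2 := (Nat.ceil_lt_add_one (pow_nonneg (fourthRoot_nonneg T) 3)).le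
      have h3 := pow_nonneg (fourthRoot_nonneg T) 3
      simp only [hr, Nat.cast_max, Nat.cast_one]
      exact max_le (by linarith) (by linarith)
    calc ((r T : ℝ) + 1) / T ≤ (fourthRoot T ^ 3 + 2 + 1) / T := by gcongr
      _ = _ := by ring
  set δ₂ : ℕ → ℝ := fun T => ε / 2 * (1 / ((T : ℝ) + 1) + revMyerson F * (((r T : ℝ) + 1) / T))
    with hδ₂
  have hδ₂0 : Tendsto δ₂ atTop (𝓝 0) := by
    simpa [hδ₂] using ((tendsto_one_div_add_atTop_nhds_zero_nat (𝕜 := ℝ)).add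
      (hr0.const_mul (revMyerson F))).const_mul (ε / 2)
  obtain ⟨T₀, hT₀⟩ := eventually_atTop.1 ((eventually_initialCredit_add_le (ε := ε) hF hμ hε1
    (topValue F)).and ((eventually_initialCredit_le_expPayment (ε := ε) hF hμ hε1).and
      (hr0.eventually_le_const one_pos)))
  refine ⟨fun T => if T < T₀ then mean F else max (δ₁ T) (δ₂ T), ?_, ?_⟩
  · have h : Tendsto (fun T => max (δ₁ T) (δ₂ T)) atTop (𝓝 0) := by simpa using hδ₁0.max hδ₂0
    refine h.congr' ?_
    filter_upwards [eventually_ge_atTop T₀] with T hT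
    rw [if_neg (not_lt.2 hT)]
  intro T hT Ω _ P _ π
  refine ⟨fun hπ => ⟨π.integrable_avgRevenue hF, ?_⟩,
    fun k hk hπ => ⟨π.integrable_avgRevenue hF, ?_⟩⟩
  · dsimp only
    split_ifs with hTT
    · exact htriv.1.trans π.integral_avgRevenue_nonneg
    have hT' : (0 : ℝ) < T := by exact_mod_cast hT
    obtain ⟨h1, h2, h3⟩ := hT₀ T (not_lt.1 hTT)
    have hB : 0 < topValue F := hμ.trans_le (mean_le_topValue hF)
    obtain ⟨hp1, hp2⟩ := reservePrice_spec hF T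
    have hrT : r T ≤ T := by
      rw [div_le_one hT'] at h3
      have : (r T : ℝ) ≤ T := by linarith
      exact_mod_cast this
    have h4 := hπ.le_integral_avgRevenue π hF hε0 hε1 hρ (by linarith) (by linarith)
      (le_max_left 1 _ : 1 ≤ r T) hrT (fun t ht => (h2 t ((le_max_right _ _).trans ht)
        ((le_max_left _ _).trans ht)).1) (fun t ht => (h2 t ((le_max_right _ _).trans ht)
        ((le_max_left _ _).trans ht)).2)
    refine le_trans ?_ h4
    set θ := ((r T : ℝ) + 1) / T with hθ
    have hθ0 : 0 ≤ θ := by positivity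
    have h5 : ((T : ℝ) - r T - 1) / T = 1 - θ := by
      rw [hθ]; field_simp; ring
    have h6 : ε / 2 * revMyerson F - max (δ₁ T) (δ₂ T) ≤ ε / 2 * revMyerson F - δ₂ T := by
      linarith [le_max_right (δ₁ T) (δ₂ T)]
    refine h6.trans ?_
    rw [mul_div_assoc, h5]
    have h7 := mul_le_mul_of_nonneg_right hp1 (sub_nonneg.2 h3)
    have h8 : 0 ≤ 1 / ((T : ℝ) + 1) * θ := by positivity
    have h9 : revMyerson F - (1 / ((T : ℝ) + 1) + revMyerson F * θ)
        ≤ reservePrice F T * (1 - cdf F (reservePrice F T)) * (1 - θ) := by linarith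
    have h10 := mul_le_mul_of_nonneg_left h9 (half_pos hε0).le
    simp only [hδ₂]
    linarith
  · dsimp only
    split_ifs with hTT
    · exact htriv.2.trans π.integral_avgRevenue_nonneg
    have hT' : (0 : ℝ) < T := by exact_mod_cast hT
    have h1 := Play.IsLookaheadBuyer.le_integral_avgRevenue π hπ hF hμ hε0 hε1 hρ hT hk
    refine le_trans ?_ h1
    have h2 : (1 - ε) * mean F - max (δ₁ T) (δ₂ T) ≤ (1 - ε) * mean F - δ₁ T := by
      linarith [le_max_left (δ₁ T) (δ₂ T)]
    refine h2.trans ?_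
    rw [le_div_iff₀ hT']
    have h3 := initialCredit_le_mul_sq hF T
    have h4 := le_revenueTarget hF ε T
    have h5 : ((1 - ε) * mean F - δ₁ T) * T = mean F * (1 - ε) * fourthRoot T ^ 4
        - ((mean F + 2 * κ) * fourthRoot T ^ 2 + 2 * κ' * fourthRoot T ^ 3
          + mean F * (1 - ε)) := by
      rw [fourthRoot_pow_four, hδ₁]
      field_simp
    rw [h5]
    linarith

end Robust

/-! ### Concentration of the values -/

section Concentration

variable {Ω S : Type} [mΩ : MeasurableSpace Ω] [MeasurableSpace S] {P : Measure Ω}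
  {M : Mechanism S} {F : Measure ℝ} {T : ℕ} (π : Play M F T P)

lemma Play.integral_value {t : ℕ} (ht : t ∈ Finset.Icc 1 T) : ∫ ω, π.v t ω ∂P = mean F := by
  have h := integral_map (μ := P) (π.measurable_v t).aemeasurable
    (f := fun v : ℝ => v) aestronglyMeasurable_id
  rw [← h, π.value_law t ht]
  rfl

/-- The event that truthful bids alone would keep the total payment above the expected payment, by
at least `μ (1 - ε)`. -/
def Play.creditEvent (π : Play M F T P) (ε : ℝ) : Set Ω :=
  {ω | ∀ t ∈ Finset.Icc 1 T, expPayment ε F T t + mean F * (1 - ε)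
    ≤ initialCredit F T + ∑ j ∈ Finset.Ico 1 t, π.v j ω}

lemma Play.measurableSet_creditEvent (ε : ℝ) : MeasurableSet (π.creditEvent ε) := by
  have : π.creditEvent ε = ⋂ t ∈ Finset.Icc 1 T, {ω | expPayment ε F T t + mean F * (1 - ε)
      ≤ initialCredit F T + ∑ j ∈ Finset.Ico 1 t, π.v j ω} := by
    ext ω
    simp [Play.creditEvent]
  rw [this]
  refine Finset.measurableSet_biInter _ fun t _ => measurableSet_le measurable_const ?_
  exact measurable_const.add (Finset.measurable_fun_sum _ fun j _ => π.measurable_v j)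

variable [IsProbabilityMeasure P]

lemma Play.hasSubgaussianMGF_mean_sub_value {C : ℝ} (hC : ∀ᵐ v ∂F, v ∈ Icc 0 C) {t : ℕ}
    (ht : t ∈ Finset.Icc 1 T) :
    HasSubgaussianMGF (fun ω => mean F - π.v t ω) ((‖C‖₊ / 2) ^ 2) P := by
  have hv : ∀ᵐ ω ∂P, π.v t ω ∈ Icc 0 C := by
    filter_upwards [π.ae_value hC] with ω h using h t ht
  have h := (hasSubgaussianMGF_of_mem_Icc (π.measurable_v t).aemeasurable hv).neg
  rw [π.integral_value ht, sub_zero] at h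
  refine h.congr (ae_of_all _ fun ω => ?_)
  simp

/-- The deviations of the values add up to a sub-Gaussian variable, because the value of a round
is independent of the history. -/
lemma Play.hasSubgaussianMGF_sum {C : ℝ} (hC : ∀ᵐ v ∂F, v ∈ Icc 0 C) {n : ℕ} (hn : n ≤ T) :
    HasSubgaussianMGF (fun ω => ∑ j ∈ Finset.Ico 1 (n + 1), (mean F - π.v j ω))
      (n * (‖C‖₊ / 2) ^ 2) P := by
  induction n with
  | zero => simp
  | succ n ih =>
    have ht : n + 1 ∈ Finset.Icc 1 T := Finset.mem_Icc.2 ⟨by omega, hn⟩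
    have hpast : Measurable[history π.s π.v π.b π.x (n + 1)]
        (fun ω => ∑ j ∈ Finset.Ico 1 (n + 1), (mean F - π.v j ω)) := by
      refine Finset.measurable_fun_sum _ fun j hj => ?_
      rw [Finset.mem_Ico] at hj
      exact measurable_const.sub (π.measurable_history_v hj.1 hj.2)
    have hind : IndepFun (fun ω => ∑ j ∈ Finset.Ico 1 (n + 1), (mean F - π.v j ω))
        (π.v (n + 1)) P := by
      rw [IndepFun_iff_Indep]
      exact indep_of_indep_of_le_left (π.value_indep (n + 1) ht).symm hpast.comap_le
    have h := (ih (by omega)).add_of_indepFun (π.hasSubgaussianMGF_mean_sub_value hC ht)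
      (hind.comp measurable_id (measurable_const.sub measurable_id))
    convert! h using 1
    · ext ω
      rw [Finset.sum_Ico_succ_top (by omega)]
    · push_cast
      ring

/-- Hoeffding's inequality for the values. -/
lemma Play.measureReal_deviation_le {C : ℝ} (hC : ∀ᵐ v ∂F, v ∈ Icc 0 C) {n : ℕ} (hn : n ≤ T)
    {x : ℝ} (hx : 0 ≤ x) :
    P.real {ω | x * n ≤ ∑ j ∈ Finset.Ico 1 (n + 1), (mean F - π.v j ω)}
      ≤ Real.exp (-(2 * x ^ 2 / C ^ 2) * n) := by
  refine ((π.hasSubgaussianMGF_sum hC hn).measure_ge_le (by positivity)).trans_eq ?_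
  congr 1
  rcases Nat.eq_zero_or_pos n with rfl | hn0
  · simp
  · have : (n : ℝ) ≠ 0 := by positivity
    rcases eq_or_ne C 0 with rfl | hC0
    · simp
    · push_cast
      rw [Real.norm_eq_abs, div_pow, sq_abs]
      field_simp

/-- A failure of the credit event is a large deviation that happens after at least `√T - 1`
rounds: before that the initial credit suffices. -/
lemma Play.one_sub_creditEvent_le {ε : ℝ} (hF : IsValuationDist F) (hμ : 0 < mean F)
    (hε0 : 0 < ε) (hε1 : ε < 1) (hT : 1 ≤ T) {C : ℝ} (hC : ∀ᵐ v ∂F, v ∈ Icc 0 C) :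
    1 - P.real (π.creditEvent ε)
      ≤ T * Real.exp (-(2 * (ε * mean F) ^ 2 / C ^ 2) * (√T - 1)) := by
  set κ := 2 * (ε * mean F) ^ 2 / C ^ 2 with hκ
  have hκ0 : 0 ≤ κ := by positivity
  set D : ℕ → Set Ω := fun n =>
    {ω | ε * mean F * n ≤ ∑ j ∈ Finset.Ico 1 (n + 1), (mean F - π.v j ω)} with hD
  set I := (Finset.range T).filter fun n : ℕ => √(T : ℝ) ≤ n + 1 with hI
  rw [← probReal_compl_eq_one_sub (π.measurableSet_creditEvent ε)]
  have h1 : P.real (π.creditEvent ε)ᶜ ≤ P.real (⋃ n ∈ I, D n) := by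
    refine ENNReal.toReal_mono (measure_ne_top _ _) (measure_mono_ae ?_)
    filter_upwards [π.ae_value hF.ae_nonneg] with ω hv hω
    have hω' : ¬ ∀ t ∈ Finset.Icc 1 T, expPayment ε F T t + mean F * (1 - ε)
      ≤ initialCredit F T + ∑ j ∈ Finset.Ico 1 t, π.v j ω := hω
    push Not at hω'
    obtain ⟨t, ht, hlt⟩ := hω'
    rw [Finset.mem_Icc] at ht
    obtain ⟨n, rfl⟩ : ∃ n, t = n + 1 := ⟨t - 1, by omega⟩
    have hc : 0 ≤ mean F * (1 - ε) := mul_nonneg hμ.le (by linarith)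
    have h2 := expPayment_le (ε := ε) (F := F) (T := T) (n + 1)
    rw [Nat.add_sub_cancel] at h2
    have h3 : mean F * √T ≤ initialCredit F T := by
      unfold initialCredit
      linarith [Real.sqrt_nonneg (4 * topValue F * mean F * √T * Real.log T)]
    have h4 : 0 ≤ ∑ j ∈ Finset.Ico 1 (n + 1), π.v j ω := Finset.sum_nonneg fun j hj => by
      rw [Finset.mem_Ico] at hj
      exact hv j (Finset.mem_Icc.2 ⟨hj.1, by omega⟩)
    have h5 : (1 : ℝ) ≤ √T := by
      rw [Real.one_le_sqrt]
      exact_mod_cast hT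
    have h6 : mean F * (1 - ε) ≤ mean F * √T := by
      have : mean F * (1 - ε) ≤ mean F * 1 := mul_le_mul_of_nonneg_left (by linarith) hμ.le
      have := mul_le_mul_of_nonneg_left h5 hμ.le
      linarith
    refine Set.mem_biUnion (x := n) ?_ ?_
    · rw [hI, Finset.coe_filter]
      refine ⟨Finset.mem_range.2 (by omega), ?_⟩
      have h7 : mean F * √T ≤ mean F * (n + 1) := by
        have : mean F * (1 - ε) * (n + 1) ≤ mean F * 1 * (n + 1) := by
          gcongr
          linarith
        linarith
      exact le_of_mul_le_mul_left h7 hμ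
    · simp only [hD, mem_ofPred_eq, Finset.sum_sub_distrib, Finset.sum_const, Nat.card_Ico,
        Nat.add_sub_cancel, nsmul_eq_mul]
      linarith
  refine h1.trans ((measureReal_biUnion_finset_le _ _).trans ?_)
  calc ∑ n ∈ I, P.real (D n) ≤ ∑ _n ∈ I, Real.exp (-κ * (√T - 1)) := by
        refine Finset.sum_le_sum fun n hn => ?_
        rw [hI, Finset.mem_filter, Finset.mem_range] at hn
        refine (π.measureReal_deviation_le hC hn.1.le (by positivity)).trans ?_
        rw [← hκ, Real.exp_le_exp]
        have := mul_le_mul_of_nonneg_left (by linarith [hn.2] : √(T : ℝ) - 1 ≤ n) hκ0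
        linarith
    _ ≤ T * Real.exp (-κ * (√T - 1)) := by
        rw [Finset.sum_const, nsmul_eq_mul]
        gcongr
        exact (Finset.card_filter_le _ _).trans (by simp)

end Concentration

/-- With probability at least `1 - 1 / T` the credit event occurs, for all large `T`, uniformly
over the plays. -/
lemma eventually_le_creditEvent {ε : ℝ} {F : Measure ℝ} (hF : IsValuationDist F)
    (hε0 : 0 < ε) (hε1 : ε < 1) : ∀ᶠ T : ℕ in atTop, ∀ (S : Type) [MeasurableSpace S]
      (M : Mechanism S) (Ω : Type) [MeasurableSpace Ω] (P : Measure Ω) [IsProbabilityMeasure P]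
      (π : Play M F T P), 1 - (T : ℝ) ^ (-(1 : ℝ)) ≤ P.real (π.creditEvent ε) := by
  rcases (mean_nonneg hF).eq_or_lt with hμ | hμ
  · filter_upwards with T S _ M Ω _ P _ π
    have h1 : P.real (π.creditEvent ε) = 1 := by
      rw [measureReal_def, (prob_compl_eq_zero_iff (π.measurableSet_creditEvent ε)).1,
        ENNReal.toReal_one]
      have h : ∀ᵐ ω ∂P, ω ∈ π.creditEvent ε := by
        filter_upwards [π.ae_value hF.ae_nonneg] with ω hv t ht
        have h2 := expPayment_le (ε := ε) (F := F) (T := T) t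
        have h3 := initialCredit_nonneg hF T
        have h4 : 0 ≤ ∑ j ∈ Finset.Ico 1 t, π.v j ω := Finset.sum_nonneg fun j hj => by
          rw [Finset.mem_Ico] at hj
          rw [Finset.mem_Icc] at ht
          exact hv j (Finset.mem_Icc.2 ⟨hj.1, by omega⟩)
        rw [← hμ, zero_mul, zero_mul] at h2
        rw [← hμ, zero_mul]
        linarith
      exact h
    rw [h1]
    have : 0 ≤ (T : ℝ) ^ (-(1 : ℝ)) := by positivity
    linarith
  · obtain ⟨C, hC⟩ := hF.2
    have hC' : ∀ᵐ v ∂F, v ∈ Icc 0 (max C 1) := by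
      filter_upwards [hC] with v hv using ⟨hv.1, hv.2.trans (le_max_left _ _)⟩
    have hC0 : 0 < max C 1 := lt_max_of_lt_right one_pos
    set κ := 2 * (ε * mean F) ^ 2 / (max C 1) ^ 2 with hκ
    have hκ0 : 0 < κ := by positivity
    have hlim : Tendsto (fun T : ℕ => Real.exp (κ * √(T : ℝ)) / √(T : ℝ) ^ (4 : ℝ)) atTop atTop :=
      (tendsto_exp_mul_div_rpow_atTop 4 κ hκ0).comp
        (Real.tendsto_sqrt_atTop.comp tendsto_natCast_atTop_atTop)
    filter_upwards [hlim.eventually_ge_atTop (Real.exp κ), eventually_ge_atTop 1]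
      with T hT hT1 S _ M Ω _ P _ π
    have h1 := π.one_sub_creditEvent_le hF hμ hε0 hε1 hT1 hC'
    have hT0 : (0 : ℝ) < T := by exact_mod_cast hT1
    rw [← hκ] at h1
    have h2 : √(T : ℝ) ^ (4 : ℝ) = (T : ℝ) ^ 2 := by
      rw [show (4 : ℝ) = ((4 : ℕ) : ℝ) by norm_num, Real.rpow_natCast,
        show √(T : ℝ) ^ 4 = (√(T : ℝ) ^ 2) ^ 2 by ring, Real.sq_sqrt hT0.le]
    rw [h2, le_div_iff₀ (by positivity)] at hT
    have h3 : T * Real.exp (-κ * (√T - 1)) ≤ (T : ℝ) ^ (-(1 : ℝ)) := by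
      rw [Real.rpow_neg_one, show -κ * (√(T : ℝ) - 1) = κ - κ * √T by ring, Real.exp_sub,
        mul_div_assoc', div_le_iff₀ (Real.exp_pos _), inv_mul_eq_div, le_div_iff₀ hT0]
      linarith
    linarith

/-! ### The play of a buyer with a given bidding policy -/

section Simulation

/-- The law of a coin that shows `1` with probability `ρ`, and `0` otherwise. -/
noncomputable def coinLaw (ρ : unitInterval) : Measure ℝ :=
  ENNReal.ofReal ρ • Measure.dirac 1 + ENNReal.ofReal (1 - ρ) • Measure.dirac 0

instance (ρ : unitInterval) : IsProbabilityMeasure (coinLaw ρ) := by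
  constructor
  simp only [coinLaw, Measure.add_apply, Measure.smul_apply, measure_univ, smul_eq_mul, mul_one]
  rw [← ENNReal.ofReal_add ρ.2.1 (sub_nonneg.2 ρ.2.2)]
  simp

lemma integral_coinLaw (ρ : unitInterval) (f : ℝ → ℝ) :
    ∫ u, f u ∂(coinLaw ρ) = ρ * f 1 + (1 - ρ) * f 0 := by
  have h0 := ρ.2.1
  have h1 := ρ.2.2
  have hint : ∀ a : ℝ, Integrable f (Measure.dirac a) := fun a => integrable_dirac (by simp)
  rw [coinLaw, integral_add_measure ((hint 1).smul_measure ENNReal.ofReal_ne_top)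
    ((hint 0).smul_measure ENNReal.ofReal_ne_top), integral_smul_measure, integral_smul_measure,
    integral_dirac, integral_dirac, ENNReal.toReal_ofReal h0,
    ENNReal.toReal_ofReal (sub_nonneg.2 h1)]
  rfl

/-- The laws of a sequence of independent draws that suffices to simulate a play: draw `2 t` is the
value of round `t`, and draw `2 t + 1` is the coin that decides on the allocation in a bad
state. -/
noncomputable def drawLaw (F : Measure ℝ) (ρ : unitInterval) (i : ℕ) : Measure ℝ :=
  if Even i then F else coinLaw ρ

instance (F : Measure ℝ) [IsProbabilityMeasure F] (ρ : unitInterval) (i : ℕ) :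
    IsProbabilityMeasure (drawLaw F ρ i) := by
  unfold drawLaw
  split_ifs <;> infer_instance

/-- The information in the draws `0, …, n`. -/
noncomputable def drawFiltration : Filtration ℕ (inferInstance : MeasurableSpace (ℕ → ℝ)) :=
  Filtration.natural (fun i (ω : ℕ → ℝ) => ω i) fun i => (measurable_pi_apply i).stronglyMeasurable

lemma measurable_draw {i n : ℕ} (h : i ≤ n) :
    Measurable[drawFiltration n] fun ω : ℕ → ℝ => ω i :=
  measurable_iff_comap_le.2 (le_iSup₂_of_le (f := fun j (_ : j ≤ n) =>
    MeasurableSpace.comap (fun ω : ℕ → ℝ => ω j) inferInstance) i h le_rfl)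

lemma indep_draw (F : Measure ℝ) [IsProbabilityMeasure F] (ρ : unitInterval) {n i : ℕ}
    (h : n < i) : Indep (MeasurableSpace.comap (fun ω : ℕ → ℝ => ω i) inferInstance)
      (drawFiltration n) (Measure.infinitePi (drawLaw F ρ)) :=
  iIndepFun.indep_comap_natural_of_lt (fun i => (measurable_pi_apply i).stronglyMeasurable)
    (iIndepFun_infinitePi (P := drawLaw F ρ) (X := fun _ u => u) fun _ => measurable_id) h

/-- Whether the good is sold, given the coin. -/
noncomputable def sale (p : ℝ≥0) (s : TargetState) (b : ℝ≥0) (u : ℝ) : Bool :=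
  decide (s.2.1 ≤ s.1 ∨ (p ≤ b ∧ u = 1))

variable (ε : ℝ) (ρ : unitInterval) (p : ℝ≥0) (F : Measure ℝ) (T : ℕ)
  (β : TargetState → ℝ → ℝ≥0)

/-- The state after a round with value `v` and coin `u`, if the buyer bids `β s v`. -/
noncomputable def simNext (s : TargetState) (v u : ℝ) : TargetState :=
  nextState ε F T s (sale p s (β s v) u)
    ((mInfinity ε ρ p F T).pay s (β s v) (sale p s (β s v) u))

/-- The state at the beginning of round `t` as a function of the draws. The value at `t = 0` is
arbitrary. -/
noncomputable def simState : ℕ → (ℕ → ℝ) → TargetState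
  | 0, _ => (initialCredit F T, 0, 1)
  | 1, _ => (initialCredit F T, 0, 1)
  | t + 2, ω => simNext ε ρ p F T β (simState (t + 1) ω) (ω (2 * (t + 1))) (ω (2 * (t + 1) + 1))

variable {ε ρ p F T β}

lemma simState_succ {t : ℕ} (ht : 1 ≤ t) (ω : ℕ → ℝ) : simState ε ρ p F T β (t + 1) ω
    = simNext ε ρ p F T β (simState ε ρ p F T β t ω) (ω (2 * t)) (ω (2 * t + 1)) := by
  obtain ⟨t, rfl⟩ : ∃ k, t = k + 1 := ⟨t - 1, by omega⟩
  rw [simState]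

lemma measurable_sale :
    Measurable fun q : TargetState × ℝ≥0 × ℝ => sale p q.1 q.2.1 q.2.2 := by
  refine measurable_to_bool ?_
  have h1 : MeasurableSet {q : TargetState × ℝ≥0 × ℝ | q.1.2.1 ≤ q.1.1} :=
    measurableSet_le (by fun_prop) (by fun_prop)
  have h2 : MeasurableSet {q : TargetState × ℝ≥0 × ℝ | p ≤ q.2.1} :=
    measurableSet_le (by fun_prop) (by fun_prop)
  have h3 : MeasurableSet {q : TargetState × ℝ≥0 × ℝ | q.2.2 = 1} :=
    (measurableSet_singleton (1 : ℝ)).preimage (by fun_prop)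
  convert! h1.union (h2.inter h3) using 1
  ext q
  exact decide_eq_true_iff

lemma measurable_simNext (hβ : Measurable fun q : TargetState × ℝ => β q.1 q.2) :
    Measurable fun q : TargetState × ℝ × ℝ => simNext ε ρ p F T β q.1 q.2.1 q.2.2 := by
  have hb : Measurable fun q : TargetState × ℝ × ℝ => β q.1 q.2.1 :=
    hβ.comp (by fun_prop : Measurable fun q : TargetState × ℝ × ℝ => (q.1, q.2.1))
  have hx : Measurable fun q : TargetState × ℝ × ℝ =>
      sale p q.1 (β q.1 q.2.1) q.2.2 :=
    measurable_sale.comp (measurable_fst.prodMk (hb.prodMk measurable_snd.snd))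
  exact measurable_nextState.comp (measurable_fst.prodMk (hx.prodMk
    ((measurable_pay (ε := ε) (ρ := ρ) (p := p)).comp
      (measurable_fst.prodMk (hb.prodMk hx)))))

lemma measurable_simState (hβ : Measurable fun q : TargetState × ℝ => β q.1 q.2) {t n : ℕ}
    (ht : 1 ≤ t) (hn : 2 * t ≤ n + 1) :
    Measurable[drawFiltration n] (simState ε ρ p F T β t) := by
  induction t, ht using Nat.le_induction generalizing n with
  | base => exact measurable_const
  | succ t ht ih =>
    have h : simState ε ρ p F T β (t + 1) = fun ω => simNext ε ρ p F T β
        (simState ε ρ p F T β t ω) (ω (2 * t)) (ω (2 * t + 1)) := funext fun ω => simState_succ ht ω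
    rw [h]
    exact (measurable_simNext hβ).comp ((ih (by omega)).prodMk
      ((measurable_draw (by omega)).prodMk (measurable_draw (by omega))))

lemma measurable_simBid (hβ : Measurable fun q : TargetState × ℝ => β q.1 q.2) {t n : ℕ}
    (ht : 1 ≤ t) (hn : 2 * t ≤ n) :
    Measurable[drawFiltration n] fun ω => β (simState ε ρ p F T β t ω) (ω (2 * t)) :=
  hβ.comp ((measurable_simState hβ ht (by omega)).prodMk (measurable_draw hn))

lemma measurable_simSale (hβ : Measurable fun q : TargetState × ℝ => β q.1 q.2) {t n : ℕ}
    (ht : 1 ≤ t) (hn : 2 * t + 1 ≤ n) :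
    Measurable[drawFiltration n] fun ω => sale p (simState ε ρ p F T β t ω)
      (β (simState ε ρ p F T β t ω) (ω (2 * t))) (ω (2 * t + 1)) :=
  measurable_sale.comp ((measurable_simState hβ ht (by omega)).prodMk
    ((measurable_simBid hβ ht (by omega)).prodMk (measurable_draw hn)))

lemma simHistory_le (hβ : Measurable fun q : TargetState × ℝ => β q.1 q.2) {t n : ℕ}
    (hn : 2 * t ≤ n + 1) :
    history (simState ε ρ p F T β) (fun t ω => ω (2 * t))
      (fun t ω => β (simState ε ρ p F T β t ω) (ω (2 * t)))
      (fun t ω => sale p (simState ε ρ p F T β t ω)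
        (β (simState ε ρ p F T β t ω) (ω (2 * t))) (ω (2 * t + 1))) t
      ≤ drawFiltration n := by
  refine history_le_of (fun i hi => ?_) (fun i hi => ?_) (fun i hi => ?_) (fun i hi => ?_)
  · rw [Finset.mem_Icc] at hi
    exact measurable_simState hβ hi.1 (by omega)
  all_goals rw [Finset.mem_Ico] at hi
  · exact measurable_draw (by omega)
  · exact measurable_simBid hβ hi.1 (by omega)
  · exact measurable_simSale hβ hi.1 (by omega)

lemma measurable_simState_of_le (hβ : Measurable fun q : TargetState × ℝ => β q.1 q.2) (t : ℕ) :
    Measurable (simState ε ρ p F T β t) := by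
  rcases Nat.eq_zero_or_pos t with rfl | ht
  · exact measurable_const
  · exact (measurable_simState hβ ht (by omega : 2 * t ≤ 2 * t + 1)).mono
      (drawFiltration.le _) le_rfl

/-- The conditional probability of a sale. -/
lemma condExp_sale [IsProbabilityMeasure F] {t : ℕ} {m : MeasurableSpace (ℕ → ℝ)}
    (hm : m ≤ drawFiltration (2 * t)) {s : (ℕ → ℝ) → TargetState} {b : (ℕ → ℝ) → ℝ≥0}
    (hs : Measurable[m] s) (hb : Measurable[m] b) :
    (Measure.infinitePi (drawLaw F ρ))[fun ω =>
        if sale p (s ω) (b ω) (ω (2 * t + 1)) = true then (1 : ℝ) else 0 | m]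
      =ᵐ[Measure.infinitePi (drawLaw F ρ)]
        fun ω => ((mInfinity ε ρ p F T).alloc (s ω) (b ω) : ℝ) := by
  have hm' : m ≤ MeasurableSpace.pi := hm.trans (drawFiltration.le _)
  set A : (ℕ → ℝ) → ℝ := fun ω => if (s ω).2.1 ≤ (s ω).1 then 1 else 0 with hA
  set D : (ℕ → ℝ) → ℝ := fun ω => if (s ω).2.1 ≤ (s ω).1 then 0 else if p ≤ b ω then 1 else 0
    with hD
  set K : (ℕ → ℝ) → ℝ := fun ω => if ω (2 * t + 1) = 1 then 1 else 0 with hK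
  have hgood : MeasurableSet[m] {ω | (s ω).2.1 ≤ (s ω).1} := hs measurableSet_good
  have hprice : MeasurableSet[m] {ω | p ≤ b ω} := hb measurableSet_Ici
  have hAm : Measurable[m] A := Measurable.ite hgood measurable_const measurable_const
  have hDm : Measurable[m] D := Measurable.ite hgood measurable_const
    (Measurable.ite hprice measurable_const measurable_const)
  have hKf : Measurable fun u : ℝ => if u = 1 then (1 : ℝ) else 0 :=
    Measurable.ite (measurableSet_singleton 1) measurable_const measurable_const
  have hKm : Measurable[MeasurableSpace.comap (fun ω : ℕ → ℝ => ω (2 * t + 1)) inferInstance] K :=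
    hKf.comp (comap_measurable _)
  have hKm' : Measurable[MeasurableSpace.pi] K := hKf.comp (measurable_pi_apply _)
  have hsum : (fun ω : ℕ → ℝ =>
      if sale p (s ω) (b ω) (ω (2 * t + 1)) = true then (1 : ℝ) else 0) = A + D * K := by
    ext ω
    simp only [hA, hD, hK, sale, decide_eq_true_eq, Pi.add_apply, Pi.mul_apply]
    split_ifs <;> simp_all
  have hAi : Integrable A (Measure.infinitePi (drawLaw F ρ)) :=
    Integrable.of_mem_Icc 0 1 (hAm.mono hm' le_rfl).aemeasurable
      (ae_of_all _ fun ω => by simp only [hA]; split_ifs <;> simp)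
  have hKi : Integrable K (Measure.infinitePi (drawLaw F ρ)) :=
    Integrable.of_mem_Icc 0 1 hKm'.aemeasurable
      (ae_of_all _ fun ω => by simp only [hK]; split_ifs <;> simp)
  have hDKi : Integrable (D * K) (Measure.infinitePi (drawLaw F ρ)) :=
    Integrable.of_mem_Icc 0 1 ((hDm.mono hm' le_rfl).mul hKm').aemeasurable
      (ae_of_all _ fun ω => by
        simp only [hD, hK, Pi.mul_apply]; split_ifs <;> simp)
  have hKint : ∫ ω, K ω ∂(Measure.infinitePi (drawLaw F ρ)) = ρ := by
    have h := integral_map (μ := Measure.infinitePi (drawLaw F ρ))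
      (measurable_pi_apply (2 * t + 1)).aemeasurable
      (f := fun u : ℝ => if u = 1 then (1 : ℝ) else 0) hKf.aestronglyMeasurable
    have h2 : drawLaw F ρ (2 * t + 1) = coinLaw ρ := if_neg (by simp)
    rw [Measure.infinitePi_map_eval, h2, integral_coinLaw] at h
    rw [← h]
    simp
  have hind := condExp_indep_eq (μ := Measure.infinitePi (drawLaw F ρ))
    (measurable_pi_apply (2 * t + 1)).comap_le hm' hKm.stronglyMeasurable
    (indep_of_indep_of_le_right (indep_draw F ρ (Nat.lt_succ_self (2 * t))) hm)
  rw [hsum]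
  filter_upwards [condExp_add hAi hDKi m, hind,
    condExp_mul_of_stronglyMeasurable_left hDm.stronglyMeasurable hDKi hKi] with ω h1 h2 h3
  rw [h1, Pi.add_apply, h3, Pi.mul_apply, h2, hKint,
    condExp_of_stronglyMeasurable hm' hAm.stronglyMeasurable hAi, mInfinity_alloc]
  simp only [hA, hD]
  split_ifs <;> simp

lemma condExp_indicator_nextState {Ω : Type} {m mΩ : MeasurableSpace Ω} {P : Measure Ω}
    [IsProbabilityMeasure P] (hm : m ≤ mΩ) {s s' : Ω → TargetState} {b : Ω → ℝ≥0} {x : Ω → Bool}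
    (hs : Measurable[m] s) (hb : Measurable[m] b) (hx : Measurable[m] x)
    (hs' : ∀ ω, s' ω = nextState ε F T (s ω) (x ω) ((mInfinity ε ρ p F T).pay (s ω) (b ω) (x ω)))
    {A : Set TargetState} (hA : MeasurableSet A) :
    P[(s' ⁻¹' A).indicator (fun _ => (1 : ℝ)) | m] =ᵐ[P] fun ω =>
      ((mInfinity ε ρ p F T).next (s ω) (b ω) (x ω)
        ((mInfinity ε ρ p F T).pay (s ω) (b ω) (x ω)) : Measure TargetState).real A := by
  have hsm : Measurable[m] s' := by
    rw [funext hs']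
    exact measurable_nextState.comp (hs.prodMk (hx.prodMk
      ((measurable_pay (ε := ε) (ρ := ρ) (p := p)).comp (hs.prodMk (hb.prodMk hx)))))
  have hAm : MeasurableSet[m] (s' ⁻¹' A) := hsm hA
  rw [condExp_of_stronglyMeasurable hm (stronglyMeasurable_const.indicator hAm)
    ((integrable_const (1 : ℝ)).indicator (hm _ hAm))]
  refine ae_of_all _ fun ω => ?_
  beta_reduce
  rw [mInfinity_next, measureReal_def, Measure.dirac_apply' _ hA, ← hs' ω]
  by_cases h : s' ω ∈ A
  · simp [h]
  · simp [h]

/-- The play in which the buyer bids `β s v` in state `s` with value `v`. -/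
noncomputable def simPlay [IsProbabilityMeasure F]
    (hβ : Measurable fun q : TargetState × ℝ => β q.1 q.2) :
    Play (mInfinity ε ρ p F T) F T (Measure.infinitePi (drawLaw F ρ)) where
  s := simState ε ρ p F T β
  v t ω := ω (2 * t)
  b t ω := β (simState ε ρ p F T β t ω) (ω (2 * t))
  x t ω := sale p (simState ε ρ p F T β t ω)
    (β (simState ε ρ p F T β t ω) (ω (2 * t))) (ω (2 * t + 1))
  measurable_s := measurable_simState_of_le hβ
  measurable_v t := measurable_pi_apply _
  measurable_b t := hβ.comp ((measurable_simState_of_le hβ t).prodMk (measurable_pi_apply _))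
  measurable_x t := measurable_sale.comp ((measurable_simState_of_le hβ t).prodMk
    ((hβ.comp ((measurable_simState_of_le hβ t).prodMk (measurable_pi_apply _))).prodMk
      (measurable_pi_apply _)))
  start_eq ω := rfl
  value_law t _ := by
    rw [Measure.infinitePi_map_eval]
    exact if_pos (even_two_mul t)
  value_indep t ht := by
    rw [Finset.mem_Icc] at ht
    exact indep_of_indep_of_le_right (indep_draw F ρ (by omega : 2 * t - 1 < 2 * t))
      (simHistory_le hβ (by omega))
  alloc_law t ht := by
    rw [Finset.mem_Icc] at ht
    exact condExp_sale (sup_le (simHistory_le hβ (by omega)) (sup_le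
      (measurable_draw le_rfl).comap_le (measurable_simBid hβ ht.1 le_rfl).comap_le))
      ((measurable_history_state ht.1 le_rfl).mono le_sup_left le_rfl)
      (measurable_iff_comap_le.2 (le_sup_right.trans le_sup_right))
  next_law t ht A hA := by
    rw [Finset.mem_Ico] at ht
    exact condExp_indicator_nextState (sup_le (sup_le ((simHistory_le (n := 2 * t) hβ
      (by omega)).trans (drawFiltration.le _)) (sup_le (measurable_pi_apply _).comap_le
      ((measurable_simBid hβ ht.1 le_rfl).mono (drawFiltration.le _) le_rfl).comap_le))
      ((measurable_simSale hβ ht.1 le_rfl).mono (drawFiltration.le _) le_rfl).comap_le)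
      ((measurable_history_state ht.1 le_rfl).mono (le_sup_left.trans le_sup_left) le_rfl)
      (measurable_iff_comap_le.2 ((le_sup_right.trans le_sup_right).trans le_sup_left))
      (measurable_iff_comap_le.2 le_sup_right) (simState_succ ht.1) hA

end Simulation

/-! ### Ex-post rationality for a myopic buyer -/

section MyopicPolicy

variable {ε : ℝ} {ρ : unitInterval} {p : ℝ≥0} {F : Measure ℝ} {T : ℕ}

/-- An optimal policy of a myopic buyer: bid nothing in a good state; in a bad state bid the price
if it does not exceed the value. The amount charged for this bid may be lower than the price, when
the total payment is close to the target. -/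
noncomputable def myopicBid (ε : ℝ) (ρ : unitInterval) (p : ℝ≥0) (F : Measure ℝ) (T : ℕ)
    (s : TargetState) (v : ℝ) : ℝ≥0 :=
  if s.2.1 ≤ s.1 then 0 else if (mInfinity ε ρ p F T).pay s p true ≤ v then p else 0

lemma measurable_myopicBid :
    Measurable fun q : TargetState × ℝ => myopicBid ε ρ p F T q.1 q.2 := by
  have h1 : MeasurableSet {q : TargetState × ℝ | q.1.2.1 ≤ q.1.1} :=
    measurableSet_le (by fun_prop) (by fun_prop)
  have h2 : Measurable fun q : TargetState × ℝ => (mInfinity ε ρ p F T).pay q.1 p true :=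
    measurable_pay.comp (measurable_fst.prodMk (measurable_const.prodMk measurable_const))
  exact Measurable.ite h1 measurable_const
    (Measurable.ite (measurableSet_le h2 measurable_snd) measurable_const measurable_const)

lemma pay_mono (s : TargetState) {b b' : ℝ≥0} (h : b ≤ b') :
    (mInfinity ε ρ p F T).pay s b true ≤ (mInfinity ε ρ p F T).pay s b' true := by
  rw [mInfinity_pay, mInfinity_pay]
  split_ifs
  · exact min_le_min_right _ (by exact_mod_cast h)
  · exact le_rfl

lemma roundUtility_myopicBid (s : TargetState) {v : ℝ} (hv : 0 ≤ v) :
    IsOptimalBid (mInfinity ε ρ p F T) F 0 s v (myopicBid ε ρ p F T s v) ∧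
      0 ≤ roundUtility (mInfinity ε ρ p F T) s v (myopicBid ε ρ p F T s v) := by
  have hpay : ∀ b, 0 ≤ (mInfinity ε ρ p F T).pay s b true :=
    fun b => mInfinity_nonPaymentForceful.1 s b true
  have hzero : (mInfinity ε ρ p F T).pay s 0 true = 0 := mInfinity_nonPaymentForceful.2 s true
  have hmono : ∀ b, p ≤ b →
      (mInfinity ε ρ p F T).pay s p true ≤ (mInfinity ε ρ p F T).pay s b true :=
    fun b hb => pay_mono s hb
  have hρ := ρ.2.1
  simp only [IsOptimalBid, lookaheadUtility, mInfinity_roundUtility, mInfinity_alloc, myopicBid]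
  by_cases hE : s.2.1 ≤ s.1
  · simp only [hE, if_true, hzero, Icc.coe_one, one_mul, sub_zero]
    exact ⟨fun b => by linarith [hpay b], hv⟩
  · simp only [hE, if_false]
    by_cases hpv : (mInfinity ε ρ p F T).pay s p true ≤ v
    · simp only [hpv, if_true, le_rfl]
      refine ⟨fun b => ?_, mul_nonneg hρ (by linarith)⟩
      split_ifs with hb
      · exact mul_le_mul_of_nonneg_left (by linarith [hmono b hb]) hρ
      · rw [Icc.coe_zero, zero_mul]
        exact mul_nonneg hρ (by linarith)
    · -- a price above the value is positive, so that the bid `0` does not win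
      have hp : ¬ p ≤ 0 := fun h => hpv (((pay_mono s h).trans_eq hzero).trans hv)
      simp only [hpv, hp, if_false, Icc.coe_zero, zero_mul, le_refl, and_true]
      intro b
      split_ifs with hb
      · exact mul_nonpos_of_nonneg_of_nonpos hρ (by linarith [hmono b hb])
      · simp

lemma myopicPerRoundExPostIR_mInfinity (hF : IsValuationDist F) :
    MyopicPerRoundExPostIR (mInfinity ε ρ p F T) F T := by
  have := hF.1
  refine ⟨ℕ → ℝ, inferInstance, Measure.infinitePi (drawLaw F ρ), inferInstance,
    simPlay (measurable_myopicBid (ε := ε) (ρ := ρ) (p := p) (F := F) (T := T)), ?_, ?_⟩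
  · intro t ht
    filter_upwards [Play.ae_value (simPlay measurable_myopicBid) hF.ae_nonneg] with ω hω
    rw [Nat.zero_min]
    exact (roundUtility_myopicBid _ (hω t ht)).1
  · filter_upwards [Play.ae_value (simPlay measurable_myopicBid) hF.ae_nonneg] with ω hω t ht
    exact (roundUtility_myopicBid _ (hω t ht)).2

end MyopicPolicy

/-! ### Truthful bids and an infinite lookahead -/

section Truthful

variable {ε : ℝ} {ρ : unitInterval} {p : ℝ≥0} {F : Measure ℝ} {T : ℕ}

/-- For all large `T` the expected payment of the first `T - 1` rounds exceeds the target, so that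
to stay in good states to the end is not cheaper than to reach the target. -/
lemma eventually_revenueTarget_le (hF : IsValuationDist F) (hε0 : 0 < ε) :
    ∀ᶠ T : ℕ in atTop, revenueTarget ε F T ≤ expPayment ε F T T := by
  filter_upwards [eventually_ge_atTop 3] with T hT
  have hT' : (3 : ℝ) ≤ T := by exact_mod_cast hT
  have hμ := mean_nonneg hF
  have h1 : 1 ≤ Real.log T := by
    rw [Real.le_log_iff_exp_le (by linarith)]
    linarith [Real.exp_one_lt_d9]
  have h2 : (1 : ℝ) ≤ √(T : ℝ) := by rw [Real.one_le_sqrt]; linarith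
  have h3 : mean F ≤ √(4 * topValue F * mean F * √T * Real.log T) := by
    refine Real.le_sqrt_of_sq_le ?_
    have h4 : mean F * mean F ≤ topValue F * mean F :=
      mul_le_mul_of_nonneg_right (mean_le_topValue hF) hμ
    have h5 : (1 : ℝ) ≤ √T * Real.log T := one_le_mul_of_one_le_of_one_le h2 h1
    have h6 := le_mul_of_one_le_right (topValue_mul_mean_nonneg hF) h5
    have h7 := topValue_mul_mean_nonneg hF
    calc mean F ^ 2 ≤ topValue F * mean F * (√T * Real.log T) := by linarith
      _ ≤ 4 * (topValue F * mean F * (√T * Real.log T)) := by linarith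
      _ = _ := by ring
  have h4 := expStep_le ε F T T
  have h5 := mul_nonneg hμ hε0.le
  rw [revenueTarget_eq, expPayment_succ (by omega)]
  linarith

/-- The states of a trajectory on which every bid keeps on track: the target is reached, or all
states have been good and the expected payment of the next round is below the target. -/
def IsOnTrack (ε : ℝ) (F : Measure ℝ) (T t : ℕ) (s : TargetState) : Prop :=
  (revenueTarget ε F T ≤ s.1 ∧ 0 ≤ s.1 ∧ s.2.1 ≤ s.1) ∨
    (s.1 < revenueTarget ε F T ∧ 0 ≤ s.1 ∧ s.2.1 ≤ s.1 ∧ s.2.1 = expPayment ε F T t ∧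
      expPayment ε F T (t + 1) ≤ revenueTarget ε F T)

lemma IsOnTrack.good {t : ℕ} {s : TargetState} (h : IsOnTrack ε F T t s) : s.2.1 ≤ s.1 := by
  rcases h with h | h
  · exact h.2.2
  · exact h.2.2.1

lemma IsOnTrack.isOptimalBid {t : ℕ} {TP EP v : ℝ} {b : ℝ≥0} (h : IsOnTrack ε F T t (TP, EP, t))
    (hF : IsValuationDist F) (hε0 : 0 < ε) (hε1 : ε < 1) (hρ : (ρ : ℝ) = ε / (2 - ε))
    (hT : revenueTarget ε F T ≤ expPayment ε F T T) (ht : t ∈ Finset.Icc 1 T)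
    (hb : KeepsOnTrack ε F T (TP, EP, t) b) :
    IsOptimalBid (mInfinity ε ρ p F T) F (T - t) (TP, EP, t) v b := by
  rw [Finset.mem_Icc] at ht
  rcases h with ⟨h1, -, h2⟩ | ⟨h1, h2, h3, h4, h5⟩
  · exact isOptimalBid_of_target_le h1 h2 _
  · simp only at h1 h2 h3 h4
    refine isOptimalBid_of_keepsOnTrack hF hε0 hε1 hρ h2 h1 h3 ?_ ?_ hb
    · rwa [h4, ← expPayment_succ ht.1]
    · rwa [h4, expPayment_add_cumStep ht.1, Nat.add_sub_cancel' ht.2]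

lemma isOnTrack_start (hF : IsValuationDist F) (hε0 : 0 < ε) (hT : 1 ≤ T) :
    IsOnTrack ε F T 1 (initialCredit F T, 0, 1) := by
  have h0 := initialCredit_nonneg hF T
  rcases le_or_gt (revenueTarget ε F T) (initialCredit F T) with h | h
  · exact Or.inl ⟨h, h0, h0⟩
  · refine Or.inr ⟨h, h0, h0, by simp, ?_⟩
    have h1 := expStep_le ε F T 1
    have h2 : mean F * 1 ≤ mean F * √T := mul_le_mul_of_nonneg_left
      (by rw [Real.one_le_sqrt]; exact_mod_cast hT) (mean_nonneg hF)
    have h3 := mul_nonneg (mean_nonneg hF) hε0.le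
    have h4 : mean F * √T ≤ initialCredit F T := by
      unfold initialCredit
      linarith [Real.sqrt_nonneg (4 * topValue F * mean F * √T * Real.log T)]
    rw [expPayment_succ le_rfl, expPayment_one]
    linarith

lemma IsTrajectory.isOnTrack_succ {s : ℕ → TargetState} {b : ℕ → ℝ≥0} {x : ℕ → Bool}
    (h : IsTrajectory ε ρ p F T s b x) {t : ℕ} (h1 : 1 ≤ t) (hT : t < T)
    (hs : IsOnTrack ε F T t (s t)) (hb : KeepsOnTrack ε F T (s t) (b t)) :
    IsOnTrack ε F T (t + 1) (s (t + 1)) := by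
  rcases hs with ⟨h2, h3, -⟩ | ⟨h2, h3, h4, h5, h6⟩
  · rw [h.next t (Finset.mem_Ico.2 ⟨h1, hT⟩), h.eq_mk h1 hT.le, nextState_done h2]
    exact Or.inl ⟨h2, h3, h3⟩
  · have hz : 0 ≤ min (b t : ℝ) (revenueTarget ε F T - (s t).1) :=
      le_min (b t).coe_nonneg (by linarith)
    have hround := h.round_eq h1 hT.le
    rw [h.next_good h1 hT h2 h4, h5, ← expPayment_succ h1]
    rcases le_or_gt (revenueTarget ε F T - (s t).1) (b t) with h7 | h7
    · rw [min_eq_right h7]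
      exact Or.inl ⟨by simp, by simp only; linarith, by simp only; linarith⟩
    · rw [min_eq_left h7.le]
      rcases hb with hb | ⟨hb1, hb2⟩
      · linarith
      · rw [hround, h5, ← expPayment_succ h1] at hb1 hb2
        rw [← expPayment_succ (by omega)] at hb2
        exact Or.inr ⟨by simp only; linarith, by simp only; linarith [(b t).coe_nonneg], hb1,
          rfl, hb2⟩

lemma IsTrajectory.isOnTrack {s : ℕ → TargetState} {b : ℕ → ℝ≥0} {x : ℕ → Bool}
    (h : IsTrajectory ε ρ p F T s b x) (hF : IsValuationDist F) (hε0 : 0 < ε) {t : ℕ}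
    (h1 : 1 ≤ t) (hT : t ≤ T)
    (hb : ∀ j ∈ Finset.Ico 1 t, KeepsOnTrack ε F T (s j) (b j)) : IsOnTrack ε F T t (s t) := by
  induction t, h1 using Nat.le_induction with
  | base =>
    rw [h.start]
    exact isOnTrack_start hF hε0 hT
  | succ t h1 ih =>
    refine h.isOnTrack_succ h1 hT (ih (by omega) fun j hj => hb j ?_)
      (hb t (Finset.mem_Ico.2 ⟨h1, by omega⟩))
    rw [Finset.mem_Ico] at hj ⊢
    omega

/-- As long as the bids were truthful, the credit event makes the true value keep on track. -/
lemma IsTrajectory.keepsOnTrack_value {s : ℕ → TargetState} {b : ℕ → ℝ≥0} {x : ℕ → Bool}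
    {v : ℕ → ℝ} (h : IsTrajectory ε ρ p F T s b x)
    (hT : revenueTarget ε F T ≤ expPayment ε F T T) (hc : 0 ≤ mean F * (1 - ε))
    (hcred : ∀ t ∈ Finset.Icc 1 T, expPayment ε F T t + mean F * (1 - ε)
      ≤ initialCredit F T + ∑ j ∈ Finset.Ico 1 t, v j)
    {t : ℕ} (ht : t ∈ Finset.Icc 1 T) (hv : ∀ j ∈ Finset.Icc 1 t, 0 ≤ v j)
    (hb : ∀ j ∈ Finset.Ico 1 t, (b j : ℝ) = v j) : KeepsOnTrack ε F T (s t) (v t) := by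
  rw [Finset.mem_Icc] at ht
  have key : ∀ j, 1 ≤ j → j ≤ t → revenueTarget ε F T ≤ (s j).1 ∨
      ((s j).1 = initialCredit F T + ∑ i ∈ Finset.Ico 1 j, v i ∧
        (s j).2.1 = expPayment ε F T j) := by
    intro j hj
    induction j, hj using Nat.le_induction with
    | base => intro _; right; rw [h.start]; simp
    | succ j hj ih =>
      intro hjt
      rcases le_or_gt (revenueTarget ε F T) (s j).1 with h1 | h1
      · exact Or.inl (h1.trans (h.le_succ hj (by omega)))
      · rcases ih (by omega) with h2 | ⟨h2, h3⟩
        · exact absurd h1 (not_lt.2 h2)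
        have h4 := hcred j (Finset.mem_Icc.2 ⟨hj, by omega⟩)
        rw [h.next_good hj (by omega) h1 (by rw [h2, h3]; linarith),
          hb j (Finset.mem_Ico.2 ⟨hj, by omega⟩)]
        rcases le_or_gt (revenueTarget ε F T - (s j).1) (v j) with h5 | h5
        · left
          rw [min_eq_right h5]
          simp
        · right
          rw [min_eq_left h5.le, Finset.sum_Ico_succ_top hj, expPayment_succ hj, h2, h3]
          exact ⟨by ring, rfl⟩
  have hvt := hv t (Finset.mem_Icc.2 ⟨ht.1, le_rfl⟩)
  rcases key t ht.1 le_rfl with h1 | ⟨h1, h2⟩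
  · exact Or.inl (by linarith)
  · rcases le_or_gt (revenueTarget ε F T) ((s t).1 + v t) with h3 | h3
    · exact Or.inl h3
    · right
      rcases ht.2.eq_or_lt with rfl | h4
      · have := hcred t (Finset.mem_Icc.2 ⟨ht.1, le_rfl⟩)
        linarith
      · have h5 := hcred (t + 1) (Finset.mem_Icc.2 ⟨by omega, h4⟩)
        rw [Finset.sum_Ico_succ_top ht.1, expPayment_succ ht.1] at h5
        have h6 := expStep_le ε F T (t + 1)
        rw [h.round_eq ht.1 ht.2, h2]
        exact ⟨by linarith, by linarith⟩

lemma truthfulOptimalWhp_mInfinity (hF : IsValuationDist F) (hε0 : 0 < ε) (hε1 : ε < 1)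
    (hρ : (ρ : ℝ) = ε / (2 - ε)) (price : ℕ → ℝ≥0) :
    TruthfulOptimalWhp (fun T => mInfinity ε ρ (price T) F T) F := by
  have hc : 0 ≤ mean F * (1 - ε) := mul_nonneg (mean_nonneg hF) (by linarith)
  refine ⟨1, one_pos, ?_⟩
  filter_upwards [eventually_revenueTarget_le (ε := ε) hF hε0,
    eventually_le_creditEvent hF hε0 hε1] with T hT hcred Ω _ P _ π hπ
  have htruth := (ae_ball_iff (Finset.Icc 1 T).countable_toSet).2 hπ
  obtain ⟨N, hN, hNm, hN0⟩ := exists_measurable_superset_of_null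
    (ae_iff.1 ((π.ae_isTrajectory.and htruth).and (π.ae_value hF.ae_nonneg)))
  refine ⟨π.creditEvent ε \ N, (π.measurableSet_creditEvent ε).diff hNm, ?_, ?_⟩
  · rw [measureReal_def, measure_sdiff_null hN0]
    exact hcred _ _ Ω P π
  · rintro ω ⟨hω, hωN⟩ t ht
    obtain ⟨⟨h1, h2⟩, h3⟩ := not_not.1 fun hn => hωN (hN hn)
    have hkeep : ∀ j ∈ Finset.Icc 1 T, KeepsOnTrack ε F T (π.s j ω) (π.b j ω) := by
      intro j hj
      rw [h2 j hj]
      rw [Finset.mem_Icc] at hj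
      exact h1.keepsOnTrack_value hT hc hω (Finset.mem_Icc.2 hj)
        (fun i hi => h3 i (Finset.Icc_subset_Icc le_rfl hj.2 hi))
        (fun i hi => h2 i (Finset.mem_Icc.2 ⟨(Finset.mem_Ico.1 hi).1,
          (Finset.mem_Ico.1 hi).2.le.trans hj.2⟩))
    have ht' := Finset.mem_Icc.1 ht
    have h4 := h1.isOnTrack hF hε0 ht'.1 ht'.2 fun j hj => hkeep j
      (Finset.mem_Icc.2 ⟨(Finset.mem_Ico.1 hj).1, (Finset.mem_Ico.1 hj).2.le.trans ht'.2⟩)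
    have h5 := hkeep t ht
    have h6 := h1.eq_mk ht'.1 ht'.2
    rw [h6] at h4 h5 ⊢
    exact h4.isOptimalBid hF hε0 hε1 hρ hT ht h5

open Classical in
/-- An optimal policy of an infinite-lookahead buyer: bid the value as long as this keeps on track,
and otherwise pay up to the target at once. -/
noncomputable def trackBid (ε : ℝ) (F : Measure ℝ) (T : ℕ) (s : TargetState) (v : ℝ) : ℝ≥0 :=
  if KeepsOnTrack ε F T s v then v.toNNReal else (revenueTarget ε F T - s.1).toNNReal

lemma measurable_trackBid : Measurable fun q : TargetState × ℝ => trackBid ε F T q.1 q.2 := by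
  have hstep := measurable_expStep ε F T
  have h1 : MeasurableSet {q : TargetState × ℝ | revenueTarget ε F T ≤ q.1.1 + q.2} :=
    measurableSet_le (by fun_prop) (by fun_prop)
  have h2 : MeasurableSet {q : TargetState × ℝ |
      q.1.2.1 + expStep ε F T q.1.2.2 ≤ q.1.1 + q.2} :=
    measurableSet_le (by fun_prop) (by fun_prop)
  have h3 : MeasurableSet {q : TargetState × ℝ | q.1.2.1 + expStep ε F T q.1.2.2
      + expStep ε F T (q.1.2.2 + 1) ≤ revenueTarget ε F T} :=
    measurableSet_le (by fun_prop) (by fun_prop)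
  exact Measurable.ite (h1.union (h2.inter h3)) (by fun_prop) (by fun_prop)

lemma keepsOnTrack_trackBid (s : TargetState) {v : ℝ} (hv : 0 ≤ v) :
    KeepsOnTrack ε F T s (trackBid ε F T s v) := by
  unfold trackBid
  split_ifs with h
  · rwa [Real.coe_toNNReal _ hv]
  · left
    have := Real.le_coe_toNNReal (revenueTarget ε F T - s.1)
    linarith

lemma infinitePerRoundExPostIRWhp_mInfinity (hF : IsValuationDist F) (hε0 : 0 < ε) (hε1 : ε < 1)
    (hρ : (ρ : ℝ) = ε / (2 - ε)) (price : ℕ → ℝ≥0) :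
    InfinitePerRoundExPostIRWhp (fun T => mInfinity ε ρ (price T) F T) F := by
  have := hF.1
  have hc : 0 ≤ mean F * (1 - ε) := mul_nonneg (mean_nonneg hF) (by linarith)
  refine ⟨1, one_pos, ?_⟩
  filter_upwards [eventually_revenueTarget_le (ε := ε) hF hε0,
    eventually_le_creditEvent hF hε0 hε1] with T hT hcred
  set π : Play (mInfinity ε ρ (price T) F T) F T (Measure.infinitePi (drawLaw F ρ)) :=
    simPlay (measurable_trackBid (ε := ε) (F := F) (T := T)) with hπdef
  have hbid : ∀ t ω, π.b t ω = trackBid ε F T (π.s t ω) (π.v t ω) := fun t ω => rfl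
  have hkeep : ∀ᵐ ω ∂(Measure.infinitePi (drawLaw F ρ)), ∀ t ∈ Finset.Icc 1 T,
      KeepsOnTrack ε F T (π.s t ω) (π.b t ω) := by
    filter_upwards [π.ae_value hF.ae_nonneg] with ω hω t ht
    rw [hbid]
    exact keepsOnTrack_trackBid _ (hω t ht)
  have htrack : ∀ᵐ ω ∂(Measure.infinitePi (drawLaw F ρ)), ∀ t ∈ Finset.Icc 1 T,
      IsOnTrack ε F T t (π.s t ω) := by
    filter_upwards [π.ae_isTrajectory, hkeep] with ω h1 h2 t ht
    rw [Finset.mem_Icc] at ht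
    exact h1.isOnTrack hF hε0 ht.1 ht.2 fun j hj => h2 j
      (Finset.mem_Icc.2 ⟨(Finset.mem_Ico.1 hj).1, (Finset.mem_Ico.1 hj).2.le.trans ht.2⟩)
  refine ⟨ℕ → ℝ, inferInstance, Measure.infinitePi (drawLaw F ρ), inferInstance, π, ?_, ?_⟩
  · intro t ht
    filter_upwards [π.ae_isTrajectory, hkeep, htrack] with ω h1 h2 h3
    have ht' := Finset.mem_Icc.1 ht
    have h4 := h3 t ht
    have h5 := h2 t ht
    have h6 := h1.eq_mk ht'.1 ht'.2
    rw [show min (T - 1) (T - t) = T - t by omega]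
    rw [h6] at h4 h5 ⊢
    exact h4.isOptimalBid hF hε0 hε1 hρ hT ht h5
  · obtain ⟨N, hN, hNm, hN0⟩ := exists_measurable_superset_of_null
      (ae_iff.1 ((π.ae_isTrajectory.and htrack).and (π.ae_value hF.ae_nonneg)))
    refine ⟨π.creditEvent ε \ N, (π.measurableSet_creditEvent ε).diff hNm, ?_, ?_⟩
    · rw [measureReal_def, measure_sdiff_null hN0]
      exact hcred _ _ _ _ π
    · rintro ω ⟨hω, hωN⟩
      obtain ⟨⟨h1, h2⟩, h3⟩ := not_not.1 fun hn => hωN (hN hn)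
      have htruth : ∀ t ∈ Finset.Icc 1 T, (π.b t ω : ℝ) = π.v t ω := by
        intro t
        induction t using Nat.strong_induction_on with
        | _ t ih =>
          intro ht
          have ht' := Finset.mem_Icc.1 ht
          have h4 := h1.keepsOnTrack_value (v := (π.v · ω)) hT hc hω ht
            (fun i hi => h3 i (Finset.Icc_subset_Icc le_rfl ht'.2 hi))
            (fun i hi => ih i (Finset.mem_Ico.1 hi).2 (Finset.mem_Icc.2
              ⟨(Finset.mem_Ico.1 hi).1, (Finset.mem_Ico.1 hi).2.le.trans ht'.2⟩))
          rw [hbid, trackBid, if_pos h4, Real.coe_toNNReal _ (h3 t ht)]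
      intro t ht
      refine ⟨htruth t ht, ?_⟩
      have hpay : (mInfinity ε ρ (price T) F T).pay (π.s t ω) (π.b t ω) true ≤ π.v t ω := by
        rw [mInfinity_pay, htruth t ht]
        split_ifs
        · exact min_le_left _ _
        · exact h3 t ht
      rw [mInfinity_roundUtility, mInfinity_alloc, if_pos (h2 t ht).good]
      simpa using hpay

end Truthful

end RepeatedAuction

theorem theorem5 (ε : ℝ) (hε0 : 0 < ε) (hε1 : ε < 1) :
    ∃ (ρ : unitInterval) (price : MeasureTheory.Measure ℝ → ℕ → NNReal),
      (ρ : ℝ) = ε / (2 - ε) ∧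
      (∀ F : MeasureTheory.Measure ℝ, RepeatedAuction.IsValuationDist F → ∀ T : ℕ, 1 ≤ T →
        RepeatedAuction.NonPaymentForceful
          (RepeatedAuction.mInfinity ε ρ (price F T) F T) ∧
        RepeatedAuction.InterimIR
          (RepeatedAuction.mInfinity ε ρ (price F T) F T) F T ∧
        RepeatedAuction.MyopicPerRoundExPostIR
          (RepeatedAuction.mInfinity ε ρ (price F T) F T) F T) ∧
      RepeatedAuction.RobustLookahead
        (fun F T => RepeatedAuction.mInfinity ε ρ (price F T) F T) (ε / 2) (1 - ε) ∧
      ∀ F : MeasureTheory.Measure ℝ, RepeatedAuction.IsValuationDist F →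
        RepeatedAuction.InfinitePerRoundExPostIRWhp
          (fun T => RepeatedAuction.mInfinity ε ρ (price F T) F T) F ∧
        RepeatedAuction.TruthfulOptimalWhp
          (fun T => RepeatedAuction.mInfinity ε ρ (price F T) F T) F := by
  have hρ0 : 0 ≤ ε / (2 - ε) := div_nonneg hε0.le (by linarith)
  have hρ1 : ε / (2 - ε) ≤ 1 := by rw [div_le_one (by linarith)]; linarith
  refine ⟨⟨ε / (2 - ε), hρ0, hρ1⟩, RepeatedAuction.reservePrice, rfl, fun F hF T _ => ⟨?_, ?_, ?_⟩,
    RepeatedAuction.robustLookahead_mInfinity hε0 hε1 rfl, fun F hF => ⟨?_, ?_⟩⟩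
  · exact RepeatedAuction.mInfinity_nonPaymentForceful
  · exact RepeatedAuction.mInfinity_nonPaymentForceful.interimIR hF T
  · exact RepeatedAuction.myopicPerRoundExPostIR_mInfinity hF
  · exact RepeatedAuction.infinitePerRoundExPostIRWhp_mInfinity hF hε0 hε1 rfl _
  · exact RepeatedAuction.truthfulOptimalWhp_mInfinity hF hε0 hε1 rfl _
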